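/- For $p,q$ in the simplex $\Delta_n=\{\lambda\in\mathbb R^n:\lambda\ge 0,\ \sum_i\lambda_i=1\}$ let $\mathcal M(p,q)$ be the set of nonnegative $n\times n$ matrices with row sums $p$ and column sums $q$. For points $x_1,\dots,x_n\in\mathbb R^d$ let $W_2(p,q)$ be the 2-Wasserstein distance, with respect to the Euclidean distance, between $\sum_i p_i\delta_{x_i}$ and $\sum_i q_i\delta_{x_i}$. **Algorithm.** Input: $x_1,\dots,x_n$, $p,q\in\Delta_n$, $\varepsilon$. Put $\eta=\frac{20\log n}{\varepsilon}$, $M=\lceil\frac{300\log n}{\varepsilon}\rceil$, $\sigma=\frac1{\sqrt{2\eta}}$, $\delta=\frac{\varepsilon}{10}$. 1. (Taylor approximation of the Gaussian kernel.) Let $V$ be the matrix with columns indexed by $i\in\{1,\dots,n\}$, rows indexed by the $\binom{M-1+d}{d}$ exponents $v\in\mathbb N^d$ with $\sum_j v_j<M$, and entries $e^{-\|x_i\|^2/(2\sigma^2)}\prod_{j=1}^d (x_{i,j}/\sigma)^{v_j}/\sqrt{v_j!}$. Put $\tilde K=V^\top V$. 2. (Sinkhorn scaling.) Put $\tau=\delta/8$,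 $p'=(1-\tau)p+\frac\tau n\mathbf 1$, $q'=(1-\tau)q+\frac\tau n\mathbf 1$, $D_1=D_2=I$. While $\|D_1\tilde KD_2\mathbf 1-p'\|_1+\|(D_1\tilde KD_2)^\top\mathbf 1-q'\|_1>\delta/2$, rescale alternately (rows first) $D_1$ so that $D_1\tilde KD_2$ has row sums $p'$, or $D_2$ so that it has column sums $q'$. 3. (Rounding.) With $F=D_1\tilde KD_2$, multiply row $i$ of $F$ by $\min(1,p_i/(F\mathbf 1)_i)$ to get $F'$, then column $j$ of $F'$ by $\min(1,q_j/(F'^\top\mathbf 1)_j)$ to get $F''$. With $a=p-F''\mathbf 1$ and $b=q-F''^\top\mathbf 1$ put $\hat P=F''+ab^\top/\|a\|_1$ ($\hat P=F''$ if $a=0$). 4. Compute $\hat W=\sum_i\|x_i\|^2(p_i+q_i)-2\langle\hat P,X^\top X\rangle$, $X=[x_1|\cdots|x_n]$, from the factors of $\hat P$. All $n\times n$ matrices are kept in factored form only. Arithmetic is exact; an operation on numbers is charged $1+\ell$ plus the number of bits of the integer part of its result, where $\ell=O(\frac{\log n}{\varepsilon})$ is the number of binary places that are kept, and bookkeeping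 steps are charged $1$. **Theorem 1.** Let $n\ge 2$, $d\ge 1$, let $x_1,\dots,x_n$ lie in the closed Euclidean unit ball of $\mathbb R^d$, let $p,q\in\Delta_n$ and $\varepsilon\in(0,1)$. Then the algorithm halts and returns a feasible coupling $\hat P\in\mathcal M(p,q)$, as a factorization with at most $1+\binom{M-1+d}{d}$ rank-one terms, and the scalar $\hat W=\sum_{i,j=1}^n\hat P_{ij}\|x_i-x_j\|^2$, such that $$\hat W\le W_2^2(p,q)+\varepsilon,$$ in time $$O\left(n\,\frac{d\log n}{\varepsilon^2}\left(e+\frac{900\log n}{\varepsilon d}\right)^{d+1}\right),$$ where the implied constant depends only on the one in $\ell=O(\frac{\log n}{\varepsilon})$. -/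

import Mathlib

open MeasureTheory
open scoped ENNReal

noncomputable section

namespace FastOT

/-! ## Transport -/

/-- The transportation polytope: nonnegative matrices with row sums `p` and column sums `q`. -/
def transportPolytope {n : ℕ} (p q : Fin n → ℝ) : Set (Matrix (Fin n) (Fin n) ℝ) :=
  {P | (∀ i j, 0 ≤ P i j) ∧ (∀ i, ∑ j, P i j = p i) ∧ (∀ j, ∑ i, P i j = q j)}

/-- The discrete distribution with mass `p i` at `x i`. -/
def discreteMeasure {n d : ℕ} (x : Fin n → EuclideanSpace ℝ (Fin d)) (p : Fin n → ℝ) :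
    Measure (EuclideanSpace ℝ (Fin d)) :=
  ∑ i, ENNReal.ofReal (p i) • Measure.dirac (x i)

/-- The couplings of two measures. -/
def couplings {d : ℕ} (μ ν : Measure (EuclideanSpace ℝ (Fin d))) :
    Set (Measure (EuclideanSpace ℝ (Fin d) × EuclideanSpace ℝ (Fin d))) :=
  {γ | γ.map Prod.fst = μ ∧ γ.map Prod.snd = ν}

/-- The `s`-Wasserstein distance for the Euclidean metric. -/
def wasserstein {d : ℕ} (s : ℝ) (μ ν : Measure (EuclideanSpace ℝ (Fin d))) : ℝ≥0∞ :=
  ⨅ γ ∈ couplings μ ν, (∫⁻ z, edist z.1 z.2 ^ s ∂γ) ^ (1 / s)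

/-! ## Machine model

A deterministic sequential machine that computes with real numbers. Numbers are thought of as kept
in fixed point with `ℓ` binary digits after the point, and an operation on numbers is charged the
length of its result (`ℓ`, plus the length of the integer part of the result, plus one). The
arithmetic itself is exact. Bookkeeping (loop counters, array writes) is charged one step. -/

/-- Programs with a result in `α`: the state is the time elapsed so far, and a run may diverge. -/
def RAM (_ℓ : ℕ) : Type → Type := StateT ℕ Part

instance (ℓ : ℕ) : Monad (RAM ℓ) := inferInstanceAs (Monad (StateT ℕ Part))

instance (ℓ : ℕ) : LawfulMonad (RAM ℓ) := inferInstanceAs (LawfulMonad (StateT ℕ Part))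

namespace RAM

variable {ℓ : ℕ} {α σ : Type}

/-- Run the program from time `t`; the outcome is the result and the time at the end. -/
def run (c : RAM ℓ α) (t : ℕ) : Part (α × ℕ) := StateT.run (m := Part) c t

/-- The program, started at time `0`, halts with result `a` after time `T`. -/
def HaltsWith (c : RAM ℓ α) (a : α) (T : ℕ) : Prop := (a, T) ∈ c.run 0

/-- Let time `c` pass. -/
def tick (c : ℕ) : RAM ℓ Unit := fun t => Part.some ((), t + c)

/-- The charge for an operation with result `y`. -/
def charge (ℓ : ℕ) (y : ℝ) : ℕ := 1 + ℓ + Nat.size ⌊|y|⌋₊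

/-- A basic operation with result `y`. -/
def prim (y : ℝ) : RAM ℓ ℝ := fun t => Part.some (y, t + charge ℓ y)

/-! The basic operations. -/

def lit (k : ℕ) : RAM ℓ ℝ := prim (k : ℝ)
def add (x y : ℝ) : RAM ℓ ℝ := prim (x + y)
def sub (x y : ℝ) : RAM ℓ ℝ := prim (x - y)
def mul (x y : ℝ) : RAM ℓ ℝ := prim (x * y)
def div (x y : ℝ) : RAM ℓ ℝ := prim (x / y)
def abs (x : ℝ) : RAM ℓ ℝ := prim |x|
def min (x y : ℝ) : RAM ℓ ℝ := prim (x ⊓ y)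
def sqrt (x : ℝ) : RAM ℓ ℝ := prim (Real.sqrt x)
def exp (x : ℝ) : RAM ℓ ℝ := prim (Real.exp x)
def log (x : ℝ) : RAM ℓ ℝ := prim (Real.log x)
def le (x y : ℝ) : RAM ℓ Bool := fun t => Part.some (decide (x ≤ y), t + charge ℓ (x - y))
def ceil (x : ℝ) : RAM ℓ ℕ := fun t => Part.some (⌈x⌉₊, t + charge ℓ x)

/-! Control structures. -/

/-- `for i = 0, …, n - 1 do a ← body i a`. -/
def forLoop : (n : ℕ) → (Fin n → α → RAM ℓ α) → α → RAM ℓ α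
  | 0, _, a => pure a
  | n + 1, body, a => do
    let a ← forLoop n (fun i => body i.castSucc) a
    tick 1
    body (Fin.last n) a

/-- Fill an array of length `n`. -/
def tabulate : (n : ℕ) → (Fin n → RAM ℓ α) → RAM ℓ (Fin n → α)
  | 0, _ => pure Fin.elim0
  | n + 1, f => do
    let g ← tabulate n (fun i => f i.castSucc)
    let a ← f (Fin.last n)
    tick 1
    return Fin.snoc (α := fun _ => α) g a

/-- One pass through a loop, as a partial function of the state of the loop and the time. It takes
one step in addition to the time of `body`. -/
def loopPass (body : σ → RAM ℓ (α ⊕ σ)) : σ × ℕ →. (α × ℕ) ⊕ (σ × ℕ) := fun st =>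
  ((body st.1).run (st.2 + 1)).map
    (fun rt => rt.1.map (fun a => (a, rt.2)) (fun s' => (s', rt.2)))

/-- Repeat `body` from the state `s` until it returns a final result; the run diverges if it never
does. -/
def repeatUntil (body : σ → RAM ℓ (α ⊕ σ)) (s : σ) : RAM ℓ α := fun t =>
  PFun.fix (loopPass body) (s, t)

/-- The sum of the `n` numbers computed by `f`. -/
def sumLoop (n : ℕ) (f : Fin n → RAM ℓ ℝ) : RAM ℓ ℝ := do
  let z ← lit 0
  forLoop n (fun i s => do let a ← f i; add s a) z

end RAM

open RAM

variable {ℓ n d r : ℕ}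

/-! ## Linear algebra with factored matrices

An `n × n` matrix of rank at most `r` is given by two arrays `L`, `R` of shape `n × r` and stands
for `L Rᵀ`; the `n × n` matrix is never formed. -/

/-- An `n × n` matrix in factored form. -/
structure Factored (n : ℕ) where
  rank : ℕ
  left : Fin n → Fin rank → ℝ
  right : Fin n → Fin rank → ℝ

/-- The matrix that a factorization stands for. -/
def Factored.toMatrix (F : Factored n) : Matrix (Fin n) (Fin n) ℝ :=
  Matrix.of fun i j => ∑ k, F.left i k * F.right j k

/-- `A w`. -/
def mulVec (A : Fin n → Fin r → ℝ) (w : Fin r → ℝ) : RAM ℓ (Fin n → ℝ) :=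
  tabulate n fun i => sumLoop r fun k => mul (A i k) (w k)

/-- `Aᵀ a`. -/
def tMulVec (A : Fin n → Fin r → ℝ) (a : Fin n → ℝ) : RAM ℓ (Fin r → ℝ) :=
  tabulate r fun k => sumLoop n fun i => mul (A i k) (a i)

/-- `(L Rᵀ) b`. -/
def factoredMulVec (L R : Fin n → Fin r → ℝ) (b : Fin n → ℝ) : RAM ℓ (Fin n → ℝ) := do
  let w ← tMulVec R b
  mulVec L w

/-- The product of the diagonal matrix with diagonal `a` and `A`. -/
def diagMul (a : Fin n → ℝ) (A : Fin n → Fin r → ℝ) : RAM ℓ (Fin n → Fin r → ℝ) :=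
  tabulate n fun i => tabulate r fun k => mul (a i) (A i k)

/-- `‖a - b‖₁`. -/
def l1Dist (a b : Fin n → ℝ) : RAM ℓ ℝ :=
  sumLoop n fun i => do abs (← sub (a i) (b i))

/-- `‖y‖²`. -/
def sqNorm (y : EuclideanSpace ℝ (Fin d)) : RAM ℓ ℝ :=
  sumLoop d fun l => mul (y l) (y l)

/-! ## Low-rank approximation of the Gaussian kernel matrix -/

/-- The exponents `v ∈ ℕ^d` with `∑ v_j < M`. -/
def exponents (d M : ℕ) : List (Fin d → ℕ) :=
  (List.range M).flatMap (List.Nat.antidiagonalTuple d)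

/-- The feature `exp (-‖y‖² / (2 s²)) ∏_j (y_j / s) ^ v_j / √(v_j !)`. -/
def feature (s : ℝ) (y : EuclideanSpace ℝ (Fin d)) (v : Fin d → ℕ) : RAM ℓ ℝ := do
  let a ← sqNorm y
  let b ← mul (← lit 2) (← mul s s)
  let c ← exp (← sub (← lit 0) (← div a b))
  forLoop d (fun j c =>
    forLoop (v j) (fun m c => do
      let c ← mul c (← div (y j) s)
      div c (← sqrt (← lit (m + 1)))) c) c

/-- The `n × r` array of all features of all points, `r` the number of exponents. (It is the
transpose of the matrix usually written `V_M`.) Listing the exponents takes `d + 1` steps each. -/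
def taylorGKM (x : Fin n → EuclideanSpace ℝ (Fin d)) (s : ℝ) (M : ℕ) :
    RAM ℓ (Fin n → Fin (exponents d M).length → ℝ) := do
  tick ((d + 1) * (exponents d M).length)
  tabulate n fun i => tabulate (exponents d M).length fun k =>
    feature s (x i) ((exponents d M).get k)

/-! ## Sinkhorn scaling of `V Vᵀ` -/

/-- `(1 - τ) p + (τ / n) 1`. -/
def smooth (τ : ℝ) (p : Fin n → ℝ) : RAM ℓ (Fin n → ℝ) := do
  let s ← sub (← lit 1) τ
  let t ← div τ (← lit n)
  tabulate n fun i => do add (← mul s (p i)) t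

/-- One pass through the loop of Sinkhorn scaling. The state is the number `k` of updates so far
and the diagonals `a`, `b` of `D₁`, `D₂`. Stop if the marginals of `D₁ V Vᵀ D₂` are within `δ / 2`
of `p`, `q`; otherwise renormalize the rows (`k` even, the next update has an odd number) or the
columns. -/
def sinkhornStep (V : Fin n → Fin r → ℝ) (p q : Fin n → ℝ) (δ : ℝ)
    (state : ℕ × (Fin n → ℝ) × (Fin n → ℝ)) :
    RAM ℓ (((Fin n → ℝ) × (Fin n → ℝ)) ⊕ (ℕ × (Fin n → ℝ) × (Fin n → ℝ))) := do
  let (k, a, b) := state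
  let Kb ← factoredMulVec V V b
  let rows ← tabulate n fun i => mul (a i) (Kb i)
  let Ka ← factoredMulVec V V a
  let cols ← tabulate n fun j => mul (b j) (Ka j)
  let err ← add (← l1Dist rows p) (← l1Dist cols q)
  if ← le err (← div δ (← lit 2)) then
    return Sum.inl (a, b)
  else if k % 2 = 0 then
    let a' ← tabulate n fun i => do div (← mul (a i) (p i)) (rows i)
    return Sum.inr (k + 1, a', b)
  else
    let b' ← tabulate n fun j => do div (← mul (b j) (q j)) (cols j)
    return Sum.inr (k + 1, a, b')

/-- Sinkhorn scaling; returns the diagonals of `D₁` and `D₂`. -/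
def sinkhorn (V : Fin n → Fin r → ℝ) (p q : Fin n → ℝ) (δ : ℝ) :
    RAM ℓ ((Fin n → ℝ) × (Fin n → ℝ)) := do
  let τ ← div δ (← lit 8)
  let p' ← smooth τ p
  let q' ← smooth τ q
  let a ← tabulate n fun _ => lit 1
  let b ← tabulate n fun _ => lit 1
  repeatUntil (sinkhornStep V p' q' δ) (0, a, b)

/-! ## Rounding `F = L Rᵀ` to the transportation polytope -/

/-- Scale the rows of `F` down to at most `p`, then the columns down to at most `q`, and add the
rank-one correction `err_r err_cᵀ / ‖err_r‖₁` (which is `0` if `err_r = 0`). -/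
def round (L R : Fin n → Fin r → ℝ) (p q : Fin n → ℝ) : RAM ℓ (Factored n) := do
  let ones ← tabulate n fun _ => lit 1
  let rows ← factoredMulVec L R ones
  let x ← tabulate n fun i => do min (← div (p i) (rows i)) (← lit 1)
  let L' ← diagMul x L
  let cols ← factoredMulVec R L' ones
  let y ← tabulate n fun j => do min (← div (q j) (cols j)) (← lit 1)
  let R' ← diagMul y R
  let rows' ← factoredMulVec L' R' ones
  let cols' ← factoredMulVec R' L' ones
  let errR ← tabulate n fun i => sub (p i) (rows' i)
  let errC ← tabulate n fun j => sub (q j) (cols' j)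
  let s ← sumLoop n fun i => abs (errR i)
  let u ← if ← le s (← lit 0) then pure errR else tabulate n fun i => div (errR i) s
  let left ← tabulate n fun i => pure (Fin.snoc (α := fun _ => ℝ) (L' i) (u i))
  let right ← tabulate n fun j => pure (Fin.snoc (α := fun _ => ℝ) (R' j) (errC j))
  return { rank := r + 1, left := left, right := right }

/-! ## The cost of a factored coupling, through `C = y 1ᵀ + 1 yᵀ - 2 Xᵀ X` -/

/-- `∑ i, ‖x i‖² (p i + q i) - 2 ∑ k, ∑ l, (∑ i, x i l * L i k) * (∑ j, x j l * R j k)`. -/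
def quadCost (x : Fin n → EuclideanSpace ℝ (Fin d)) (p q : Fin n → ℝ) (P : Factored n) :
    RAM ℓ ℝ := do
  let y ← tabulate n fun i => sqNorm (x i)
  let s ← sumLoop n fun i => do mul (y i) (← add (p i) (q i))
  let t ← sumLoop P.rank fun k => sumLoop d fun l => do
    let f ← sumLoop n fun i => mul (x i l) (P.left i k)
    let g ← sumLoop n fun j => mul (x j l) (P.right j k)
    mul f g
  sub s (← mul (← lit 2) t)

/-! ## The algorithm -/

/-- Input: points `x`, weights `p`, `q`, accuracy `ε`. Output: a coupling in factored form and its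
cost. -/
def algorithm (x : Fin n → EuclideanSpace ℝ (Fin d)) (p q : Fin n → ℝ) (ε : ℝ) :
    RAM ℓ (Factored n × ℝ) := do
  let logn ← log (← lit n)
  let η ← div (← mul (← lit 20) logn) ε
  let M ← ceil (← div (← mul (← lit 300) logn) ε)
  let s ← div (← lit 1) (← sqrt (← mul (← lit 2) η))
  let V ← taylorGKM x s M
  let (D₁, D₂) ← sinkhorn V p q (← div ε (← lit 10))
  let L ← diagMul D₁ V
  let R ← diagMul D₂ V
  let P ← round L R p q
  let W ← quadCost x p q P
  return (P, W)

end FastOT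

end

open MeasureTheory
open scoped ENNReal

noncomputable section

namespace FastOT

namespace RAM

variable {ℓ : ℕ} {α β σ : Type}

/-- The program `c` halts with result `a` after time at most `T`, whenever it is started. -/
def RunsIn (c : RAM ℓ α) (a : α) (T : ℕ) : Prop := ∀ t, ∃ t' ≤ t + T, (a, t') ∈ c.run t

theorem RunsIn.mono {c : RAM ℓ α} {a : α} {T T' : ℕ} (h : RunsIn c a T) (hT : T ≤ T') :
    RunsIn c a T' := fun t =>
  let ⟨t', h1, h2⟩ := h t
  ⟨t', h1.trans (by omega), h2⟩

theorem RunsIn.congr {c : RAM ℓ α} {a a' : α} {T : ℕ} (h : RunsIn c a T) (ha : a = a') :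
    RunsIn c a' T := ha ▸ h

theorem runsIn_pure (a : α) : RunsIn (pure a : RAM ℓ α) a 0 := fun t =>
  ⟨t, by simp, by
    change (a, t) ∈ (Part.some (a, t) : Part (α × ℕ))
    exact Part.mem_some _⟩

theorem RunsIn.bind {c : RAM ℓ α} {f : α → RAM ℓ β} {a : α} {b : β} {T₁ T₂ : ℕ}
    (h₁ : RunsIn c a T₁) (h₂ : RunsIn (f a) b T₂) : RunsIn (c >>= f) b (T₁ + T₂) := fun t => by
  obtain ⟨t₁, ht₁, m₁⟩ := h₁ t
  obtain ⟨t₂, ht₂, m₂⟩ := h₂ t₁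
  refine ⟨t₂, by omega, ?_⟩
  change (b, t₂) ∈ (c.run t).bind fun at' => (f at'.1).run at'.2
  exact Part.mem_bind_iff.2 ⟨_, m₁, m₂⟩

theorem runsIn_tick (c : ℕ) : RunsIn (tick c : RAM ℓ Unit) () c := fun t =>
  ⟨t + c, le_rfl, Part.mem_some _⟩

theorem charge_mono {x y : ℝ} (h : |x| ≤ y) : charge ℓ x ≤ charge ℓ y := by
  have : |x| ≤ |y| := h.trans (le_abs_self y)
  unfold charge
  have := Nat.size_le_size (Nat.floor_mono this)
  omega

section Basic

variable {B : ℝ}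

theorem runsIn_prim {y : ℝ} (h : |y| ≤ B) : RunsIn (prim y : RAM ℓ ℝ) y (charge ℓ B) := fun t =>
  ⟨t + charge ℓ y, by have := charge_mono (ℓ := ℓ) h; omega, Part.mem_some _⟩

theorem runsIn_lit {k : ℕ} (h : (k : ℝ) ≤ B) : RunsIn (lit k : RAM ℓ ℝ) (k : ℝ) (charge ℓ B) :=
  runsIn_prim (by simpa using h)

theorem runsIn_add {x y : ℝ} (h : |x + y| ≤ B) :
    RunsIn (add x y : RAM ℓ ℝ) (x + y) (charge ℓ B) := runsIn_prim h

theorem runsIn_sub {x y : ℝ} (h : |x - y| ≤ B) :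
    RunsIn (sub x y : RAM ℓ ℝ) (x - y) (charge ℓ B) := runsIn_prim h

theorem runsIn_mul {x y : ℝ} (h : |x * y| ≤ B) :
    RunsIn (mul x y : RAM ℓ ℝ) (x * y) (charge ℓ B) := runsIn_prim h

theorem runsIn_div {x y : ℝ} (h : |x / y| ≤ B) :
    RunsIn (div x y : RAM ℓ ℝ) (x / y) (charge ℓ B) := runsIn_prim h

theorem runsIn_abs {x : ℝ} (h : |x| ≤ B) :
    RunsIn (abs x : RAM ℓ ℝ) |x| (charge ℓ B) := runsIn_prim (by simpa using h)

theorem runsIn_min {x y : ℝ} (h : |x ⊓ y| ≤ B) :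
    RunsIn (min x y : RAM ℓ ℝ) (x ⊓ y) (charge ℓ B) := runsIn_prim h

theorem runsIn_sqrt {x : ℝ} (h : Real.sqrt x ≤ B) :
    RunsIn (sqrt x : RAM ℓ ℝ) (Real.sqrt x) (charge ℓ B) :=
  runsIn_prim (by rwa [abs_of_nonneg (Real.sqrt_nonneg x)])

theorem runsIn_exp {x : ℝ} (h : Real.exp x ≤ B) :
    RunsIn (exp x : RAM ℓ ℝ) (Real.exp x) (charge ℓ B) := runsIn_prim (by simpa using h)

theorem runsIn_log {x : ℝ} (h : |Real.log x| ≤ B) :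
    RunsIn (log x : RAM ℓ ℝ) (Real.log x) (charge ℓ B) := runsIn_prim h

theorem runsIn_le {x y : ℝ} (h : |x - y| ≤ B) :
    RunsIn (le x y : RAM ℓ Bool) (decide (x ≤ y)) (charge ℓ B) := fun t =>
  ⟨t + charge ℓ (x - y), by have := charge_mono (ℓ := ℓ) h; omega, Part.mem_some _⟩

theorem runsIn_ceil {x : ℝ} (h : |x| ≤ B) : RunsIn (ceil x : RAM ℓ ℕ) ⌈x⌉₊ (charge ℓ B) := fun t =>
  ⟨t + charge ℓ x, by have := charge_mono (ℓ := ℓ) h; omega, Part.mem_some _⟩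

end Basic

theorem runsIn_forLoop : ∀ {n : ℕ} {body : Fin n → α → RAM ℓ α} (s : ℕ → α) {T : Fin n → ℕ},
    (∀ i : Fin n, RunsIn (body i (s i)) (s (i + 1)) (T i)) →
    RunsIn (forLoop n body (s 0)) (s n) (∑ i, (T i + 1))
  | 0, _, s, _, _ => by simpa [forLoop] using runsIn_pure (s 0)
  | n + 1, body, s, T, h => by
    rw [Fin.sum_univ_castSucc, add_comm (T (Fin.last n)) 1]
    exact (runsIn_forLoop s fun i => h i.castSucc).bind ((runsIn_tick 1).bind (h (Fin.last n)))

theorem runsIn_tabulate : ∀ {n : ℕ} {f : Fin n → RAM ℓ α} {a : Fin n → α} {T : ℕ},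
    (∀ i, RunsIn (f i) (a i) T) → RunsIn (tabulate n f) a (n * (T + 1))
  | 0, _, a, _, _ => by
    simpa [tabulate] using (runsIn_pure (ℓ := ℓ) (Fin.elim0 : Fin 0 → α)).congr
      (Subsingleton.elim _ a)
  | n + 1, f, a, T, h => by
    have key : RunsIn (tabulate (n + 1) f) (Fin.snoc (α := fun _ => α)
        (fun i => a i.castSucc) (a (Fin.last n))) (n * (T + 1) + (T + (1 + 0))) :=
      (runsIn_tabulate fun i => h i.castSucc).bind ((h (Fin.last n)).bind
        ((runsIn_tick 1).bind (runsIn_pure _)))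
    have e : (Fin.snoc (α := fun _ => α) (fun i => a i.castSucc) (a (Fin.last n))) = a :=
      Fin.snoc_init_self a
    exact (key.congr e).mono (by ring_nf; rfl)

theorem runsIn_sumLoop {n : ℕ} {B : ℝ} {f : Fin n → RAM ℓ ℝ} {a : Fin n → ℝ} {T : ℕ} (hB : 0 ≤ B)
    (h : ∀ i, RunsIn (f i) (a i) T) (ha : ∑ i, |a i| ≤ B) :
    RunsIn (sumLoop n f) (∑ i, a i) (n * (T + charge ℓ B + 1) + charge ℓ B) := by
  classical
  let s : ℕ → ℝ := fun m => ∑ i : Fin n with i.val < m, a i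
  have hs : ∀ i : Fin n, s (i + 1) = s i + a i := fun i => by
    have : (Finset.univ.filter fun j : Fin n => j.val < i + 1) =
        insert i (Finset.univ.filter fun j : Fin n => j.val < i) := by
      ext j; simp [Fin.ext_iff]; omega
    simp only [s]
    rw [this, Finset.sum_insert (by simp), add_comm]
  have hbd : ∀ m, |s m| ≤ B := fun m =>
    (Finset.abs_sum_le_sum_abs _ _).trans ((Finset.sum_le_sum_of_subset_of_nonneg
      (Finset.filter_subset _ _) fun _ _ _ => abs_nonneg _).trans ha)
  have h0 : s 0 = ((0 : ℕ) : ℝ) := by simp [s]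
  have hn : s n = ∑ i, a i := by simp [s]
  have key := runsIn_forLoop (ℓ := ℓ) (body := fun i s => do let a ← f i; add s a) s
    (T := fun _ => T + charge ℓ B) fun i => by
      rw [hs]
      exact (h i).bind (runsIn_add (by rw [← hs]; exact hbd _))
  rw [hn, h0] at key
  have := (runsIn_lit (ℓ := ℓ) (k := 0) (B := B) (by simpa using hB)).bind key
  exact this.mono (by simp; ring_nf; rfl)

theorem runsIn_repeatUntil {body : σ → RAM ℓ (α ⊕ σ)} {T : ℕ} {a : α} :
    ∀ (N : ℕ) (s : ℕ → σ), (∀ k < N, RunsIn (body (s k)) (Sum.inr (s (k + 1))) T) →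
    RunsIn (body (s N)) (Sum.inl a) T → RunsIn (repeatUntil body (s 0)) a ((N + 1) * (T + 1))
  | 0, s, _, h => fun t => by
    obtain ⟨t', ht, m⟩ := h (t + 1)
    refine ⟨t', by omega, ?_⟩
    exact PFun.fix_stop (Part.mem_map_iff _ |>.2 ⟨_, m, rfl⟩)
  | N + 1, s, h, h' => fun t => by
    obtain ⟨t₁, ht₁, m₁⟩ := h 0 (by omega) (t + 1)
    obtain ⟨t₂, ht₂, m₂⟩ := runsIn_repeatUntil N (fun k => s (k + 1))
      (fun k hk => h (k + 1) (by omega)) h' t₁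
    refine ⟨t₂, ht₂.trans ?_, ?_⟩
    · have : (N + 1 + 1) * (T + 1) = (N + 1) * (T + 1) + (T + 1) := by ring
      omega
    · have : Sum.inr (s 1, t₁) ∈ loopPass body (s 0, t) :=
        Part.mem_map_iff _ |>.2 ⟨_, m₁, rfl⟩
      change _ ∈ PFun.fix (loopPass body) (s 0, t)
      rw [PFun.fix_fwd_eq this]
      exact m₂

end RAM


/-! ## Convergence of Sinkhorn scaling -/

theorem sq_l1_le_relEntropy {ι : Type*} [Fintype ι] {p r : ι → ℝ} (hp : ∀ i, 0 < p i)
    (hr : ∀ i, 0 < r i) (hp1 : ∑ i, p i = 1) (hr1 : ∑ i, r i = 1) :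
    (∑ i, |r i - p i|) ^ 2 / 4 ≤ ∑ i, p i * (Real.log (p i) - Real.log (r i)) := by
  set s : ι → ℝ := fun i => Real.sqrt (p i)
  set t : ι → ℝ := fun i => Real.sqrt (r i)
  have hs : ∀ i, 0 < s i := fun i => Real.sqrt_pos.2 (hp i)
  have ht : ∀ i, 0 < t i := fun i => Real.sqrt_pos.2 (hr i)
  have hs2 : ∀ i, s i ^ 2 = p i := fun i => Real.sq_sqrt (hp i).le
  have ht2 : ∀ i, t i ^ 2 = r i := fun i => Real.sq_sqrt (hr i).le
  have h1 : ∑ i, (s i - t i) ^ 2 ≤ ∑ i, p i * (Real.log (p i) - Real.log (r i)) := by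
    have e : ∑ i, (s i - t i) ^ 2 = ∑ i, (2 * p i - 2 * (s i * t i)) := by
      have : ∀ i, (s i - t i) ^ 2 = (2 * p i - 2 * (s i * t i)) + (r i - p i) := fun i => by
        rw [← hs2, ← ht2]; ring
      simp_rw [this]
      rw [Finset.sum_add_distrib, Finset.sum_sub_distrib _ p, hp1, hr1]; ring
    rw [e]
    refine Finset.sum_le_sum fun i _ => ?_
    have hl := Real.log_le_sub_one_of_pos (div_pos (ht i) (hs i))
    rw [Real.log_div (ht i).ne' (hs i).ne'] at hl
    have e1 : Real.log (p i) = 2 * Real.log (s i) := by rw [← hs2, Real.log_pow]; simp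
    have e2 : Real.log (r i) = 2 * Real.log (t i) := by rw [← ht2, Real.log_pow]; simp
    have e3 : p i * (t i / s i) = s i * t i := by
      rw [← hs2]; field_simp [(hs i).ne']
    rw [e1, e2]
    nlinarith [mul_le_mul_of_nonneg_left hl (hp i).le]
  refine le_trans ?_ h1
  have h2 : (∑ i, |r i - p i|) ^ 2 ≤ (∑ i, (s i - t i) ^ 2) * ∑ i, (s i + t i) ^ 2 := by
    have : ∀ i, |r i - p i| = |s i - t i| * (s i + t i) := fun i => by
      rw [← hs2, ← ht2, abs_sub_comm, sq_sub_sq, abs_mul, abs_of_pos (add_pos (hs i) (ht i)),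
        mul_comm]
    simp_rw [this]
    refine (Finset.sum_mul_sq_le_sq_mul_sq _ _ _).trans (le_of_eq ?_)
    simp only [sq_abs]
  have h3 : ∑ i, (s i + t i) ^ 2 ≤ 4 := by
    have : ∀ i, (s i + t i) ^ 2 ≤ 2 * p i + 2 * r i := fun i => by
      rw [← hs2, ← ht2]; nlinarith [sq_nonneg (s i - t i)]
    refine (Finset.sum_le_sum fun i _ => this i).trans ?_
    rw [Finset.sum_add_distrib, ← Finset.mul_sum, ← Finset.mul_sum, hp1, hr1]; norm_num
  have h4 : 0 ≤ ∑ i, (s i - t i) ^ 2 := Finset.sum_nonneg fun i _ => sq_nonneg _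
  nlinarith

theorem sum_sub_mul_le_l1_mul {ι : Type*} [Fintype ι] [Nonempty ι] {p r u : ι → ℝ} {R : ℝ}
    (h : ∑ i, p i = ∑ i, r i) (hu : ∀ i j, u i - u j ≤ R) :
    ∑ i, (r i - p i) * u i ≤ (∑ i, |r i - p i|) * (R / 2) := by
  obtain ⟨j, hj⟩ := Finite.exists_min u
  have e : ∑ i, (r i - p i) * u i = ∑ i, (r i - p i) * (u i - u j) := by
    simp_rw [mul_sub]
    rw [Finset.sum_sub_distrib, ← Finset.sum_mul, Finset.sum_sub_distrib, h]; ring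
  have e2 : (∑ i, |r i - p i|) * (R / 2) = ∑ i, ((|r i - p i| + (r i - p i)) / 2 * R) := by
    rw [← Finset.sum_mul, ← Finset.sum_div, Finset.sum_add_distrib, Finset.sum_sub_distrib, h]
    ring
  rw [e, e2]
  refine Finset.sum_le_sum fun i _ => ?_
  have h1 : 0 ≤ (|r i - p i| + (r i - p i)) / 2 := by linarith [neg_abs_le (r i - p i)]
  have h2 : r i - p i ≤ (|r i - p i| + (r i - p i)) / 2 := by linarith [le_abs_self (r i - p i)]
  calc _ ≤ (|r i - p i| + (r i - p i)) / 2 * (u i - u j) :=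
        mul_le_mul_of_nonneg_right h2 (by linarith [hj i])
    _ ≤ _ := mul_le_mul_of_nonneg_left (hu i j) h1

/-- A nonnegative sequence with `g k ≤ A e k` that decreases by `(e k)² / 4` in step `k` admits only
`O (A / h)` steps with `e k ≥ h`. -/
theorem card_steps_le {g e : ℕ → ℝ} {A h : ℝ} {N : ℕ} (hA : 0 < A) (hh : 0 < h)
    (hg : ∀ k ≤ N, 0 ≤ g k) (hge : ∀ k < N, g k ≤ A * e k)
    (hdec : ∀ k < N, g (k + 1) ≤ g k - e k ^ 2 / 4) (he : ∀ k < N, h ≤ e k) :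
    (N : ℝ) ≤ 1 + 8 * A / h := by
  have step : ∀ k < N, 4 * A ^ 2 * g (k + 1) ≤ 4 * A ^ 2 * g k - g k ^ 2 := fun k hk => by
    have h1 : g k ^ 2 ≤ (A * e k) ^ 2 := pow_le_pow_left₀ (hg k hk.le) (hge k hk) 2
    nlinarith [mul_le_mul_of_nonneg_left (hdec k hk) (by positivity : (0 : ℝ) ≤ 4 * A ^ 2)]
  have hD : (0 : ℝ) < 4 * A ^ 2 := by positivity
  have rate : ∀ k, k ≤ N → (k : ℝ) * g k ≤ 4 * A ^ 2 := by
    intro k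
    induction k with
    | zero => intro _; simp; positivity
    | succ k ih =>
      intro hk
      have h1 := ih (by omega)
      have h2 := step k (by omega)
      have h0 := hg k (by omega)
      generalize 4 * A ^ 2 = D at *
      generalize g k = x at *
      generalize g (k + 1) = y at *
      have hkk : (0 : ℝ) ≤ k := Nat.cast_nonneg k
      push_cast
      generalize (k : ℝ) = c at *
      have : D * ((c + 1) * y) ≤ D * D := by
        have : (c + 1) * (D * y) ≤ (c + 1) * (D * x - x ^ 2) :=
          mul_le_mul_of_nonneg_left h2 (by linarith)
        have h3 : (c + 1) * (D * x - x ^ 2) ≤ D * D := by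
          rcases le_total c 1 with hc | hc
          · nlinarith [sq_nonneg (D - 2 * x), sq_nonneg (D - x), mul_nonneg h0 h0]
          · nlinarith [mul_nonneg (sub_nonneg.2 h1) (sub_nonneg.2 h1), mul_nonneg h0 (sub_nonneg.2 h1), mul_nonneg h0 h0]
        linarith
      exact le_of_mul_le_mul_left this hD
  have tele : ∀ m j, m + j ≤ N → (j : ℝ) * (h ^ 2 / 4) ≤ g m - g (m + j) := by
    intro m j
    induction j with
    | zero => intro _; simp
    | succ j ih =>
      intro hj
      have h1 := ih (by omega)
      have h2 := hdec (m + j) (by omega)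
      have h3 : h ^ 2 ≤ e (m + j) ^ 2 := pow_le_pow_left₀ hh.le (he _ (by omega)) 2
      push_cast
      rw [← add_assoc m j 1]
      linarith
  set m := N / 2
  have hm : N ≤ 2 * m + 1 := by omega
  have hmj := tele m m (by omega)
  have hr := rate m (by omega)
  have h0 := hg (m + m) (by omega)
  have hmm : (m : ℝ) * h ≤ 4 * A := by
    have : ((m : ℝ) * h) ^ 2 ≤ (4 * A) ^ 2 := by
      have : (m : ℝ) * ((m : ℝ) * (h ^ 2 / 4)) ≤ m * g m :=
        mul_le_mul_of_nonneg_left (by linarith) (Nat.cast_nonneg m)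
      nlinarith
    exact le_of_sq_le_sq this (by positivity)
  have : (m : ℝ) ≤ 4 * A / h := (le_div_iff₀ hh).2 hmm
  have hN : (N : ℝ) ≤ 2 * m + 1 := by exact_mod_cast hm
  have e : 8 * A / h = 2 * (4 * A / h) := by ring
  linarith

section Sinkhorn

variable {n : ℕ}

/-- The marginals that are imposed alternately. -/
def altMarginal (p q : Fin n → ℝ) (k : ℕ) : Fin n → ℝ := if k % 2 = 0 then p else q

theorem altMarginal_add_two (p q : Fin n → ℝ) (k : ℕ) :
    altMarginal p q (k + 2) = altMarginal p q k := by simp [altMarginal]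

/-- The scalings of a symmetric matrix `K` that Sinkhorn's algorithm goes through: after `k` updates
the two diagonals are `sinkhornSeq K p q k` and `sinkhornSeq K p q (k + 1)`, the next update
replaces the first of them. -/
def sinkhornSeq (K : Fin n → Fin n → ℝ) (p q : Fin n → ℝ) : ℕ → Fin n → ℝ
  | 0 => fun _ => 1
  | 1 => fun _ => 1
  | k + 2 => fun i => sinkhornSeq K p q k i * altMarginal p q k i /
      (sinkhornSeq K p q k i * ∑ j, K i j * sinkhornSeq K p q (k + 1) j)

/-- A symmetric positive kernel and two positive probability vectors. -/
structure ScalingData (K : Fin n → Fin n → ℝ) (p q : Fin n → ℝ) (κ μ : ℝ) : Prop where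
  two_le : 2 ≤ n
  symm : ∀ i j, K i j = K j i
  kappa_pos : 0 < κ
  kappa_le : ∀ i j, κ ≤ K i j
  le_one : ∀ i j, K i j ≤ 1
  mu_pos : 0 < μ
  mu_le_left : ∀ i, μ ≤ p i
  mu_le_right : ∀ i, μ ≤ q i
  sum_left : ∑ i, p i = 1
  sum_right : ∑ i, q i = 1

namespace ScalingData

variable {K : Fin n → Fin n → ℝ} {p q : Fin n → ℝ} {κ μ : ℝ} (S : ScalingData K p q κ μ)
include S

theorem nonempty : Nonempty (Fin n) := ⟨⟨0, by have := S.two_le; omega⟩⟩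

theorem one_le_card : (1 : ℝ) ≤ n := by have := S.two_le; exact_mod_cast (by omega : 1 ≤ n)

theorem K_pos (i j : Fin n) : 0 < K i j := S.kappa_pos.trans_le (S.kappa_le i j)

theorem kappa_le_one : κ ≤ 1 :=
  have ⟨i⟩ := S.nonempty
  (S.kappa_le i i).trans (S.le_one i i)

theorem mu_le (k : ℕ) (i : Fin n) : μ ≤ altMarginal p q k i := by
  unfold altMarginal; split_ifs
  exacts [S.mu_le_left i, S.mu_le_right i]

theorem marginal_pos (k : ℕ) (i : Fin n) : 0 < altMarginal p q k i := S.mu_pos.trans_le (S.mu_le k i)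

theorem sum_marginal (k : ℕ) : ∑ i, altMarginal p q k i = 1 := by
  unfold altMarginal; split_ifs
  exacts [S.sum_left, S.sum_right]

theorem marginal_le_one (k : ℕ) (i : Fin n) : altMarginal p q k i ≤ 1 := by
  rw [← S.sum_marginal k]
  exact Finset.single_le_sum (fun j _ => (S.marginal_pos k j).le) (Finset.mem_univ i)

theorem mu_le_one : μ ≤ 1 :=
  have ⟨i⟩ := S.nonempty
  (S.mu_le 0 i).trans (S.marginal_le_one 0 i)

theorem mulVec_pos {w : Fin n → ℝ} (hw : ∀ i, 0 < w i) (i : Fin n) : 0 < ∑ j, K i j * w j := by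
  have := S.nonempty
  exact Finset.sum_pos (fun j _ => mul_pos (S.K_pos i j) (hw j)) Finset.univ_nonempty

theorem seq_pos : ∀ (k : ℕ) (i : Fin n), 0 < sinkhornSeq K p q k i
  | 0, _ => one_pos
  | 1, _ => one_pos
  | k + 2, i => by
    rw [sinkhornSeq]
    exact div_pos (mul_pos (seq_pos k i) (S.marginal_pos k i))
      (mul_pos (seq_pos k i) (S.mulVec_pos (seq_pos (k + 1)) i))

theorem seq_mulVec_pos (k : ℕ) (i : Fin n) : 0 < ∑ j, K i j * sinkhornSeq K p q k j :=
  S.mulVec_pos (S.seq_pos k) i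

theorem seq_add_two (k : ℕ) (i : Fin n) : sinkhornSeq K p q (k + 2) i =
    altMarginal p q k i / ∑ j, K i j * sinkhornSeq K p q (k + 1) j := by
  simp only [sinkhornSeq]
  rw [mul_div_mul_left _ _ (S.seq_pos k i).ne']

theorem updated_marginal (k : ℕ) (i : Fin n) : sinkhornSeq K p q (k + 2) i *
    ∑ j, K i j * sinkhornSeq K p q (k + 1) j = altMarginal p q k i := by
  rw [S.seq_add_two, div_mul_cancel₀ _ (S.seq_mulVec_pos (k + 1) i).ne']

omit S in
theorem sum_mul_comm_of_symm (symm : ∀ i j, K i j = K j i) (f g : Fin n → ℝ) :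
    ∑ i, f i * ∑ j, K i j * g j = ∑ j, g j * ∑ i, K j i * f i := by
  simp_rw [Finset.mul_sum]
  rw [Finset.sum_comm]
  exact Finset.sum_congr rfl fun j _ => Finset.sum_congr rfl fun i _ => by rw [symm i j]; ring

theorem sum_seq_succ (k : ℕ) : ∑ i, sinkhornSeq K p q (k + 1) i *
    ∑ j, K i j * sinkhornSeq K p q (k + 2) j = 1 := by
  rw [sum_mul_comm_of_symm S.symm]
  simp_rw [S.updated_marginal]
  exact S.sum_marginal k

theorem mul_le_of_sum {f g : Fin n → ℝ} {s : ℝ} (hf : ∀ i, 0 < f i) (hg : ∀ i, 0 < g i)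
    (h : ∑ i, f i * ∑ j, K i j * g j = s) (i j : Fin n) : f i * (κ * g j) ≤ s := by
  rw [← h]
  calc f i * (κ * g j) ≤ f i * (K i j * g j) := by
        have := S.kappa_le i j
        have := hf i
        have := hg j
        gcongr
    _ ≤ f i * ∑ j, K i j * g j := by
        refine mul_le_mul_of_nonneg_left ?_ (hf i).le
        exact Finset.single_le_sum (f := fun j => K i j * g j)
          (fun j _ => (mul_pos (S.K_pos i j) (hg j)).le) (Finset.mem_univ j)
    _ ≤ _ := Finset.single_le_sum (f := fun i => f i * ∑ j, K i j * g j)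
          (fun i _ => (mul_pos (hf i) (S.mulVec_pos hg i)).le) (Finset.mem_univ i)

/-- `∑ i, m i log w i` for the marginal `m` that belongs to the `k`-th scaling `w`. -/
def _root_.FastOT.scalingPotential (K : Fin n → Fin n → ℝ) (p q : Fin n → ℝ) (k : ℕ) : ℝ :=
  ∑ i, altMarginal p q k i * Real.log (sinkhornSeq K p q k i)

/-- `ℓ¹` error of the marginal that is updated next. -/
def _root_.FastOT.scalingError (K : Fin n → Fin n → ℝ) (p q : Fin n → ℝ) (k : ℕ) : ℝ :=
  ∑ i, |sinkhornSeq K p q k i * ∑ j, K i j * sinkhornSeq K p q (k + 1) j - altMarginal p q k i|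

theorem potential_step (k : ℕ) : scalingPotential K p q (k + 1) +
    scalingError K p q (k + 1) ^ 2 / 4 ≤ scalingPotential K p q (k + 3) := by
  have h := sq_l1_le_relEntropy (p := altMarginal p q (k + 1))
    (r := fun i => sinkhornSeq K p q (k + 1) i * ∑ j, K i j * sinkhornSeq K p q (k + 2) j)
    (S.marginal_pos _) (fun i => mul_pos (S.seq_pos _ _) (S.seq_mulVec_pos _ _))
    (S.sum_marginal _) (S.sum_seq_succ k)
  have e : scalingPotential K p q (k + 3) = scalingPotential K p q (k + 1) +
      ∑ i, altMarginal p q (k + 1) i * (Real.log (altMarginal p q (k + 1) i) - Real.log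
        (sinkhornSeq K p q (k + 1) i * ∑ j, K i j * sinkhornSeq K p q (k + 2) j)) := by
    unfold scalingPotential
    rw [← Finset.sum_add_distrib, altMarginal_add_two]
    refine Finset.sum_congr rfl fun i _ => ?_
    rw [S.seq_add_two (k + 1), Real.log_div (S.marginal_pos _ _).ne' (S.seq_mulVec_pos _ _).ne',
      Real.log_mul (S.seq_pos _ _).ne' (S.seq_mulVec_pos _ _).ne']
    ring
  rw [e]
  exact add_le_add le_rfl h

theorem log_mu_div_le_potential : ∀ k, Real.log (μ / n) ≤ scalingPotential K p q k
  | 0 | 1 => by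
    have := S.mu_pos
    have := S.one_le_card
    simp only [scalingPotential, sinkhornSeq, Real.log_one, mul_zero, Finset.sum_const_zero]
    refine Real.log_nonpos (by positivity) ?_
    rw [div_le_one (by positivity)]
    linarith [S.mu_le_one]
  | 2 => by
    have hμ := S.mu_pos
    have hn := S.one_le_card
    rw [← one_mul (Real.log _), ← S.sum_marginal 2, Finset.sum_mul]
    refine Finset.sum_le_sum fun i _ => mul_le_mul_of_nonneg_left ?_ (S.marginal_pos _ _).le
    refine Real.log_le_log (by positivity) ?_
    rw [S.seq_add_two 0]
    refine div_le_div₀ (S.marginal_pos _ _).le (S.mu_le _ _) (S.seq_mulVec_pos _ _) ?_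
    refine (Finset.sum_le_sum (g := fun _ => 1) fun j _ => ?_).trans (by simp)
    simpa [sinkhornSeq] using S.le_one i j
  | k + 3 => by
    have := S.potential_step k
    have := log_mu_div_le_potential (k + 1)
    have := sq_nonneg (scalingError K p q (k + 1))
    linarith

theorem exists_le_seq (k : ℕ) : ∃ j, μ / n ≤ sinkhornSeq K p q k j := by
  by_contra! h
  have hμ := S.mu_pos
  have hn := S.one_le_card
  have h1 := S.log_mu_div_le_potential k
  have : scalingPotential K p q k < Real.log (μ / n) := by
    rw [← one_mul (Real.log _), ← S.sum_marginal k, Finset.sum_mul]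
    have := S.nonempty
    refine Finset.sum_lt_sum_of_nonempty Finset.univ_nonempty fun i _ =>
      mul_lt_mul_of_pos_left ?_ (S.marginal_pos _ _)
    exact Real.log_lt_log (S.seq_pos k i) (h i)
  linarith

theorem div_le_one : μ / n ≤ 1 := by
  have hn := S.one_le_card
  rw [_root_.div_le_one (by positivity)]
  linarith [S.mu_le_one]

theorem seq_le : ∀ (k : ℕ) (i : Fin n), sinkhornSeq K p q k i ≤ 1 / (κ * (μ / n))
  | 0, i => by
    have hμ := S.mu_pos
    have hκ := S.kappa_pos
    have hn := S.one_le_card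
    simp only [sinkhornSeq]
    rw [le_div_iff₀ (by positivity), one_mul]
    exact mul_le_one₀ S.kappa_le_one (by positivity) S.div_le_one
  | k + 1, i => by
    have hμ := S.mu_pos
    have hκ := S.kappa_pos
    have hn := S.one_le_card
    obtain ⟨j, hj⟩ := S.exists_le_seq (k + 2)
    rw [le_div_iff₀ (by positivity)]
    refine le_trans ?_ (S.mul_le_of_sum (S.seq_pos _) (S.seq_pos _) (S.sum_seq_succ k) i j)
    have := S.seq_pos (k + 1) i
    gcongr

theorem le_seq : ∀ (k : ℕ) (i : Fin n), μ / (n * (1 / (κ * (μ / n)))) ≤ sinkhornSeq K p q k i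
  | 0, i | 1, i => by
    have hμ := S.mu_pos
    have hκ := S.kappa_pos
    have hn := S.one_le_card
    have h := S.seq_le 0 i
    simp only [sinkhornSeq] at h ⊢
    refine (div_le_div_of_nonneg_left hμ.le one_pos ?_).trans (by simpa using S.mu_le_one)
    nlinarith
  | k + 2, i => by
    rw [S.seq_add_two]
    refine div_le_div₀ (S.marginal_pos _ _).le (S.mu_le _ _) (S.seq_mulVec_pos _ _) ?_
    refine (Finset.sum_le_sum (g := fun _ => 1 / (κ * (μ / n))) fun j _ => ?_).trans (by simp)
    have := S.le_one i j
    have := S.seq_pos (k + 1) j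
    calc _ ≤ 1 * sinkhornSeq K p q (k + 1) j := by gcongr
      _ ≤ _ := by rw [one_mul]; exact S.seq_le _ _

theorem log_seq_sub_le : ∀ (k : ℕ) (i j : Fin n),
    Real.log (sinkhornSeq K p q k i) - Real.log (sinkhornSeq K p q k j) ≤ Real.log (1 / (κ * μ))
  | 0, i, j | 1, i, j => by
    have hμ := S.mu_pos
    have hκ := S.kappa_pos
    simp only [sinkhornSeq, sub_self]
    refine Real.log_nonneg ((one_le_div (by positivity)).2 ?_)
    exact mul_le_one₀ S.kappa_le_one hμ.le S.mu_le_one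
  | k + 2, i, j => by
    have hμ := S.mu_pos
    have hκ := S.kappa_pos
    rw [← Real.log_div (S.seq_pos _ _).ne' (S.seq_pos _ _).ne']
    refine Real.log_le_log (div_pos (S.seq_pos _ _) (S.seq_pos _ _)) ?_
    rw [div_le_div_iff₀ (S.seq_pos _ _) (by positivity), S.seq_add_two, S.seq_add_two, one_mul,
      div_mul_eq_mul_div, div_le_div_iff₀ (S.seq_mulVec_pos _ _) (S.seq_mulVec_pos _ _)]
    have h1 : κ * ∑ l, K j l * sinkhornSeq K p q (k + 1) l ≤
        ∑ l, K i l * sinkhornSeq K p q (k + 1) l := by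
      rw [Finset.mul_sum]
      refine Finset.sum_le_sum fun l _ => ?_
      have := S.le_one j l
      have := S.kappa_le i l
      have := S.seq_pos (k + 1) l
      calc _ ≤ κ * (1 * sinkhornSeq K p q (k + 1) l) := by gcongr
        _ ≤ _ := by rw [one_mul]; gcongr
    have := S.mu_le k j
    have := S.marginal_pos k j
    have := S.marginal_le_one k i
    have := S.marginal_pos k i
    have := S.seq_mulVec_pos (k + 1) j
    calc _ = altMarginal p q k i * μ * (κ * ∑ l, K j l * sinkhornSeq K p q (k + 1) l) := by ring
      _ ≤ 1 * altMarginal p q k j * (∑ l, K i l * sinkhornSeq K p q (k + 1) l) := by gcongr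
      _ = _ := by ring

theorem potential_gap_le {f g : Fin n → ℝ} (k : ℕ) (hf : ∀ i, 0 < f i) (hg : ∀ i, 0 < g i)
    (h1 : ∑ i, f i * ∑ j, K i j * g j = 1) {R : ℝ}
    (hR : ∀ i j, Real.log (f i) - Real.log (f j) ≤ R) :
    ∑ i, altMarginal p q (k + 1) i * Real.log (f i) +
      ∑ i, altMarginal p q (k + 2) i * Real.log (g i) -
      (scalingPotential K p q (k + 1) + scalingPotential K p q (k + 2)) ≤
      (R + Real.log (1 / (κ * μ))) / 2 * scalingError K p q (k + 1) := by
  have := S.nonempty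
  set w := sinkhornSeq K p q (k + 1)
  set w' := sinkhornSeq K p q (k + 2)
  have hw : ∀ i, 0 < w i := S.seq_pos _
  have hw' : ∀ i, 0 < w' i := S.seq_pos _
  set u : Fin n → ℝ := fun i => Real.log (f i) - Real.log (w i)
  set v : Fin n → ℝ := fun i => Real.log (g i) - Real.log (w' i)
  have hu : ∀ i, f i = w i * Real.exp (u i) := fun i => by
    simp only [u, Real.exp_sub, Real.exp_log (hf i), Real.exp_log (hw i)]
    field_simp [(hw i).ne']
  have hv : ∀ i, g i = w' i * Real.exp (v i) := fun i => by
    simp only [v, Real.exp_sub, Real.exp_log (hg i), Real.exp_log (hw' i)]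
    field_simp [(hw' i).ne']
  have hrow : ∀ i, w' i * ∑ j, K i j * w j = altMarginal p q (k + 2) i := fun i => by
    rw [altMarginal_add_two]; exact S.updated_marginal k i
  have htot : ∑ i, w i * ∑ j, K i j * w' j = 1 := S.sum_seq_succ k
  have hlin : ∑ i, (w i * ∑ j, K i j * w' j) * u i + ∑ j, altMarginal p q (k + 2) j * v j ≤ 0 := by
    have e1 : ∑ j, altMarginal p q (k + 2) j * v j = ∑ i, ∑ j, w i * (K i j * w' j) * v j := by
      rw [Finset.sum_comm]
      refine Finset.sum_congr rfl fun j _ => ?_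
      rw [← hrow, Finset.mul_sum, Finset.sum_mul]
      exact Finset.sum_congr rfl fun i _ => by rw [S.symm j i]; ring
    have e2 : ∑ i, (w i * ∑ j, K i j * w' j) * u i = ∑ i, ∑ j, w i * (K i j * w' j) * u i := by
      refine Finset.sum_congr rfl fun i _ => ?_
      rw [Finset.mul_sum, Finset.sum_mul]
    have e3 : ∑ i, ∑ j, w i * (K i j * w' j) = 1 := by
      rw [← htot]; exact Finset.sum_congr rfl fun i _ => by rw [Finset.mul_sum]
    have e4 : ∑ i, ∑ j, (w i * (K i j * w' j) + w i * (K i j * w' j) * u i +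
        w i * (K i j * w' j) * v j) ≤ 1 := by
      rw [← h1]
      refine Finset.sum_le_sum fun i _ => ?_
      rw [Finset.mul_sum]
      refine Finset.sum_le_sum fun j _ => ?_
      rw [hu i, hv j]
      have h := Real.add_one_le_exp (u i + v j)
      rw [Real.exp_add] at h
      have h0 : 0 ≤ w i * (K i j * w' j) :=
        (mul_pos (hw i) (mul_pos (S.K_pos i j) (hw' j))).le
      nlinarith [mul_le_mul_of_nonneg_left h h0]
    simp_rw [Finset.sum_add_distrib] at e4
    rw [e3] at e4
    rw [e1, e2]; linarith
  have hfin := sum_sub_mul_le_l1_mul (p := fun i => w i * ∑ j, K i j * w' j)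
    (r := altMarginal p q (k + 1)) (u := u) (R := R + Real.log (1 / (κ * μ)))
    (by rw [htot, S.sum_marginal]) fun i j => by
      have := hR i j
      have := S.log_seq_sub_le (k + 1) j i
      simp only [u, w]; linarith
  have e5 : ∑ i, |altMarginal p q (k + 1) i - w i * ∑ j, K i j * w' j| =
      scalingError K p q (k + 1) := Finset.sum_congr rfl fun i _ => abs_sub_comm _ _
  rw [e5] at hfin
  have e6 : ∑ i, altMarginal p q (k + 1) i * u i + ∑ j, altMarginal p q (k + 2) j * v j =
      ∑ i, altMarginal p q (k + 1) i * Real.log (f i) +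
      ∑ i, altMarginal p q (k + 2) i * Real.log (g i) -
      (scalingPotential K p q (k + 1) + scalingPotential K p q (k + 2)) := by
    simp only [u, v, mul_sub, Finset.sum_sub_distrib, scalingPotential, w, w']; ring
  have e7 : ∑ i, (altMarginal p q (k + 1) i - w i * ∑ j, K i j * w' j) * u i =
      ∑ i, altMarginal p q (k + 1) i * u i - ∑ i, (w i * ∑ j, K i j * w' j) * u i := by
    rw [← Finset.sum_sub_distrib]; exact Finset.sum_congr rfl fun i _ => by ring
  rw [e7] at hfin
  rw [← e6]
  linarith

theorem potential_sub_le {k N : ℕ} :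
    scalingPotential K p q (N + 1) + scalingPotential K p q (N + 2) -
      (scalingPotential K p q (k + 1) + scalingPotential K p q (k + 2)) ≤
      Real.log (1 / (κ * μ)) * scalingError K p q (k + 1) := by
  have hpar : ∀ a b : ℕ, a % 2 = b % 2 → altMarginal p q a = altMarginal p q b := fun a b h => by
    simp [altMarginal, h]
  rcases Nat.mod_two_eq_zero_or_one (N + k) with h | h
  · have := S.potential_gap_le k (S.seq_pos (N + 1)) (S.seq_pos (N + 2)) (S.sum_seq_succ N)
      (S.log_seq_sub_le (N + 1))
    rw [hpar (k + 1) (N + 1) (by omega), hpar (k + 2) (N + 2) (by omega)] at this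
    unfold scalingPotential at this ⊢
    linarith
  · have := S.potential_gap_le k (S.seq_pos (N + 2)) (S.seq_pos (N + 1))
      (by rw [sum_mul_comm_of_symm S.symm]; exact S.sum_seq_succ N)
      (S.log_seq_sub_le (N + 2))
    rw [hpar (k + 1) (N + 2) (by omega), hpar (k + 2) (N + 1) (by omega)] at this
    unfold scalingPotential at this ⊢
    linarith

theorem log_inv_pos (hκμ : κ * μ < 1) : 0 < Real.log (1 / (κ * μ)) :=
  Real.log_pos ((one_lt_div (mul_pos S.kappa_pos S.mu_pos)).2 hκμ)

theorem mu_lt_one : μ < 1 := by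
  obtain ⟨i, j, hij⟩ : ∃ i j : Fin n, i ≠ j :=
    ⟨⟨0, by have := S.two_le; omega⟩, ⟨1, by have := S.two_le; omega⟩, by simp⟩
  have := Finset.add_le_sum (f := p) (fun k _ => S.mu_pos.le.trans (S.mu_le_left k))
    (Finset.mem_univ i) (Finset.mem_univ j) hij
  rw [S.sum_left] at this
  linarith [S.mu_le_left i, S.mu_le_left j, S.mu_pos]

theorem kappa_mul_mu_lt_one : κ * μ < 1 := by
  nlinarith [S.mu_lt_one, S.kappa_le_one, S.mu_pos, S.kappa_pos]

theorem steps_le {N : ℕ} {h : ℝ} (hh : 0 < h) (he : ∀ k < N, h ≤ scalingError K p q (k + 1)) :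
    (N : ℝ) ≤ 1 + 8 * Real.log (1 / (κ * μ)) / h := by
  set ψ : ℕ → ℝ := fun k => scalingPotential K p q (k + 1) + scalingPotential K p q (k + 2)
  have hstep : ∀ k, ψ k + scalingError K p q (k + 1) ^ 2 / 4 ≤ ψ (k + 1) := fun k => by
    have := S.potential_step k
    simp only [ψ]; linarith
  have hmono : Monotone ψ := monotone_nat_of_le_succ fun k => by
    have := hstep k
    have := sq_nonneg (scalingError K p q (k + 1))
    linarith
  refine card_steps_le (g := fun k => ψ N - ψ k) (e := fun k => scalingError K p q (k + 1))
    (S.log_inv_pos S.kappa_mul_mu_lt_one) hh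
    (fun k hk => sub_nonneg.2 (hmono hk)) (fun k _ => S.potential_sub_le)
    (fun k _ => ?_) he
  have := hstep k
  linarith

/-- The stopping criterion of Sinkhorn scaling. -/
def _root_.FastOT.totalError (K : Fin n → Fin n → ℝ) (p q : Fin n → ℝ) (k : ℕ) : ℝ :=
  scalingError K p q k +
  ∑ i, |sinkhornSeq K p q (k + 1) i * ∑ j, K i j * sinkhornSeq K p q k j - altMarginal p q (k + 1) i|

theorem totalError_succ (k : ℕ) : totalError K p q (k + 1) = scalingError K p q (k + 1) := by
  simp [totalError, S.updated_marginal, show k + 1 + 1 = k + 2 from rfl, altMarginal_add_two]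

theorem exists_totalError_le {h : ℝ} (hh : 0 < h) : ∃ N : ℕ,
    (N : ℝ) ≤ 3 + 8 * Real.log (1 / (κ * μ)) / h ∧ totalError K p q N ≤ h ∧
    ∀ k < N, h < totalError K p q k := by
  classical
  set b := 1 + 8 * Real.log (1 / (κ * μ)) / h
  have hb : 0 ≤ b := by
    have := S.log_inv_pos S.kappa_mul_mu_lt_one
    positivity
  have hex : ∃ k ≤ ⌊b⌋₊ + 1, totalError K p q k ≤ h := by
    by_contra! hc
    have := S.steps_le (N := ⌊b⌋₊ + 1) hh fun k hk => by
      rw [← S.totalError_succ]; exact (hc (k + 1) (by omega)).le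
    have h2 := Nat.lt_floor_add_one b
    push_cast at this
    linarith
  have hex' : ∃ k, totalError K p q k ≤ h := hex.imp fun k hk => hk.2
  refine ⟨Nat.find hex', ?_, Nat.find_spec hex', fun k hk => not_le.1 (Nat.find_min hex' hk)⟩
  obtain ⟨k, hk, hk'⟩ := hex
  have h1 : Nat.find hex' ≤ ⌊b⌋₊ + 1 := (Nat.find_min' hex' hk').trans hk
  have h2 : ((Nat.find hex' : ℕ) : ℝ) ≤ ⌊b⌋₊ + 1 := by exact_mod_cast h1
  have h3 := Nat.floor_le hb
  linarith

end ScalingData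

end Sinkhorn


/-! ## The Taylor features of the Gaussian kernel -/

theorem sum_exponents {R : Type*} [AddCommMonoid R] (d M : ℕ) (f : (Fin d → ℕ) → R) :
    ∑ k, f ((exponents d M).get k) =
      ∑ m ∈ Finset.range M, ∑ v ∈ Finset.piAntidiag (Finset.univ : Finset (Fin d)) m, f v := by
  have h1 : ∀ l : List (Fin d → ℕ), ∑ k, f (l.get k) = (l.map f).sum := fun l => by
    simp [← Fin.sum_univ_fun_getElem]
  rw [h1, exponents]
  induction M with
  | zero => simp
  | succ M ih =>
    rw [List.range_succ, List.flatMap_append, List.map_append, List.sum_append, ih,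
      Finset.sum_range_succ, Finset.piAntidiag_univ_fin_eq_antidiagonalTuple]
    simp only [List.flatMap_cons, List.flatMap_nil, List.append_nil]
    rfl

theorem length_exponents (d M : ℕ) (hM : 0 < M) :
    (exponents d M).length = (M - 1 + d).choose d := by
  have h := sum_exponents d M fun _ => 1
  obtain ⟨m, rfl⟩ : ∃ m, M = m + 1 := ⟨M - 1, by omega⟩
  simp only [Finset.sum_const, Finset.card_univ, Fintype.card_fin, smul_eq_mul, mul_one] at h
  rw [h, Nat.add_sub_cancel, ← Nat.sum_range_multichoose]
  refine Finset.sum_congr rfl fun i _ => ?_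
  rw [← Fintype.card_fin d, ← Finset.card_univ, ← Finset.card_finsuppAntidiag_nat_eq_multichoose,
    Finset.card_univ, Fintype.card_fin]
  symm
  refine Finset.card_bij (fun v _ => (v : Fin d → ℕ)) ?_ ?_ ?_
  · intro v hv
    simpa [Finset.mem_piAntidiag] using hv
  · intro v _ w _ h
    exact DFunLike.coe_injective h
  · intro v hv
    refine ⟨Finsupp.equivFunOnFinite.symm v, ?_, by simp⟩
    simpa [Finset.mem_piAntidiag] using hv

theorem sum_lt_of_mem_exponents {d M : ℕ} {v : Fin d → ℕ} (h : v ∈ exponents d M) :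
    ∑ j, v j < M := by
  simp only [exponents, List.mem_flatMap, List.mem_range, List.Nat.mem_antidiagonalTuple] at h
  obtain ⟨m, hm, rfl⟩ := h
  exact hm

theorem sum_pow_div_factorial (d m : ℕ) (z : Fin d → ℝ) :
    ∑ v ∈ Finset.piAntidiag (Finset.univ : Finset (Fin d)) m, ∏ j, z j ^ v j / (v j).factorial =
      (∑ j, z j) ^ m / m.factorial := by
  rw [Finset.sum_pow_eq_sum_piAntidiag, Finset.sum_div]
  refine Finset.sum_congr rfl fun v hv => ?_
  have hm : ∑ j, v j = m := by simpa [Finset.mem_piAntidiag] using hv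
  have h := Nat.multinomial_spec Finset.univ v
  rw [hm] at h
  have h' : (∏ j, ((v j).factorial : ℝ)) * (Nat.multinomial Finset.univ v : ℝ) = m.factorial := by
    exact_mod_cast h
  have h0 : (∏ j, ((v j).factorial : ℝ)) ≠ 0 :=
    Finset.prod_ne_zero_iff.2 fun j _ => by exact_mod_cast (v j).factorial_ne_zero
  have h1 : (m.factorial : ℝ) ≠ 0 := by exact_mod_cast m.factorial_ne_zero
  rw [Finset.prod_div_distrib, div_eq_div_iff h0 h1, ← h']
  ring

theorem exp_sub_sum_le {t : ℝ} (ht : 0 ≤ t) (M : ℕ) :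
    Real.exp t - ∑ m ∈ Finset.range M, t ^ m / m.factorial ≤
      t ^ M / M.factorial * Real.exp t := by
  have hlim : Filter.Tendsto (fun J => ∑ m ∈ Finset.range (M + J), t ^ m / m.factorial)
      Filter.atTop (nhds (Real.exp t)) := by
    have := (NormedSpace.expSeries_div_hasSum_exp t).tendsto_sum_nat
    rw [← Real.exp_eq_exp_ℝ] at this
    exact this.comp (Filter.tendsto_add_atTop_nat M |>.congr fun x => add_comm _ _)
  refine le_of_tendsto (hlim.sub_const _) (Filter.Eventually.of_forall fun J => ?_)
  rw [Finset.sum_range_add, add_sub_cancel_left]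
  refine le_trans ?_ (mul_le_mul_of_nonneg_left (Real.sum_le_exp_of_nonneg ht J) (by positivity))
  rw [Finset.mul_sum]
  refine Finset.sum_le_sum fun k _ => ?_
  rw [div_mul_div_comm, ← pow_add]
  refine div_le_div_of_nonneg_left (by positivity) (by positivity) ?_
  exact_mod_cast Nat.le_of_dvd (Nat.factorial_pos _) (Nat.factorial_mul_factorial_dvd_factorial_add M k)

theorem abs_exp_sub_sum_le (t : ℝ) (M : ℕ) :
    |Real.exp t - ∑ m ∈ Finset.range M, t ^ m / m.factorial| ≤
      |t| ^ M / M.factorial * Real.exp |t| := by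
  have h := Complex.norm_exp_sub_sum_le_exp_norm_sub_sum t M
  have e : Complex.exp t - ∑ m ∈ Finset.range M, (t : ℂ) ^ m / m.factorial =
      ((Real.exp t - ∑ m ∈ Finset.range M, t ^ m / m.factorial : ℝ) : ℂ) := by push_cast; rfl
  rw [e, Complex.norm_real, Complex.norm_real, Real.norm_eq_abs, Real.norm_eq_abs] at h
  exact h.trans (exp_sub_sum_le (abs_nonneg t) M)

section Feature

variable {d : ℕ}

/-- The value that `feature` computes. -/
def featureValue (s : ℝ) (y : EuclideanSpace ℝ (Fin d)) (v : Fin d → ℕ) : ℝ :=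
  Real.exp (0 - (∑ l, y l * y l) / (2 * (s * s))) *
    ∏ j, ((y j / s) ^ v j / Real.sqrt (v j).factorial)

theorem sum_mul_self_eq (y : EuclideanSpace ℝ (Fin d)) : ∑ l, y l * y l = ‖y‖ ^ 2 := by
  rw [EuclideanSpace.norm_sq_eq]
  exact Finset.sum_congr rfl fun i _ => by rw [Real.norm_eq_abs, sq_abs, sq]

theorem abs_featureValue_le_one {s : ℝ} (y : EuclideanSpace ℝ (Fin d)) (v : Fin d → ℕ) :
    |featureValue s y v| ≤ 1 := by
  have h : ∀ j, |(y j / s) ^ v j / Real.sqrt (v j).factorial| ≤ Real.exp ((y j / s) ^ 2 / 2) := by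
    intro j
    have h1 := Real.pow_div_factorial_le_exp _ (sq_nonneg (y j / s)) (v j)
    refine le_of_sq_le_sq ?_ (Real.exp_nonneg _)
    rw [sq_abs, div_pow, Real.sq_sqrt (Nat.cast_nonneg _), ← Real.exp_nat_mul, ← pow_mul, mul_comm (v j),
      pow_mul]
    have e : ((2 : ℕ) : ℝ) * ((y j / s) ^ 2 / 2) = (y j / s) ^ 2 := by push_cast; ring
    rwa [e]
  rw [featureValue, abs_mul, Real.abs_exp, Finset.abs_prod]
  calc _ ≤ Real.exp (0 - (∑ l, y l * y l) / (2 * (s * s))) * ∏ j, Real.exp ((y j / s) ^ 2 / 2) :=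
        mul_le_mul_of_nonneg_left (Finset.prod_le_prod (fun _ _ => abs_nonneg _) fun j _ => h j)
          (Real.exp_nonneg _)
    _ = 1 := by
        rw [← Real.exp_sum, ← Real.exp_add, Real.exp_eq_one_iff, ← Finset.sum_div]
        simp_rw [div_pow]
        rw [← Finset.sum_div]
        simp_rw [sq]
        rw [div_div, mul_comm (s * s) 2]; ring

theorem featureValue_update_succ (s : ℝ) (y : EuclideanSpace ℝ (Fin d)) (v : Fin d → ℕ) (j : Fin d)
    (m : ℕ) : featureValue s y (Function.update v j (m + 1)) =
      featureValue s y (Function.update v j m) * (y j / s) / Real.sqrt ((m + 1 : ℕ) : ℝ) := by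
  have h : ∀ k, ∏ i, ((y i / s) ^ Function.update v j k i /
      Real.sqrt (Function.update v j k i).factorial) = (y j / s) ^ k / Real.sqrt k.factorial *
      ∏ i ∈ Finset.univ.erase j, ((y i / s) ^ v i / Real.sqrt (v i).factorial) := fun k => by
    rw [← Finset.mul_prod_erase _ _ (Finset.mem_univ j), Function.update_self]
    congr 1
    refine Finset.prod_congr rfl fun i hi => ?_
    rw [Function.update_of_ne (Finset.ne_of_mem_erase hi)]
  rw [featureValue, featureValue, h, h, Nat.factorial_succ, Nat.cast_mul,
    Real.sqrt_mul (Nat.cast_nonneg _), pow_succ]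
  ring

/-- The low-rank kernel. -/
def taylorKernel (s : ℝ) (M : ℕ) (y z : EuclideanSpace ℝ (Fin d)) : ℝ :=
  ∑ k, featureValue s y ((exponents d M).get k) * featureValue s z ((exponents d M).get k)

theorem taylorKernel_eq (s : ℝ) (M : ℕ) (y z : EuclideanSpace ℝ (Fin d)) :
    taylorKernel s M y z = Real.exp (-(‖y‖ ^ 2 + ‖z‖ ^ 2) / (2 * s ^ 2)) *
      ∑ m ∈ Finset.range M, (inner ℝ y z / s ^ 2) ^ m / m.factorial := by
  rw [taylorKernel, sum_exponents d M fun v => featureValue s y v * featureValue s z v,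
    Finset.mul_sum]
  refine Finset.sum_congr rfl fun m _ => ?_
  have e : inner ℝ y z / s ^ 2 = ∑ j, (y j / s) * (z j / s) := by
    rw [PiLp.inner_apply, Finset.sum_div]
    refine Finset.sum_congr rfl fun j _ => ?_
    simp; ring
  rw [e, ← sum_pow_div_factorial, Finset.mul_sum]
  refine Finset.sum_congr rfl fun v _ => ?_
  have h : ∀ j, ((y j / s) ^ v j / Real.sqrt (v j).factorial) *
      ((z j / s) ^ v j / Real.sqrt (v j).factorial) =
      ((y j / s) * (z j / s)) ^ v j / (v j).factorial := fun j => by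
    rw [div_mul_div_comm, Real.mul_self_sqrt (Nat.cast_nonneg _), mul_pow]
  rw [featureValue, featureValue, mul_mul_mul_comm, ← Real.exp_add, ← Finset.prod_mul_distrib]
  simp_rw [h]
  rw [sum_mul_self_eq, sum_mul_self_eq]
  congr 2
  ring

theorem taylorKernel_self_le_one (s : ℝ) (M : ℕ) (y : EuclideanSpace ℝ (Fin d)) :
    taylorKernel s M y y ≤ 1 := by
  rw [taylorKernel_eq, real_inner_self_eq_norm_sq]
  refine (mul_le_mul_of_nonneg_left (Real.sum_le_exp_of_nonneg (by positivity) M)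
    (Real.exp_nonneg _)).trans (le_of_eq ?_)
  rw [← Real.exp_add, Real.exp_eq_one_iff]
  ring

theorem sum_abs_featureValue_mul_le_one (s : ℝ) (M : ℕ) (y z : EuclideanSpace ℝ (Fin d)) :
    ∑ k, |featureValue s y ((exponents d M).get k)| *
      |featureValue s z ((exponents d M).get k)| ≤ 1 := by
  have h : ∀ k, |featureValue s y ((exponents d M).get k)| *
      |featureValue s z ((exponents d M).get k)| ≤
      (featureValue s y ((exponents d M).get k) * featureValue s y ((exponents d M).get k) +
      featureValue s z ((exponents d M).get k) * featureValue s z ((exponents d M).get k)) / 2 :=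
    fun k => by
    generalize featureValue s y _ = a
    generalize featureValue s z _ = b
    nlinarith [sq_nonneg (|a| - |b|), sq_abs a, sq_abs b]
  refine (Finset.sum_le_sum fun k _ => h k).trans ?_
  rw [← Finset.sum_div, Finset.sum_add_distrib]
  have h1 := taylorKernel_self_le_one s M y
  have h2 := taylorKernel_self_le_one s M z
  unfold taylorKernel at h1 h2
  linarith

theorem taylorKernel_comm (s : ℝ) (M : ℕ) (y z : EuclideanSpace ℝ (Fin d)) :
    taylorKernel s M y z = taylorKernel s M z y :=
  Finset.sum_congr rfl fun _ _ => mul_comm _ _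

theorem taylorKernel_le_one (s : ℝ) (M : ℕ) (y z : EuclideanSpace ℝ (Fin d)) :
    taylorKernel s M y z ≤ 1 :=
  (Finset.sum_le_sum fun _ _ => (le_abs_self _).trans (abs_mul _ _).le).trans
    (sum_abs_featureValue_mul_le_one s M y z)

theorem abs_gaussian_sub_taylorKernel_le {s : ℝ} (hs : 0 < s) (M : ℕ)
    {y z : EuclideanSpace ℝ (Fin d)} (hy : ‖y‖ ≤ 1) (hz : ‖z‖ ≤ 1) :
    |Real.exp (-‖y - z‖ ^ 2 / (2 * s ^ 2)) - taylorKernel s M y z| ≤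
      (1 / s ^ 2) ^ M / M.factorial := by
  have hs2 : 0 < s ^ 2 := by positivity
  set t := inner ℝ y z / s ^ 2
  have ht : |t| ≤ (‖y‖ ^ 2 + ‖z‖ ^ 2) / (2 * s ^ 2) := by
    rw [abs_div, abs_of_pos hs2, ← div_div]
    refine div_le_div_of_nonneg_right ?_ hs2.le
    have := abs_real_inner_le_norm y z
    nlinarith [sq_nonneg (‖y‖ - ‖z‖)]
  have ht1 : |t| ≤ 1 / s ^ 2 := by
    rw [abs_div, abs_of_pos hs2]
    refine div_le_div_of_nonneg_right ?_ hs2.le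
    exact (abs_real_inner_le_norm y z).trans (mul_le_one₀ hy (norm_nonneg _) hz)
  have e : Real.exp (-‖y - z‖ ^ 2 / (2 * s ^ 2)) =
      Real.exp (-(‖y‖ ^ 2 + ‖z‖ ^ 2) / (2 * s ^ 2)) * Real.exp t := by
    rw [← Real.exp_add, norm_sub_sq_real]
    congr 1
    simp only [t]
    field_simp
    ring
  rw [e, taylorKernel_eq, ← mul_sub, abs_mul, Real.abs_exp]
  calc _ ≤ Real.exp (-(‖y‖ ^ 2 + ‖z‖ ^ 2) / (2 * s ^ 2)) *
        ((1 / s ^ 2) ^ M / M.factorial * Real.exp ((‖y‖ ^ 2 + ‖z‖ ^ 2) / (2 * s ^ 2))) := by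
        refine mul_le_mul_of_nonneg_left ?_ (Real.exp_nonneg _)
        refine (abs_exp_sub_sum_le t M).trans ?_
        gcongr
    _ = (1 / s ^ 2) ^ M / M.factorial * (Real.exp (-(‖y‖ ^ 2 + ‖z‖ ^ 2) / (2 * s ^ 2)) *
        Real.exp ((‖y‖ ^ 2 + ‖z‖ ^ 2) / (2 * s ^ 2))) := by ring
    _ = _ := by rw [← Real.exp_add, neg_div, neg_add_cancel, Real.exp_zero, mul_one]

end Feature

/-- `T ^ M / M!` is exponentially small once `M ≥ 7.5 T`. -/
theorem pow_div_factorial_le_exp_neg {T : ℝ} {M : ℕ} (hT : 0 < T) (hM : 15 * T ≤ 2 * M) :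
    T ^ M / M.factorial ≤ Real.exp (-M) := by
  have hM0 : (0 : ℝ) < M := by linarith
  have h1 := Real.pow_div_factorial_le_exp _ hM0.le M
  have he : Real.exp 1 ^ 2 ≤ 15 / 2 := by
    have := Real.exp_one_lt_d9
    have := Real.exp_pos 1
    nlinarith
  have h2 : T ^ M ≤ (M : ℝ) ^ M * Real.exp (-2) ^ M := by
    rw [← mul_pow]
    refine pow_le_pow_left₀ hT.le ?_ M
    rw [Real.exp_neg, ← div_eq_mul_inv, le_div_iff₀ (Real.exp_pos _)]
    have : Real.exp 2 = Real.exp 1 ^ 2 := by rw [← Real.exp_nat_mul]; norm_num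
    rw [this]
    nlinarith
  calc T ^ M / M.factorial ≤ (M : ℝ) ^ M * Real.exp (-2) ^ M / M.factorial := by gcongr
    _ = (M : ℝ) ^ M / M.factorial * Real.exp (-2) ^ M := by ring
    _ ≤ Real.exp M * Real.exp (-2) ^ M := by gcongr
    _ = Real.exp (-M) := by rw [← Real.exp_nat_mul, ← Real.exp_add]; congr 1; ring

theorem choose_le_exp_pow {m d : ℕ} (hd : 1 ≤ d) :
    ((m + d).choose d : ℝ) ≤ (Real.exp 1 + Real.exp 1 * m / d) ^ d := by
  have hd0 : (0 : ℝ) < d := by exact_mod_cast hd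
  have h1 := Nat.choose_le_pow_div (α := ℝ) d (m + d)
  have h2 := Real.pow_div_factorial_le_exp _ hd0.le d
  have hf : (0 : ℝ) < d.factorial := by exact_mod_cast d.factorial_pos
  refine h1.trans ?_
  have e : (Real.exp 1 + Real.exp 1 * m / d) = Real.exp 1 * ((m + d : ℕ) / d) := by
    push_cast; field_simp; ring
  rw [e, mul_pow, ← Real.exp_nat_mul, mul_one, div_pow]
  calc ((m + d : ℕ) : ℝ) ^ d / d.factorial
      = (d : ℝ) ^ d / d.factorial * (((m + d : ℕ) : ℝ) ^ d / (d : ℝ) ^ d) := by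
        field_simp
    _ ≤ _ := by gcongr


/-! ## Rounding to the transportation polytope -/

section Rounding

variable {n : ℕ}

/-- The factors by which rounding scales the rows of `F`. -/
def rowScale (F : Fin n → Fin n → ℝ) (p : Fin n → ℝ) (i : Fin n) : ℝ := (p i / ∑ j, F i j) ⊓ 1

theorem rowScale_le_one (F : Fin n → Fin n → ℝ) (p : Fin n → ℝ) (i : Fin n) :
    rowScale F p i ≤ 1 := inf_le_right

theorem rowScale_nonneg {F : Fin n → Fin n → ℝ} {p : Fin n → ℝ} (hF : ∀ i j, 0 ≤ F i j)
    (hp : ∀ i, 0 ≤ p i) (i : Fin n) : 0 ≤ rowScale F p i :=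
  le_inf (div_nonneg (hp i) (Finset.sum_nonneg fun j _ => hF i j)) zero_le_one

theorem rowScale_mul {F : Fin n → Fin n → ℝ} {p : Fin n → ℝ} (hF : ∀ i j, 0 ≤ F i j)
    (hp : ∀ i, 0 ≤ p i) (i : Fin n) : rowScale F p i * ∑ j, F i j = p i ⊓ ∑ j, F i j := by
  rcases (Finset.sum_nonneg fun j _ => hF i j : 0 ≤ ∑ j, F i j).eq_or_lt with h | h
  · rw [← h, mul_zero, inf_eq_right.2 (hp i)]
  · rw [rowScale, min_mul_of_nonneg _ _ h.le, div_mul_cancel₀ _ h.ne', one_mul]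

/-- `F` with its rows scaled down to at most `p`. -/
def scaledRows (F : Fin n → Fin n → ℝ) (p : Fin n → ℝ) (i j : Fin n) : ℝ := rowScale F p i * F i j

/-- The factors by which rounding scales the columns. -/
def colScale (F : Fin n → Fin n → ℝ) (p q : Fin n → ℝ) (j : Fin n) : ℝ :=
  rowScale (fun j i => scaledRows F p i j) q j

/-- `F` with rows and columns scaled down. -/
def scaledDown (F : Fin n → Fin n → ℝ) (p q : Fin n → ℝ) (i j : Fin n) : ℝ :=
  rowScale F p i * colScale F p q j * F i j

/-- What is missing in the rows. -/
def rowDefect (F : Fin n → Fin n → ℝ) (p q : Fin n → ℝ) (i : Fin n) : ℝ :=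
  p i - ∑ j, scaledDown F p q i j

/-- What is missing in the columns. -/
def colDefect (F : Fin n → Fin n → ℝ) (p q : Fin n → ℝ) (j : Fin n) : ℝ :=
  q j - ∑ i, scaledDown F p q i j

/-- The left factor of the rank-one correction. -/
def correction (F : Fin n → Fin n → ℝ) (p q : Fin n → ℝ) (i : Fin n) : ℝ :=
  if ∑ i, |rowDefect F p q i| ≤ 0 then rowDefect F p q i
  else rowDefect F p q i / ∑ i, |rowDefect F p q i|

/-- The rounded matrix. -/
def rounded (F : Fin n → Fin n → ℝ) (p q : Fin n → ℝ) (i j : Fin n) : ℝ :=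
  scaledDown F p q i j + correction F p q i * colDefect F p q j

variable {F : Fin n → Fin n → ℝ} {p q : Fin n → ℝ} (hF : ∀ i j, 0 ≤ F i j)
  (hp : p ∈ stdSimplex ℝ (Fin n)) (hq : q ∈ stdSimplex ℝ (Fin n))
include hF hp

theorem scaledRows_nonneg (i j : Fin n) : 0 ≤ scaledRows F p i j :=
  mul_nonneg (rowScale_nonneg hF hp.1 i) (hF i j)

omit hp in
theorem scaledRows_le (i j : Fin n) : scaledRows F p i j ≤ F i j :=
  mul_le_of_le_one_left (hF i j) (rowScale_le_one F p i)

theorem sum_scaledRows (i : Fin n) : ∑ j, scaledRows F p i j = p i ⊓ ∑ j, F i j := by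
  simp only [scaledRows]
  rw [← Finset.mul_sum, rowScale_mul hF hp.1]

include hq

theorem colScale_nonneg (j : Fin n) : 0 ≤ colScale F p q j :=
  rowScale_nonneg (fun _ _ => scaledRows_nonneg hF hp _ _) hq.1 j

omit hF hp hq in
theorem colScale_le_one (j : Fin n) : colScale F p q j ≤ 1 := rowScale_le_one _ _ _

theorem scaledDown_nonneg (i j : Fin n) : 0 ≤ scaledDown F p q i j :=
  mul_nonneg (mul_nonneg (rowScale_nonneg hF hp.1 i) (colScale_nonneg hF hp hq j)) (hF i j)

omit hq in
theorem scaledDown_le_scaledRows (i j : Fin n) : scaledDown F p q i j ≤ scaledRows F p i j := by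
  have := scaledRows_nonneg hF hp i j
  have h := mul_le_of_le_one_left this (colScale_le_one (F := F) (p := p) (q := q) j)
  unfold scaledRows at h
  unfold scaledDown scaledRows
  linarith

omit hq in
theorem scaledDown_le (i j : Fin n) : scaledDown F p q i j ≤ F i j :=
  (scaledDown_le_scaledRows hF hp i j).trans (scaledRows_le hF i j)

theorem sum_scaledDown_col (j : Fin n) :
    ∑ i, scaledDown F p q i j = q j ⊓ ∑ i, scaledRows F p i j := by
  rw [← rowScale_mul (F := fun j i => scaledRows F p i j)
    (fun _ _ => scaledRows_nonneg hF hp _ _) hq.1 j, Finset.mul_sum]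
  refine Finset.sum_congr rfl fun i _ => ?_
  simp only [scaledDown, scaledRows, colScale]
  ring

omit hq in
theorem rowDefect_nonneg (i : Fin n) : 0 ≤ rowDefect F p q i := by
  have h := Finset.sum_le_sum fun j (_ : j ∈ Finset.univ) =>
    scaledDown_le_scaledRows (q := q) hF hp i j
  rw [sum_scaledRows hF hp] at h
  exact sub_nonneg.2 (h.trans inf_le_left)

theorem colDefect_nonneg (j : Fin n) : 0 ≤ colDefect F p q j := by
  rw [colDefect, sum_scaledDown_col hF hp hq]
  exact sub_nonneg.2 inf_le_left

omit hq in
theorem sum_abs_rowDefect : ∑ i, |rowDefect F p q i| = ∑ i, rowDefect F p q i :=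
  Finset.sum_congr rfl fun i _ => abs_of_nonneg (rowDefect_nonneg hF hp i)

omit hF in
theorem sum_colDefect : ∑ j, colDefect F p q j = ∑ i, rowDefect F p q i := by
  simp only [colDefect, rowDefect, Finset.sum_sub_distrib, hp.2, hq.2]
  rw [Finset.sum_comm]

omit hF hp hq in
theorem rowDefect_eq_zero (h : ∑ i, |rowDefect F p q i| ≤ 0) (i : Fin n) :
    rowDefect F p q i = 0 := by
  have h1 := Finset.single_le_sum (fun j _ => abs_nonneg (rowDefect F p q j)) (Finset.mem_univ i)
  exact abs_eq_zero.1 (le_antisymm (h1.trans h) (abs_nonneg _))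

omit hq in
theorem correction_mul (i : Fin n) :
    correction F p q i * ∑ i, rowDefect F p q i = rowDefect F p q i := by
  unfold correction
  split_ifs with h
  · rw [rowDefect_eq_zero h, zero_mul]
  · rw [sum_abs_rowDefect hF hp] at h ⊢
    exact div_mul_cancel₀ _ (not_le.1 h).ne'

omit hq in
theorem correction_nonneg (i : Fin n) : 0 ≤ correction F p q i := by
  unfold correction
  split_ifs
  · exact rowDefect_nonneg hF hp i
  · exact div_nonneg (rowDefect_nonneg hF hp i) (Finset.sum_nonneg fun _ _ => abs_nonneg _)

omit hF hp hq in
theorem correction_le_one (i : Fin n) : correction F p q i ≤ 1 := by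
  unfold correction
  split_ifs with h
  · rw [rowDefect_eq_zero h]; exact zero_le_one
  · refine div_le_one_of_le₀ ((le_abs_self _).trans ?_) (Finset.sum_nonneg fun _ _ => abs_nonneg _)
    exact Finset.single_le_sum (fun j _ => abs_nonneg (rowDefect F p q j)) (Finset.mem_univ i)

omit hq in
theorem sum_correction_mul :
    (∑ i, correction F p q i) * ∑ i, rowDefect F p q i = ∑ i, rowDefect F p q i := by
  rw [Finset.sum_mul]
  exact Finset.sum_congr rfl fun i _ => correction_mul hF hp i

theorem correction_mul_colDefect_sum (j : Fin n) :
    (∑ i, correction F p q i) * colDefect F p q j = colDefect F p q j := by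
  by_cases h : ∑ i, rowDefect F p q i = 0
  · have : colDefect F p q j = 0 := by
      rw [← sum_colDefect hp hq] at h
      exact (Finset.sum_eq_zero_iff_of_nonneg fun j _ => colDefect_nonneg hF hp hq j).1 h j
        (Finset.mem_univ j)
    rw [this, mul_zero]
  · rw [mul_right_cancel₀ h ((sum_correction_mul hF hp).trans (one_mul _).symm), one_mul]

theorem rounded_mem : Matrix.of (rounded F p q) ∈ transportPolytope p q := by
  refine ⟨fun i j => ?_, fun i => ?_, fun j => ?_⟩
  · exact add_nonneg (scaledDown_nonneg hF hp hq i j)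
      (mul_nonneg (correction_nonneg hF hp i) (colDefect_nonneg hF hp hq j))
  · simp only [Matrix.of_apply, rounded, Finset.sum_add_distrib]
    rw [← Finset.mul_sum, sum_colDefect hp hq, correction_mul hF hp, rowDefect]
    ring
  · simp only [Matrix.of_apply, rounded, Finset.sum_add_distrib]
    rw [← Finset.sum_mul, correction_mul_colDefect_sum hF hp hq, colDefect]
    ring

theorem sum_rowDefect_le : ∑ i, rowDefect F p q i ≤
    ∑ i, |∑ j, F i j - p i| + ∑ j, |∑ i, F i j - q j| := by
  have e : ∑ i, rowDefect F p q i = ∑ i, (p i - ∑ j, scaledRows F p i j) +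
      ∑ j, (∑ i, scaledRows F p i j - ∑ i, scaledDown F p q i j) := by
    simp only [rowDefect, Finset.sum_sub_distrib]
    rw [Finset.sum_comm (f := fun i j => scaledRows F p i j),
      Finset.sum_comm (f := fun i j => scaledDown F p q i j)]
    ring
  rw [e]
  refine add_le_add (Finset.sum_le_sum fun i _ => ?_) (Finset.sum_le_sum fun j _ => ?_)
  · rw [sum_scaledRows hF hp]
    rcases min_cases (p i) (∑ j, F i j) with ⟨h, _⟩ | ⟨h, _⟩
    · rw [h, sub_self]; exact abs_nonneg _
    · rw [h, abs_sub_comm]; exact le_abs_self _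
  · rw [sum_scaledDown_col hF hp hq]
    have hc : ∑ i, scaledRows F p i j ≤ ∑ i, F i j :=
      Finset.sum_le_sum fun i _ => scaledRows_le hF i j
    rcases min_cases (q j) (∑ i, scaledRows F p i j) with ⟨h, _⟩ | ⟨h, _⟩
    · rw [h]; exact (sub_le_sub_right hc _).trans (le_abs_self _)
    · rw [h, sub_self]; exact abs_nonneg _

theorem rounded_cost_le {C : Fin n → Fin n → ℝ} {D : ℝ} (hC : ∀ i j, 0 ≤ C i j)
    (hD : ∀ i j, C i j ≤ D) : ∑ i, ∑ j, rounded F p q i j * C i j ≤ ∑ i, ∑ j, F i j * C i j +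
      (∑ i, |∑ j, F i j - p i| + ∑ j, |∑ i, F i j - q j|) * D := by
  simp only [rounded, add_mul, Finset.sum_add_distrib]
  have h0 : ∀ i j, 0 ≤ correction F p q i * colDefect F p q j := fun i j =>
    mul_nonneg (correction_nonneg hF hp i) (colDefect_nonneg hF hp hq j)
  have h1 : ∑ i, ∑ j, correction F p q i * colDefect F p q j * C i j ≤
      (∑ i, rowDefect F p q i) * D := by
    calc _ ≤ ∑ i, ∑ j, correction F p q i * colDefect F p q j * D :=
          Finset.sum_le_sum fun i _ => Finset.sum_le_sum fun j _ =>
            mul_le_mul_of_nonneg_left (hD i j) (h0 i j)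
      _ = (∑ i, correction F p q i) * (∑ j, colDefect F p q j) * D := by
          simp_rw [Finset.sum_mul_sum, Finset.sum_mul]
      _ = _ := by rw [sum_colDefect hp hq, sum_correction_mul hF hp]
  have h2 := sum_rowDefect_le hF hp hq
  rcases isEmpty_or_nonempty (Fin n) with hn | ⟨⟨i⟩⟩
  · simp
  · have hD0 : 0 ≤ D := (hC i i).trans (hD i i)
    rw [← add_mul]
    refine add_le_add (Finset.sum_le_sum fun i _ => Finset.sum_le_sum fun j _ =>
      mul_le_mul_of_nonneg_right (scaledDown_le hF hp i j) (hC i j))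
      (h1.trans (mul_le_mul_of_nonneg_right h2 hD0))

end Rounding

/-! ## Near-optimality of scaled matrices -/

theorem mul_log_div_le {x y : ℝ} (hx : 0 ≤ x) (hy : 0 < y) :
    x * (Real.log y - Real.log x) ≤ y - x := by
  rcases hx.eq_or_lt with rfl | hx
  · simp [hy.le]
  · have h := Real.log_le_sub_one_of_pos (div_pos hy hx)
    rw [Real.log_div hy.ne' hx.ne'] at h
    have := mul_le_mul_of_nonneg_left h hx.le
    have e : x * (y / x - 1) = y - x := by field_simp
    linarith

theorem scaled_cost_le {n : ℕ} (hn : 0 < n) {K : Fin n → Fin n → ℝ} {a b p q : Fin n → ℝ}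
    (hK : ∀ i j, 0 < K i j) (ha : ∀ i, 0 < a i) (hb : ∀ i, 0 < b i)
    (hp : ∑ i, p i = 1) {P : Matrix (Fin n) (Fin n) ℝ} (hP : P ∈ transportPolytope p q)
    {s : ℝ} (hs : ∑ i, ∑ j, a i * K i j * b j = s) :
    ∑ i, ∑ j, a i * K i j * b j * -Real.log (K i j) - ∑ i, ∑ j, P i j * -Real.log (K i j) ≤
      2 * s * Real.log n + ∑ i, (∑ j, a i * K i j * b j - p i) * Real.log (a i) +
      ∑ j, (∑ i, a i * K i j * b j - q j) * Real.log (b j) := by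
  have hne : Nonempty (Fin n) := ⟨⟨0, hn⟩⟩
  have hn0 : (0 : ℝ) < n := by exact_mod_cast hn
  set F : Fin n → Fin n → ℝ := fun i j => a i * K i j * b j
  have hF : ∀ i j, 0 < F i j := fun i j => mul_pos (mul_pos (ha i) (hK i j)) (hb j)
  have hs0 : 0 < s := by
    rw [← hs]
    exact Finset.sum_pos (fun i _ => Finset.sum_pos (fun j _ => hF i j) Finset.univ_nonempty)
      Finset.univ_nonempty
  obtain ⟨hP0, hPr, hPc⟩ := hP
  have hPs : ∑ i, ∑ j, P i j = 1 := by simp_rw [hPr]; exact hp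
  have hP1 : ∀ i j, P i j ≤ 1 := fun i j => by
    rw [← hPs]
    exact (Finset.single_le_sum (f := fun j => P i j) (fun j _ => hP0 i j)
      (Finset.mem_univ j)).trans (Finset.single_le_sum (f := fun i => ∑ j, P i j)
      (fun i _ => Finset.sum_nonneg fun j _ => hP0 i j) (Finset.mem_univ i))
  have hlogF : ∀ i j, Real.log (F i j) = Real.log (a i) + Real.log (K i j) + Real.log (b j) :=
    fun i j => by
      rw [Real.log_mul (mul_pos (ha i) (hK i j)).ne' (hb j).ne',
        Real.log_mul (ha i).ne' (hK i j).ne']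
  have split : ∀ G : Fin n → Fin n → ℝ, ∑ i, ∑ j, G i j * Real.log (F i j) =
      ∑ i, (∑ j, G i j) * Real.log (a i) + ∑ i, ∑ j, G i j * Real.log (K i j) +
      ∑ j, (∑ i, G i j) * Real.log (b j) := fun G => by
    simp_rw [hlogF, mul_add, Finset.sum_add_distrib, Finset.sum_mul]
    rw [Finset.sum_comm (f := fun i j => G i j * Real.log (b j))]
  have h1 : ∑ i, ∑ j, P i j * Real.log (F i j) ≤ Real.log s := by
    have : ∑ i, ∑ j, (P i j * Real.log (F i j) - P i j * Real.log s) ≤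
        ∑ i, ∑ j, (F i j / s - P i j) := by
      refine Finset.sum_le_sum fun i _ => Finset.sum_le_sum fun j _ => ?_
      have h := mul_log_div_le (hP0 i j) (div_pos (hF i j) hs0)
      rw [Real.log_div (hF i j).ne' hs0.ne'] at h
      have := mul_nonpos_of_nonneg_of_nonpos (hP0 i j) (Real.log_nonpos (hP0 i j) (hP1 i j))
      linarith
    simp_rw [Finset.sum_sub_distrib, ← Finset.sum_mul, ← Finset.sum_div] at this
    rw [hs, hPs, div_self hs0.ne'] at this
    linarith
  have h2 : -∑ i, ∑ j, F i j * Real.log (F i j) ≤ 2 * s * Real.log n - s * Real.log s := by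
    have : ∑ i, ∑ j, (F i j * (Real.log s - 2 * Real.log n) - F i j * Real.log (F i j)) ≤
        ∑ _i : Fin n, ∑ _j : Fin n, (s / n ^ 2) - ∑ i, ∑ j, F i j := by
      rw [← Finset.sum_sub_distrib]
      refine Finset.sum_le_sum fun i _ => ?_
      rw [← Finset.sum_sub_distrib]
      refine Finset.sum_le_sum fun j _ => ?_
      have h := mul_log_div_le (hF i j).le (div_pos hs0 (pow_pos hn0 2))
      rw [Real.log_div hs0.ne' (pow_pos hn0 2).ne', Real.log_pow] at h
      push_cast at h
      linarith
    simp_rw [Finset.sum_sub_distrib, ← Finset.sum_mul] at this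
    rw [hs] at this
    have e : ∑ _i : Fin n, ∑ _j : Fin n, (s / (n : ℝ) ^ 2) = s := by
      simp; field_simp
    rw [e] at this
    linarith
  have h3 : (1 - s) * Real.log s ≤ 0 := by
    rcases le_total s 1 with h | h
    · exact mul_nonpos_of_nonneg_of_nonpos (by linarith) (Real.log_nonpos hs0.le h)
    · exact mul_nonpos_of_nonpos_of_nonneg (by linarith) (Real.log_nonneg h)
  rw [split P] at h1
  rw [split F] at h2
  simp_rw [hPr, hPc] at h1
  simp_rw [mul_neg, Finset.sum_neg_distrib, sub_mul, Finset.sum_sub_distrib]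
  change -∑ i, ∑ j, F i j * _ - _ ≤ _ + (∑ i, (∑ j, F i j) * _ - _) + (∑ j, (∑ i, F i j) * _ - _)
  linarith


/-! ## The Wasserstein distance of discrete measures -/

section Wasserstein

variable {n d : ℕ} {x : Fin n → EuclideanSpace ℝ (Fin d)} {p q : Fin n → ℝ}

theorem lintegral_discreteMeasure (x : Fin n → EuclideanSpace ℝ (Fin d)) (p : Fin n → ℝ)
    (f : EuclideanSpace ℝ (Fin d) → ℝ≥0∞) :
    ∫⁻ z, f z ∂discreteMeasure x p = ∑ i, ENNReal.ofReal (p i) * f (x i) := by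
  simp [discreteMeasure, lintegral_finsetSum_measure, lintegral_smul_measure, lintegral_dirac]

/-- The share of the `i`-th atom in the mass of the distribution at `z`. -/
def atomShare (x : Fin n → EuclideanSpace ℝ (Fin d)) (p : Fin n → ℝ) (i : Fin n)
    (z : EuclideanSpace ℝ (Fin d)) : ℝ≥0∞ :=
  ({x i} : Set (EuclideanSpace ℝ (Fin d))).indicator
    (fun _ => ENNReal.ofReal (p i) / discreteMeasure x p {x i}) z

theorem measurable_atomShare (i : Fin n) : Measurable (atomShare x p i) :=
  measurable_const.indicator (measurableSet_singleton _)

theorem discreteMeasure_singleton (z : EuclideanSpace ℝ (Fin d)) :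
    discreteMeasure x p {z} = ∑ k, if x k = z then ENNReal.ofReal (p k) else 0 := by
  simp only [discreteMeasure, Measure.finsetSum_apply, Measure.smul_apply, smul_eq_mul]
  refine Finset.sum_congr rfl fun k _ => ?_
  rw [Measure.dirac_apply' _ (measurableSet_singleton _)]
  by_cases h : x k = z <;> simp [h, Set.indicator]

theorem discreteMeasure_singleton_ne_top (z : EuclideanSpace ℝ (Fin d)) :
    discreteMeasure x p {z} ≠ ∞ := by
  rw [discreteMeasure_singleton]
  refine ENNReal.sum_ne_top.2 fun k _ => ?_
  split_ifs <;> simp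

theorem ofReal_le_discreteMeasure (i : Fin n) :
    ENNReal.ofReal (p i) ≤ discreteMeasure x p {x i} := by
  rw [discreteMeasure_singleton]
  have := Finset.single_le_sum (f := fun k => if x k = x i then ENNReal.ofReal (p k) else 0)
    (fun _ _ => zero_le) (Finset.mem_univ i)
  simpa using this

theorem lintegral_atomShare (i : Fin n) :
    ∫⁻ z, atomShare x p i z ∂discreteMeasure x p = ENNReal.ofReal (p i) := by
  simp only [atomShare]
  rw [lintegral_indicator_const (measurableSet_singleton _)]
  rcases eq_or_ne (discreteMeasure x p {x i}) 0 with h | h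
  · have := ofReal_le_discreteMeasure (x := x) (p := p) i
    rw [h] at this ⊢
    simpa using this.antisymm zero_le |>.symm
  · exact ENNReal.div_mul_cancel h (discreteMeasure_singleton_ne_top _)

theorem sum_atomShare_of_ne_zero {z : EuclideanSpace ℝ (Fin d)}
    (hz : discreteMeasure x p {z} ≠ 0) : ∑ i, atomShare x p i z = 1 := by
  have h : ∀ i, atomShare x p i z =
      (if x i = z then ENNReal.ofReal (p i) else 0) / discreteMeasure x p {z} := fun i => by
    by_cases h : x i = z
    · simp [atomShare, h]
    · have : z ∉ ({x i} : Set (EuclideanSpace ℝ (Fin d))) := fun h' => h h'.symm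
      simp [atomShare, h, Set.indicator_of_notMem this]
  simp_rw [h, div_eq_mul_inv]
  rw [← Finset.sum_mul, ← discreteMeasure_singleton]
  exact ENNReal.mul_inv_cancel hz (discreteMeasure_singleton_ne_top z)

theorem ae_sum_atomShare : ∀ᵐ z ∂discreteMeasure x p, ∑ i, atomShare x p i z = 1 := by
  have hm : Measurable fun z => ∑ i, atomShare x p i z :=
    Finset.measurable_sum _ fun i _ => measurable_atomShare i
  have hs : MeasurableSet {z | ∑ i, atomShare x p i z = 1} := hm (measurableSet_singleton 1)
  rw [ae_iff]
  change discreteMeasure x p {z | ∑ i, atomShare x p i z = 1}ᶜ = 0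
  rw [← lintegral_indicator_one hs.compl, lintegral_discreteMeasure]
  refine Finset.sum_eq_zero fun i _ => ?_
  by_cases h : discreteMeasure x p {x i} = 0
  · have := ofReal_le_discreteMeasure (x := x) (p := p) i
    rw [h] at this
    rw [this.antisymm zero_le, zero_mul]
  · have : x i ∉ {z | ∑ i, atomShare x p i z = 1}ᶜ := fun h' => h' (sum_atomShare_of_ne_zero h)
    rw [Set.indicator_of_notMem this, mul_zero]

section Coupling

variable {γ : Measure (EuclideanSpace ℝ (Fin d) × EuclideanSpace ℝ (Fin d))}
  (hγ : γ ∈ couplings (discreteMeasure x p) (discreteMeasure x q))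
include hγ

theorem ae_sum_atomShare_fst : ∀ᵐ z ∂γ, ∑ i, atomShare x p i z.1 = 1 := by
  have h := ae_sum_atomShare (x := x) (p := p)
  rw [← hγ.1] at h
  exact ae_of_ae_map measurable_fst.aemeasurable h

theorem ae_sum_atomShare_snd : ∀ᵐ z ∂γ, ∑ j, atomShare x q j z.2 = 1 := by
  have h := ae_sum_atomShare (x := x) (p := q)
  rw [← hγ.2] at h
  exact ae_of_ae_map measurable_snd.aemeasurable h

theorem lintegral_atomShare_fst (i : Fin n) :
    ∫⁻ z, atomShare x p i z.1 ∂γ = ENNReal.ofReal (p i) := by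
  rw [← lintegral_atomShare (x := x) (p := p) i, ← hγ.1,
    lintegral_map (measurable_atomShare i) measurable_fst]

theorem lintegral_atomShare_snd (j : Fin n) :
    ∫⁻ z, atomShare x q j z.2 ∂γ = ENNReal.ofReal (q j) := by
  rw [← lintegral_atomShare (x := x) (p := q) j, ← hγ.2,
    lintegral_map (measurable_atomShare j) measurable_snd]

theorem exists_matrix_of_coupling (hp : ∀ i, 0 ≤ p i) (hq : ∀ i, 0 ≤ q i) :
    ∃ P ∈ transportPolytope p q, ENNReal.ofReal (∑ i, ∑ j, P i j * ‖x i - x j‖ ^ 2) =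
      ∫⁻ z, edist z.1 z.2 ^ (2 : ℝ) ∂γ := by
  have hm : ∀ i j, Measurable fun z : EuclideanSpace ℝ (Fin d) × EuclideanSpace ℝ (Fin d) =>
      atomShare x p i z.1 * atomShare x q j z.2 := fun i j =>
    ((measurable_atomShare i).comp measurable_fst).mul
      ((measurable_atomShare j).comp measurable_snd)
  set Q : Fin n → Fin n → ℝ≥0∞ := fun i j => ∫⁻ z, atomShare x p i z.1 * atomShare x q j z.2 ∂γ
  have hrow : ∀ i, ∑ j, Q i j = ENNReal.ofReal (p i) := fun i => by
    rw [← lintegral_atomShare_fst hγ i, ← lintegral_finsetSum _ fun j _ => hm i j]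
    refine lintegral_congr_ae ?_
    filter_upwards [ae_sum_atomShare_snd hγ] with z hz
    rw [← Finset.mul_sum, hz, mul_one]
  have hcol : ∀ j, ∑ i, Q i j = ENNReal.ofReal (q j) := fun j => by
    rw [← lintegral_atomShare_snd hγ j, ← lintegral_finsetSum _ fun i _ => hm i j]
    refine lintegral_congr_ae ?_
    filter_upwards [ae_sum_atomShare_fst hγ] with z hz
    rw [← Finset.sum_mul, hz, one_mul]
  have hfin : ∀ i j, Q i j ≠ ∞ := fun i j => by
    have h1 : Q i j ≤ ∑ j, Q i j := Finset.single_le_sum (fun _ _ => zero_le) (Finset.mem_univ j)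
    rw [hrow] at h1
    exact ne_top_of_le_ne_top ENNReal.ofReal_ne_top h1
  refine ⟨Matrix.of fun i j => (Q i j).toReal,
    ⟨fun i j => ENNReal.toReal_nonneg, fun i => ?_, fun j => ?_⟩, ?_⟩
  · simp only [Matrix.of_apply]
    rw [← ENNReal.toReal_sum fun j _ => hfin i j, hrow, ENNReal.toReal_ofReal (hp i)]
  · simp only [Matrix.of_apply]
    rw [← ENNReal.toReal_sum fun i _ => hfin i j, hcol, ENNReal.toReal_ofReal (hq j)]
  · have e1 : ∫⁻ z, edist z.1 z.2 ^ (2 : ℝ) ∂γ = ∫⁻ z, ∑ i, ∑ j,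
        atomShare x p i z.1 * atomShare x q j z.2 * ENNReal.ofReal (‖x i - x j‖ ^ 2) ∂γ := by
      refine lintegral_congr_ae ?_
      filter_upwards [ae_sum_atomShare_fst hγ, ae_sum_atomShare_snd hγ] with z h1 h2
      have : ∀ i j, atomShare x p i z.1 * atomShare x q j z.2 * ENNReal.ofReal (‖x i - x j‖ ^ 2) =
          atomShare x p i z.1 * atomShare x q j z.2 * edist z.1 z.2 ^ (2 : ℝ) := fun i j => by
        by_cases hi : z.1 = x i
        · by_cases hj : z.2 = x j
          · rw [hi, hj, edist_dist, dist_eq_norm, ENNReal.ofReal_rpow_of_nonneg (norm_nonneg _)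
              zero_le_two, Real.rpow_two]
          · have : z.2 ∉ ({x j} : Set (EuclideanSpace ℝ (Fin d))) := hj
            simp [atomShare, Set.indicator_of_notMem this]
        · have : z.1 ∉ ({x i} : Set (EuclideanSpace ℝ (Fin d))) := hi
          simp [atomShare, Set.indicator_of_notMem this]
      simp_rw [this, ← Finset.sum_mul, ← Finset.mul_sum, h2, mul_one]
      rw [h1, one_mul]
    have e2 : ∫⁻ z, ∑ i, ∑ j, atomShare x p i z.1 * atomShare x q j z.2 *
        ENNReal.ofReal (‖x i - x j‖ ^ 2) ∂γ = ∑ i, ∑ j, Q i j * ENNReal.ofReal (‖x i - x j‖ ^ 2) := by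
      rw [lintegral_finsetSum _ fun i _ => Finset.measurable_sum _ fun j _ => (hm i j).mul_const _]
      refine Finset.sum_congr rfl fun i _ => ?_
      rw [lintegral_finsetSum _ fun j _ => (hm i j).mul_const _]
      exact Finset.sum_congr rfl fun j _ => lintegral_mul_const _ (hm i j)
    rw [e1, e2, ENNReal.ofReal_sum_of_nonneg fun i _ => Finset.sum_nonneg fun j _ => by
      simp only [Matrix.of_apply]; positivity]
    refine Finset.sum_congr rfl fun i _ => ?_
    rw [ENNReal.ofReal_sum_of_nonneg fun j _ => by simp only [Matrix.of_apply]; positivity]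
    refine Finset.sum_congr rfl fun j _ => ?_
    rw [Matrix.of_apply, ENNReal.ofReal_mul ENNReal.toReal_nonneg, ENNReal.ofReal_toReal (hfin i j)]

end Coupling

theorem exists_coupling_of_matrix {P : Matrix (Fin n) (Fin n) ℝ} (hP : P ∈ transportPolytope p q) :
    ∃ γ ∈ couplings (discreteMeasure x p) (discreteMeasure x q),
      ∫⁻ z, edist z.1 z.2 ^ (2 : ℝ) ∂γ ≠ ∞ := by
  obtain ⟨h0, hr, hc⟩ := hP
  refine ⟨∑ i, ∑ j, ENNReal.ofReal (P i j) • Measure.dirac (x i, x j), ⟨?_, ?_⟩, ?_⟩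
  · rw [Measure.map_finset_sum measurable_fst.aemeasurable, discreteMeasure]
    refine Finset.sum_congr rfl fun i _ => ?_
    rw [Measure.map_finset_sum measurable_fst.aemeasurable, ← hr i,
      ENNReal.ofReal_sum_of_nonneg fun j _ => h0 i j, Finset.sum_smul]
    refine Finset.sum_congr rfl fun j _ => ?_
    rw [Measure.map_smul, Measure.map_dirac' measurable_fst]
  · rw [Finset.sum_comm, Measure.map_finset_sum measurable_snd.aemeasurable, discreteMeasure]
    refine Finset.sum_congr rfl fun j _ => ?_
    rw [Measure.map_finset_sum measurable_snd.aemeasurable, ← hc j,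
      ENNReal.ofReal_sum_of_nonneg fun i _ => h0 i j, Finset.sum_smul]
    refine Finset.sum_congr rfl fun i _ => ?_
    rw [Measure.map_smul, Measure.map_dirac' measurable_snd]
  · simp only [lintegral_finsetSum_measure, lintegral_smul_measure, lintegral_dirac, smul_eq_mul]
    refine ENNReal.sum_ne_top.2 fun i _ => ENNReal.sum_ne_top.2 fun j _ => ?_
    exact ENNReal.mul_ne_top ENNReal.ofReal_ne_top
      (ENNReal.rpow_ne_top_of_nonneg zero_le_two (edist_ne_top _ _))

theorem le_wasserstein_sq (hp : ∀ i, 0 ≤ p i) (hq : ∀ i, 0 ≤ q i) {c : ℝ}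
    (hne : (transportPolytope p q).Nonempty)
    (h : ∀ P ∈ transportPolytope p q, c ≤ ∑ i, ∑ j, P i j * ‖x i - x j‖ ^ 2) :
    c ≤ (wasserstein 2 (discreteMeasure x p) (discreteMeasure x q)).toReal ^ 2 := by
  rcases le_total c 0 with hc | hc
  · exact hc.trans (sq_nonneg _)
  have hle : ENNReal.ofReal (Real.sqrt c) ≤
      wasserstein 2 (discreteMeasure x p) (discreteMeasure x q) := by
    refine le_iInf₂ fun γ hγ => ?_
    obtain ⟨P, hP, e⟩ := exists_matrix_of_coupling hγ hp hq
    rw [← e, Real.sqrt_eq_rpow, ← ENNReal.ofReal_rpow_of_nonneg hc (by norm_num)]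
    exact ENNReal.rpow_le_rpow (ENNReal.ofReal_le_ofReal (h P hP)) (by norm_num)
  have htop : wasserstein 2 (discreteMeasure x p) (discreteMeasure x q) ≠ ∞ := by
    obtain ⟨P, hP⟩ := hne
    obtain ⟨γ, hγ, hfin⟩ := exists_coupling_of_matrix (x := x) hP
    refine ne_top_of_le_ne_top (ENNReal.rpow_ne_top_of_nonneg (by norm_num) hfin)
      (iInf₂_le γ hγ : _ ≤ (∫⁻ z, edist z.1 z.2 ^ (2 : ℝ) ∂γ) ^ (1 / (2 : ℝ)))
  have h2 := (ENNReal.ofReal_le_iff_le_toReal htop).1 hle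
  calc c = Real.sqrt c ^ 2 := (Real.sq_sqrt hc).symm
    _ ≤ _ := pow_le_pow_left₀ (Real.sqrt_nonneg c) h2 2

end Wasserstein


open RAM

/-! ## Running times of the subroutines -/

section Programs

variable {ℓ n d r : ℕ} {B : ℝ}

theorem one_le_charge (ℓ : ℕ) (y : ℝ) : 1 ≤ charge ℓ y := by unfold charge; omega

/-- The entries of `L Rᵀ`. -/
def factorProd (L R : Fin n → Fin r → ℝ) (i j : Fin n) : ℝ := ∑ k, L i k * R j k

theorem runsIn_mulVec (hB : 0 ≤ B) {A : Fin n → Fin r → ℝ} {w : Fin r → ℝ}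
    (h : ∀ i, ∑ k, |A i k * w k| ≤ B) :
    RunsIn (ℓ := ℓ) (mulVec A w) (fun i => ∑ k, A i k * w k)
      (n * (r * (charge ℓ B + charge ℓ B + 1) + charge ℓ B + 1)) :=
  runsIn_tabulate fun i => runsIn_sumLoop hB (fun k => runsIn_mul
    ((Finset.single_le_sum (f := fun k => |A i k * w k|) (fun _ _ => abs_nonneg _)
      (Finset.mem_univ k)).trans (h i))) (h i)

theorem runsIn_tMulVec (hB : 0 ≤ B) {A : Fin n → Fin r → ℝ} {a : Fin n → ℝ}
    (h : ∀ k, ∑ i, |A i k * a i| ≤ B) :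
    RunsIn (ℓ := ℓ) (tMulVec A a) (fun k => ∑ i, A i k * a i)
      (r * (n * (charge ℓ B + charge ℓ B + 1) + charge ℓ B + 1)) :=
  runsIn_tabulate fun k => runsIn_sumLoop hB (fun i => runsIn_mul
    ((Finset.single_le_sum (f := fun i => |A i k * a i|) (fun _ _ => abs_nonneg _)
      (Finset.mem_univ i)).trans (h k))) (h k)

/-- Bounds for a factorization `L Rᵀ` and for the sums that occur in its use. -/
structure FactorBound (L R : Fin n → Fin r → ℝ) (A : ℝ) : Prop where
  left : ∀ i k, |L i k| ≤ A
  right : ∀ i k, |R i k| ≤ A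
  prod : ∀ i j, ∑ k, |L i k| * |R j k| ≤ A

theorem FactorBound.swap {L R : Fin n → Fin r → ℝ} {A : ℝ} (h : FactorBound L R A) :
    FactorBound R L A :=
  ⟨h.right, h.left, fun i j => by simpa only [mul_comm] using h.prod j i⟩

theorem FactorBound.mono {L R : Fin n → Fin r → ℝ} {A A' : ℝ} (h : FactorBound L R A)
    (hA : A ≤ A') : FactorBound L R A' :=
  ⟨fun i k => (h.left i k).trans hA, fun i k => (h.right i k).trans hA,
    fun i j => (h.prod i j).trans hA⟩

theorem FactorBound.abs_factorProd_le {L R : Fin n → Fin r → ℝ} {A : ℝ} (h : FactorBound L R A)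
    (i j : Fin n) : |factorProd L R i j| ≤ A :=
  (Finset.abs_sum_le_sum_abs _ _).trans (by simpa only [abs_mul] using h.prod i j)

theorem FactorBound.scale {L R : Fin n → Fin r → ℝ} {A : ℝ} (h : FactorBound L R A)
    {x y : Fin n → ℝ} (hx0 : ∀ i, 0 ≤ x i) (hx : ∀ i, x i ≤ 1) (hy0 : ∀ i, 0 ≤ y i)
    (hy : ∀ i, y i ≤ 1) : FactorBound (fun i k => x i * L i k) (fun i k => y i * R i k) A := by
  have h1 : ∀ i k, |x i * L i k| ≤ |L i k| := fun i k => by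
    rw [abs_mul, abs_of_nonneg (hx0 i)]
    exact mul_le_of_le_one_left (abs_nonneg _) (hx i)
  have h2 : ∀ i k, |y i * R i k| ≤ |R i k| := fun i k => by
    rw [abs_mul, abs_of_nonneg (hy0 i)]
    exact mul_le_of_le_one_left (abs_nonneg _) (hy i)
  exact ⟨fun i k => (h1 i k).trans (h.left i k), fun i k => (h2 i k).trans (h.right i k),
    fun i j => (Finset.sum_le_sum fun k _ => mul_le_mul (h1 i k) (h2 j k) (abs_nonneg _)
      (abs_nonneg _)).trans (h.prod i j)⟩

theorem sum_le_card_mul {f : Fin n → ℝ} {c : ℝ} (h : ∀ i, f i ≤ c) : ∑ i, f i ≤ n * c :=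
  (Finset.sum_le_sum fun i _ => h i).trans (by simp)

theorem runsIn_factoredMulVec (hB : 0 ≤ B) (hn : 1 ≤ n) (hr : 1 ≤ r) {L R : Fin n → Fin r → ℝ}
    {A c : ℝ} {b : Fin n → ℝ} (h : FactorBound L R A) (hb : ∀ j, |b j| ≤ c)
    (hAc : n * (A * c) ≤ B) :
    RunsIn (ℓ := ℓ) (factoredMulVec L R b) (fun i => ∑ j, factorProd L R i j * b j)
      (10 * (n * r * charge ℓ B)) := by
  have h1 : ∀ k, ∑ j, |R j k * b j| ≤ B := fun k =>
    (sum_le_card_mul fun j => by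
      rw [abs_mul]
      exact mul_le_mul (h.right j k) (hb j) (abs_nonneg _)
        ((abs_nonneg _).trans (h.right j k))).trans hAc
  have h2 : ∀ i, ∑ k, |L i k * ∑ j, R j k * b j| ≤ B := fun i => by
    calc ∑ k, |L i k * ∑ j, R j k * b j| ≤ ∑ k, ∑ j, |L i k| * |R j k| * |b j| := by
          refine Finset.sum_le_sum fun k _ => ?_
          rw [abs_mul]
          refine (mul_le_mul_of_nonneg_left (Finset.abs_sum_le_sum_abs _ _) (abs_nonneg _)).trans ?_
          rw [Finset.mul_sum]
          exact le_of_eq (Finset.sum_congr rfl fun j _ => by rw [abs_mul, mul_assoc])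
      _ = ∑ j, (∑ k, |L i k| * |R j k|) * |b j| := by
          rw [Finset.sum_comm]
          exact Finset.sum_congr rfl fun j _ => by rw [Finset.sum_mul]
      _ ≤ n * (A * c) := sum_le_card_mul fun j => by
          have h0 := h.prod i j
          exact mul_le_mul h0 (hb j) (abs_nonneg _) (le_trans (by positivity) h0)
      _ ≤ B := hAc
  have e : (fun i => ∑ k, L i k * ∑ j, R j k * b j) = fun i => ∑ j, factorProd L R i j * b j := by
    funext i
    simp only [factorProd, Finset.mul_sum, Finset.sum_mul]
    rw [Finset.sum_comm]
    exact Finset.sum_congr rfl fun j _ => Finset.sum_congr rfl fun k _ => by ring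
  refine (((runsIn_tMulVec hB h1).bind (runsIn_mulVec hB h2)).congr e).mono ?_
  have hQ := one_le_charge ℓ B
  generalize charge ℓ B = Q at *
  have a1 : n ≤ n * r * Q := by nlinarith [Nat.mul_le_mul hr hQ]
  have a2 : r ≤ n * r * Q := by nlinarith [Nat.mul_le_mul hn hQ]
  have a3 : n * Q ≤ n * r * Q := by nlinarith [Nat.mul_le_mul_left (n * Q) hr]
  have a4 : r * Q ≤ n * r * Q := by nlinarith [Nat.mul_le_mul_left (r * Q) hn]
  have a5 : n * r ≤ n * r * Q := by nlinarith [Nat.mul_le_mul_left (n * r) hQ]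
  linarith

theorem runsIn_diagMul {a : Fin n → ℝ} {A : Fin n → Fin r → ℝ} (h : ∀ i k, |a i * A i k| ≤ B) :
    RunsIn (ℓ := ℓ) (diagMul a A) (fun i k => a i * A i k) (n * (r * (charge ℓ B + 1) + 1)) :=
  runsIn_tabulate fun i => runsIn_tabulate fun k => runsIn_mul (h i k)

theorem runsIn_l1Dist (hB : 0 ≤ B) {a b : Fin n → ℝ} (h : ∑ i, |a i - b i| ≤ B) :
    RunsIn (ℓ := ℓ) (l1Dist a b) (∑ i, |a i - b i|)
      (n * (charge ℓ B + charge ℓ B + charge ℓ B + 1) + charge ℓ B) := by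
  have h1 : ∀ i, |a i - b i| ≤ B := fun i =>
    (Finset.single_le_sum (f := fun i => |a i - b i|) (fun _ _ => abs_nonneg _)
      (Finset.mem_univ i)).trans h
  exact runsIn_sumLoop hB (fun i => (runsIn_sub (h1 i)).bind (runsIn_abs (h1 i)))
    (by simpa only [abs_abs] using h)

theorem abs_coord_le (y : EuclideanSpace ℝ (Fin d)) (l : Fin d) : |y l| ≤ ‖y‖ := by
  simpa using PiLp.norm_apply_le y l

theorem runsIn_sqNorm (hB : 1 ≤ B) {y : EuclideanSpace ℝ (Fin d)} (hy : ‖y‖ ≤ 1) :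
    RunsIn (ℓ := ℓ) (sqNorm y) (∑ l, y l * y l)
      (d * (charge ℓ B + charge ℓ B + 1) + charge ℓ B) := by
  have h : ∑ l, |y l * y l| ≤ B := by
    simp only [abs_mul_self]
    rw [sum_mul_self_eq]
    nlinarith [norm_nonneg y]
  exact runsIn_sumLoop (by linarith) (fun l => runsIn_mul
    ((Finset.single_le_sum (f := fun l => |y l * y l|) (fun _ _ => abs_nonneg _)
      (Finset.mem_univ l)).trans h)) h

theorem runsIn_feature {s : ℝ} {M : ℕ} {y : EuclideanSpace ℝ (Fin d)} {v : Fin d → ℕ}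
    (hB : 2 ≤ B) (hs : 0 < s) (hs1 : s ≤ 1) (hsB : 1 / (s * s) ≤ B) (hMB : (M : ℝ) ≤ B)
    (hy : ‖y‖ ≤ 1) (hv : ∑ j, v j < M) :
    RunsIn (ℓ := ℓ) (feature s y v) (featureValue s y v) (20 * charge ℓ B * (d + M)) := by
  have hss : s * s ≤ 1 := mul_le_one₀ hs1 hs.le hs1
  have hss0 : 0 < s * s := by positivity
  have hn0 : 0 ≤ ∑ l, y l * y l := Finset.sum_nonneg fun l _ => mul_self_nonneg _
  have hn1 : ∑ l, y l * y l ≤ 1 := by rw [sum_mul_self_eq]; nlinarith [norm_nonneg y]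
  have hquot : (∑ l, y l * y l) / (2 * (s * s)) ≤ B := by
    refine le_trans ?_ hsB
    exact div_le_div₀ zero_le_one hn1 hss0 (by linarith)
  have hq0 : 0 ≤ (∑ l, y l * y l) / (2 * (s * s)) := by positivity
  have hdiv : ∀ j, |y j / s| ≤ B := fun j => by
    rw [abs_div, abs_of_pos hs]
    refine le_trans ?_ hsB
    exact div_le_div₀ zero_le_one ((abs_coord_le y j).trans hy) hss0 (by nlinarith)
  have hinner : ∀ (j : Fin d) (u : Fin d → ℕ),
      RunsIn (ℓ := ℓ) (forLoop (v j) (fun m c => do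
        let c ← mul c (← div (y j) s)
        div c (← sqrt (← lit (m + 1)))) (featureValue s y (Function.update u j 0)))
        (featureValue s y (Function.update u j (v j))) (v j * (6 * charge ℓ B)) := by
    intro j u
    refine RunsIn.mono (runsIn_forLoop (fun m => featureValue s y (Function.update u j m))
      (T := fun _ => charge ℓ B + (charge ℓ B + (charge ℓ B + (charge ℓ B + charge ℓ B))))
      fun m => ?_) ?_
    · have hm : ((m.val + 1 : ℕ) : ℝ) ≤ B := by
        refine le_trans ?_ hMB
        have h1 : v j ≤ ∑ j, v j := Finset.single_le_sum (fun _ _ => Nat.zero_le _)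
          (Finset.mem_univ j)
        have := m.2
        exact_mod_cast (by omega : m.val + 1 ≤ M)
      simp only [featureValue_update_succ]
      refine (runsIn_div (hdiv j)).bind ((runsIn_mul ?_).bind ((runsIn_lit hm).bind
        ((runsIn_sqrt ?_).bind (runsIn_div ?_))))
      · rw [abs_mul]
        exact (mul_le_of_le_one_left (abs_nonneg _) (abs_featureValue_le_one y _)).trans (hdiv j)
      · refine (Real.sqrt_le_left (by linarith)).2 ?_
        nlinarith
      · rw [← featureValue_update_succ]
        exact (abs_featureValue_le_one y _).trans (by linarith)
    · have hQ := one_le_charge ℓ B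
      simp only [Finset.sum_const, Finset.card_univ, Fintype.card_fin, smul_eq_mul]
      exact Nat.mul_le_mul_left _ (by omega)
  set t : ℕ → Fin d → ℕ := fun m i => if i.val < m then v i else 0
  have ht0 : ∀ j : Fin d, Function.update (t j) j 0 = t j := fun j => by
    refine Function.update_eq_self_iff.2 ?_
    simp [t]
  have ht1 : ∀ j : Fin d, Function.update (t j) j (v j) = t (j + 1) := fun j => by
    funext i
    rcases lt_trichotomy i j with h | h | h
    · have h' : i.val < j.val := h
      rw [Function.update_of_ne h.ne]
      simp [t, h', Nat.lt_succ_of_lt h']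
    · subst h; simp [t]
    · have h' : j.val < i.val := h
      rw [Function.update_of_ne h.ne']
      simp [t, not_lt.2 h'.le, not_le.2 h']
  have houter := runsIn_forLoop (ℓ := ℓ) (n := d) (body := fun j c =>
    forLoop (v j) (fun m c => do
      let c ← mul c (← div (y j) s)
      div c (← sqrt (← lit (m + 1)))) c) (fun m => featureValue s y (t m))
    (T := fun j => v j * (6 * charge ℓ B)) fun j => by
      have := hinner j (t j)
      rwa [ht0, ht1] at this
  have e0 : featureValue s y (t 0) = Real.exp (((0 : ℕ) : ℝ) - (∑ l, y l * y l) /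
      (((2 : ℕ) : ℝ) * (s * s))) := by
    simp [featureValue, t]
  have ed : t d = v := by funext i; simp [t]
  simp only at houter
  rw [ed, e0] at houter
  refine RunsIn.mono ((runsIn_sqNorm (B := B) (by linarith) hy).bind ((runsIn_lit (by simpa using hB)).bind
    ((runsIn_mul (B := B) ?_).bind ((runsIn_mul (B := B) ?_).bind ((runsIn_lit (B := B) ?_).bind
    ((runsIn_div (B := B) ?_).bind ((runsIn_sub (B := B) ?_).bind ((runsIn_exp (B := B) ?_).bind
    houter)))))))) ?_
  · rw [abs_of_pos hss0]; linarith
  · push_cast; rw [abs_of_pos (by positivity)]; linarith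
  · simp; linarith
  · push_cast; rwa [abs_of_nonneg hq0]
  · push_cast; rwa [zero_sub, abs_neg, abs_of_nonneg hq0]
  · push_cast
    refine (Real.exp_le_one_iff.2 (by linarith)).trans (by linarith)
  · have hQ := one_le_charge ℓ B
    generalize charge ℓ B = Q at *
    rw [Finset.sum_add_distrib, ← Finset.sum_mul]
    simp only [Finset.sum_const, Finset.card_univ, Fintype.card_fin, smul_eq_mul, mul_one]
    generalize ∑ j, v j = V at *
    have h1 : V * Q + Q ≤ M * Q := by nlinarith
    have h2 : d ≤ d * Q := Nat.le_mul_of_pos_right d hQ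
    nlinarith

theorem runsIn_taylorGKM {s : ℝ} {M : ℕ} {x : Fin n → EuclideanSpace ℝ (Fin d)}
    (hn : 1 ≤ n) (hM : 1 ≤ M)
    (hB : 2 ≤ B) (hs : 0 < s) (hs1 : s ≤ 1) (hsB : 1 / (s * s) ≤ B) (hMB : (M : ℝ) ≤ B)
    (hx : ∀ i, ‖x i‖ ≤ 1) :
    RunsIn (ℓ := ℓ) (taylorGKM x s M) (fun i k => featureValue s (x i) ((exponents d M).get k))
      (25 * (n * (exponents d M).length * charge ℓ B) * (d + M)) := by
  refine RunsIn.mono ((runsIn_tick _).bind (runsIn_tabulate fun i => runsIn_tabulate fun k =>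
    runsIn_feature hB hs hs1 hsB hMB (hx i) (sum_lt_of_mem_exponents (List.get_mem _ k)))) ?_
  have hQ := one_le_charge ℓ B
  have hr : 1 ≤ (exponents d M).length := by
    rw [length_exponents d M hM]
    exact Nat.choose_pos (by omega)
  generalize charge ℓ B = Q at *
  generalize (exponents d M).length = r at *
  set X := n * r * Q
  have a1 : n * r ≤ X * (d + M) := by
    calc n * r = n * r * 1 * 1 := by ring
      _ ≤ _ := Nat.mul_le_mul (Nat.mul_le_mul le_rfl hQ) (by omega)
  have a2 : n ≤ X * (d + M) := le_trans (Nat.le_mul_of_pos_right n hr) a1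
  have a3 : (d + 1) * r ≤ X * (d + M) := by
    calc (d + 1) * r = 1 * r * 1 * (d + 1) := by ring
      _ ≤ _ := Nat.mul_le_mul (Nat.mul_le_mul (Nat.mul_le_mul hn le_rfl) hQ) (by omega)
  have e : n * (r * (20 * Q * (d + M) + 1) + 1) = 20 * (X * (d + M)) + n * r + n := by
    simp only [X]; ring
  rw [e, mul_assoc 25]
  omega

theorem runsIn_smooth {τ : ℝ} {p : Fin n → ℝ} (hn : 1 ≤ n) (hB : 1 ≤ B) (hnB : (n : ℝ) ≤ B)
    (hτ : 0 ≤ τ) (hτ1 : τ ≤ 1) (hp0 : ∀ i, 0 ≤ p i) (hp1 : ∀ i, p i ≤ 1) :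
    RunsIn (ℓ := ℓ) (smooth τ p) (fun i => (1 - τ) * p i + τ / n)
      (7 * (n * charge ℓ B)) := by
  have hn0 : (1 : ℝ) ≤ n := by exact_mod_cast hn
  have h1 : τ / n ≤ τ := div_le_self hτ hn0
  have h2 : 0 ≤ τ / n := by positivity
  have h3 : ∀ i, 0 ≤ (1 - τ) * p i := fun i => mul_nonneg (by linarith) (hp0 i)
  have h4 : ∀ i, (1 - τ) * p i ≤ 1 - τ := fun i => mul_le_of_le_one_right (by linarith) (hp1 i)
  have key : RunsIn (ℓ := ℓ) (smooth τ p) (fun i => (((1 : ℕ) : ℝ) - τ) * p i + τ / n)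
      (charge ℓ B + (charge ℓ B + (charge ℓ B + (charge ℓ B +
        n * (charge ℓ B + charge ℓ B + 1))))) := by
    refine (runsIn_lit (by simpa using hB)).bind ((runsIn_sub ?_).bind
      ((runsIn_lit hnB).bind ((runsIn_div ?_).bind (runsIn_tabulate fun i =>
      (runsIn_mul ?_).bind (runsIn_add ?_)))))
    · push_cast; rw [abs_of_nonneg (by linarith)]; linarith
    · rw [abs_of_nonneg h2]; linarith
    · push_cast; rw [abs_of_nonneg (h3 i)]; linarith [h4 i]
    · push_cast; rw [abs_of_nonneg (add_nonneg (h3 i) h2)]; linarith [h4 i]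
  rw [Nat.cast_one] at key
  refine key.mono ?_
  have hQ := one_le_charge ℓ B
  generalize charge ℓ B = Q at *
  nlinarith [Nat.mul_le_mul hn hQ]

end Programs


section Programs

variable {ℓ n d r : ℕ} {B : ℝ}

/-- The marginal `a ∘ K b` of a scaled matrix. -/
def scaledMarginal (K : Fin n → Fin n → ℝ) (a b : Fin n → ℝ) (i : Fin n) : ℝ :=
  a i * ∑ j, K i j * b j

/-- The quantity compared with `δ / 2` in a pass of Sinkhorn scaling. -/
def marginalError (K : Fin n → Fin n → ℝ) (p q a b : Fin n → ℝ) : ℝ :=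
  ∑ i, |scaledMarginal K a b i - p i| + ∑ j, |scaledMarginal K b a j - q j|

theorem runsIn_sinkhornStep (hn : 1 ≤ n) (hr : 1 ≤ r) {V : Fin n → Fin r → ℝ}
    {p q a b : Fin n → ℝ} {δ A : ℝ} {k : ℕ} (hV : FactorBound V V 1) (hA : 1 ≤ A)
    (hAB : 5 * n ^ 2 * A ^ 2 ≤ B) (hδ : 0 < δ) (hδ1 : δ ≤ 1)
    (hp : ∀ i, |p i| ≤ 1) (hq : ∀ i, |q i| ≤ 1)
    (ha : ∀ i, |a i| ≤ A) (hb : ∀ i, |b i| ≤ A)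
    (ha' : k % 2 = 0 → ∀ i, |a i * p i / scaledMarginal (factorProd V V) a b i| ≤ A)
    (hb' : k % 2 ≠ 0 → ∀ j, |b j * q j / scaledMarginal (factorProd V V) b a j| ≤ A) :
    RunsIn (ℓ := ℓ) (sinkhornStep V p q δ (k, a, b))
      (if marginalError (factorProd V V) p q a b ≤ δ / 2 then Sum.inl (a, b)
      else if k % 2 = 0 then
        Sum.inr (k + 1, fun i => a i * p i / scaledMarginal (factorProd V V) a b i, b)
      else Sum.inr (k + 1, a, fun j => b j * q j / scaledMarginal (factorProd V V) b a j))
      (50 * (n * r * charge ℓ B)) := by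
  have hn0 : (1 : ℝ) ≤ n := by exact_mod_cast hn
  have hA2 : 1 ≤ A ^ 2 := one_le_pow₀ hA
  have hAA : A ≤ A ^ 2 := by nlinarith
  have hnn : (n : ℝ) ≤ n ^ 2 := by nlinarith
  have hnA : n * A ^ 2 ≤ n ^ 2 * A ^ 2 := mul_le_mul_of_nonneg_right hnn (by positivity)
  have hnA1 : A ^ 2 ≤ n * A ^ 2 := by nlinarith
  have hB : 0 ≤ B := by linarith
  have hmv : ∀ w : Fin n → ℝ, (∀ i, |w i| ≤ A) → ∀ i,
      |∑ j, factorProd V V i j * w j| ≤ n * A := fun w hw i =>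
    (Finset.abs_sum_le_sum_abs _ _).trans (sum_le_card_mul fun j => by
      rw [abs_mul]
      exact (mul_le_mul (hV.abs_factorProd_le i j) (hw j) (abs_nonneg _) zero_le_one).trans
        (one_mul _).le)
  have hmarg : ∀ v w : Fin n → ℝ, (∀ i, |v i| ≤ A) → (∀ i, |w i| ≤ A) → ∀ i,
      |scaledMarginal (factorProd V V) v w i| ≤ n * A ^ 2 := fun v w hv hw i => by
    rw [scaledMarginal, abs_mul]
    refine (mul_le_mul (hv i) (hmv w hw i) (abs_nonneg _) (by linarith)).trans (le_of_eq ?_)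
    ring
  have herr : ∀ v w m : Fin n → ℝ, (∀ i, |v i| ≤ A) → (∀ i, |w i| ≤ A) → (∀ i, |m i| ≤ 1) →
      ∑ i, |scaledMarginal (factorProd V V) v w i - m i| ≤ 2 * n ^ 2 * A ^ 2 :=
    fun v w m hv hw hm => by
    refine (sum_le_card_mul (c := 2 * (n * A ^ 2)) fun i => ?_).trans (le_of_eq (by ring))
    have := abs_sub (scaledMarginal (factorProd V V) v w i) (m i)
    linarith [hmarg v w hv hw i, hm i]
  have he0 : 0 ≤ marginalError (factorProd V V) p q a b :=
    add_nonneg (Finset.sum_nonneg fun _ _ => abs_nonneg _)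
      (Finset.sum_nonneg fun _ _ => abs_nonneg _)
  have he1 : marginalError (factorProd V V) p q a b ≤ 4 * n ^ 2 * A ^ 2 := by
    have := herr a b p ha hb hp
    have := herr b a q hb ha hq
    unfold marginalError; linarith
  have hmul : ∀ v m : Fin n → ℝ, (∀ i, |v i| ≤ A) → (∀ i, |m i| ≤ 1) → ∀ i, |v i * m i| ≤ B :=
    fun v m hv hm i => by
    rw [abs_mul]
    refine (mul_le_mul (hv i) (hm i) (abs_nonneg _) (by linarith)).trans ?_
    linarith
  have tail : RunsIn (ℓ := ℓ) (if decide (marginalError (factorProd V V) p q a b ≤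
        δ / ((2 : ℕ) : ℝ)) = true
      then pure (Sum.inl (a, b))
      else if k % 2 = 0 then do
        let a' ← tabulate n fun i => do
          div (← mul (a i) (p i)) (scaledMarginal (factorProd V V) a b i)
        pure (Sum.inr (k + 1, a', b))
      else do
        let b' ← tabulate n fun j => do
          div (← mul (b j) (q j)) (scaledMarginal (factorProd V V) b a j)
        pure (Sum.inr (k + 1, a, b')))
      (if marginalError (factorProd V V) p q a b ≤ δ / 2 then Sum.inl (a, b)
      else if k % 2 = 0 then
        Sum.inr (k + 1, fun i => a i * p i / scaledMarginal (factorProd V V) a b i, b)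
      else Sum.inr (k + 1, a, fun j => b j * q j / scaledMarginal (factorProd V V) b a j))
      (n * (charge ℓ B + charge ℓ B + 1) + 0) := by
    have hA' : A ≤ B := by linarith
    rw [Nat.cast_ofNat]
    by_cases h : marginalError (factorProd V V) p q a b ≤ δ / 2
    · simp only [h, decide_true, if_true]
      exact (runsIn_pure _).mono (Nat.zero_le _)
    · simp only [h, decide_false, if_false, Bool.false_eq_true]
      by_cases hk : k % 2 = 0
      · simp only [hk, if_true]
        exact (runsIn_tabulate fun i => (runsIn_mul (hmul a p ha hp i)).bind
          (runsIn_div (y := scaledMarginal (factorProd V V) a b i) ((ha' hk i).trans hA'))).bind (runsIn_pure _)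
      · simp only [hk, if_false]
        exact (runsIn_tabulate fun i => (runsIn_mul (hmul b q hb hq i)).bind
          (runsIn_div (y := scaledMarginal (factorProd V V) b a i) ((hb' hk i).trans hA'))).bind (runsIn_pure _)
  have hfm : (n : ℝ) * (1 * A) ≤ B := by nlinarith
  refine RunsIn.mono ((runsIn_factoredMulVec hB hn hr hV hb hfm).bind
    ((runsIn_tabulate (a := scaledMarginal (factorProd V V) a b) fun i =>
      runsIn_mul (B := B) ?_).bind
    ((runsIn_factoredMulVec hB hn hr hV ha hfm).bind
    ((runsIn_tabulate (a := scaledMarginal (factorProd V V) b a) fun i =>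
      runsIn_mul (B := B) ?_).bind
    ((runsIn_l1Dist hB ?_).bind ((runsIn_l1Dist hB ?_).bind
    ((runsIn_add (B := B) ?_).bind ((runsIn_lit (k := 2) (B := B) ?_).bind
    ((runsIn_div (B := B) ?_).bind ((runsIn_le (B := B) ?_).bind tail)))))))))) ?_
  · exact (hmarg a b ha hb i).trans (by linarith)
  · exact (hmarg b a hb ha i).trans (by linarith)
  · exact (herr a b p ha hb hp).trans (by linarith)
  · exact (herr b a q hb ha hq).trans (by linarith)
  · exact (abs_of_nonneg he0).le.trans (by linarith)
  · push_cast; linarith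
  · push_cast; rw [abs_of_pos (by positivity)]; linarith
  · have h2 : |marginalError (factorProd V V) p q a b - δ / ((2 : ℕ) : ℝ)| ≤ B := by
      push_cast; rw [abs_le]; constructor <;> linarith
    exact h2
  have hQ := one_le_charge ℓ B
  generalize charge ℓ B = Q at *
  have a1 : n ≤ n * r * Q := by nlinarith [Nat.mul_le_mul hr hQ]
  have a3 : n * Q ≤ n * r * Q := by nlinarith [Nat.mul_le_mul_left (n * Q) hr]
  have a5 : Q ≤ n * r * Q := by nlinarith [Nat.mul_le_mul_left Q (Nat.mul_le_mul hn hr)]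
  linarith

/-- The state of Sinkhorn scaling after `k` updates. -/
def sinkhornState (K : Fin n → Fin n → ℝ) (p q : Fin n → ℝ) (k : ℕ) : (Fin n → ℝ) × (Fin n → ℝ) :=
  if k % 2 = 0 then (sinkhornSeq K p q k, sinkhornSeq K p q (k + 1))
  else (sinkhornSeq K p q (k + 1), sinkhornSeq K p q k)

theorem marginalError_sinkhornState (K : Fin n → Fin n → ℝ) (p q : Fin n → ℝ) (k : ℕ) :
    marginalError K p q (sinkhornState K p q k).1 (sinkhornState K p q k).2 =
      totalError K p q k := by
  rcases Nat.mod_two_eq_zero_or_one k with h | h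
  · have h' : (k + 1) % 2 ≠ 0 := by omega
    simp [sinkhornState, h, marginalError, totalError, scalingError, altMarginal, h',
      scaledMarginal]
  · have h' : (k + 1) % 2 = 0 := by omega
    have h'' : k % 2 ≠ 0 := by omega
    simp [sinkhornState, h'', marginalError, totalError, scalingError, altMarginal, h',
      scaledMarginal, add_comm]

theorem runsIn_sinkhorn_loop (hr : 1 ≤ r) {V : Fin n → Fin r → ℝ} {p q : Fin n → ℝ}
    {κ μ δ : ℝ} (S : ScalingData (factorProd V V) p q κ μ) (hV : FactorBound V V 1)
    (hAB : 5 * n ^ 2 * (1 / (κ * (μ / n))) ^ 2 ≤ B) (hδ : 0 < δ) (hδ1 : δ ≤ 1) {N : ℕ}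
    (hN : totalError (factorProd V V) p q N ≤ δ / 2)
    (hN' : ∀ k < N, δ / 2 < totalError (factorProd V V) p q k) :
    RunsIn (ℓ := ℓ) (repeatUntil (sinkhornStep V p q δ) (0, (fun _ => 1), (fun _ => 1)))
      (sinkhornState (factorProd V V) p q N) ((N + 1) * (50 * (n * r * charge ℓ B) + 1)) := by
  set K := factorProd V V
  have hn : 1 ≤ n := by have := S.two_le; omega
  have hA : 1 ≤ 1 / (κ * (μ / n)) := by
    obtain ⟨i⟩ := S.nonempty
    exact S.seq_le 0 i
  have habs : ∀ k i, |sinkhornSeq K p q k i| ≤ 1 / (κ * (μ / n)) := fun k i => by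
    rw [abs_of_pos (S.seq_pos k i)]; exact S.seq_le k i
  have hm : ∀ k i, |altMarginal p q k i| ≤ 1 := fun k i => by
    rw [abs_of_pos (S.marginal_pos k i)]; exact S.marginal_le_one k i
  have hp : ∀ i, |p i| ≤ 1 := hm 0
  have hq : ∀ i, |q i| ≤ 1 := hm 1
  have hnext : ∀ k, (fun i => sinkhornSeq K p q k i * altMarginal p q k i /
      scaledMarginal K (sinkhornSeq K p q k) (sinkhornSeq K p q (k + 1)) i) =
      sinkhornSeq K p q (k + 2) := fun k => rfl
  have hstep : ∀ k, RunsIn (ℓ := ℓ) (sinkhornStep V p q δ (k, sinkhornState K p q k))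
      (if totalError K p q k ≤ δ / 2 then Sum.inl (sinkhornState K p q k)
      else Sum.inr (k + 1, sinkhornState K p q (k + 1))) (50 * (n * r * charge ℓ B)) := fun k => by
    have ha : ∀ i, |(sinkhornState K p q k).1 i| ≤ 1 / (κ * (μ / n)) := fun i => by
      unfold sinkhornState; split_ifs <;> exact habs _ i
    have hb : ∀ i, |(sinkhornState K p q k).2 i| ≤ 1 / (κ * (μ / n)) := fun i => by
      unfold sinkhornState; split_ifs <;> exact habs _ i
    have h := runsIn_sinkhornStep (ℓ := ℓ) (k := k) hn hr hV hA hAB hδ hδ1 hp hq ha hb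
      (fun hk i => by
        have := congrFun (hnext k) i
        simp only [altMarginal, hk, if_true] at this
        simp only [sinkhornState, hk, if_true]
        rw [this]; exact habs _ i)
      (fun hk i => by
        have := congrFun (hnext k) i
        simp only [altMarginal, hk, if_false] at this
        simp only [sinkhornState, hk, if_false]
        rw [this]; exact habs _ i)
    rw [marginalError_sinkhornState] at h
    refine h.congr ?_
    split_ifs with h1 h2
    · rfl
    · have h3 : (k + 1) % 2 ≠ 0 := by omega
      have := hnext k
      simp only [altMarginal, h2, if_true] at this
      simp only [sinkhornState, h2, h3, if_true, if_false]
      rw [← this]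
    · have h3 : (k + 1) % 2 = 0 := by omega
      have := hnext k
      simp only [altMarginal, h2, if_false] at this
      simp only [sinkhornState, h2, h3, if_true, if_false]
      rw [← this]
  refine runsIn_repeatUntil N (fun k => (k, sinkhornState K p q k)) (fun k hk => ?_) ?_
  · have h := hstep k
    rwa [if_neg (not_le.2 (hN' k hk))] at h
  · have h := hstep N
    rwa [if_pos hN] at h

end Programs


section Programs

variable {ℓ n d r : ℕ} {B : ℝ}

/-- The smoothed marginals. -/
def smoothed (τ : ℝ) (p : Fin n → ℝ) (i : Fin n) : ℝ := (1 - τ) * p i + τ / n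

theorem runsIn_sinkhorn (hr : 1 ≤ r) {V : Fin n → Fin r → ℝ} {p q : Fin n → ℝ}
    {κ μ δ : ℝ} (hp : p ∈ stdSimplex ℝ (Fin n)) (hq : q ∈ stdSimplex ℝ (Fin n))
    (S : ScalingData (factorProd V V) (smoothed (δ / 8) p) (smoothed (δ / 8) q) κ μ)
    (hV : FactorBound V V 1) (hnB : (n : ℝ) ≤ B) (hB8 : 8 ≤ B)
    (hAB : 5 * n ^ 2 * (1 / (κ * (μ / n))) ^ 2 ≤ B) (hδ : 0 < δ) (hδ1 : δ ≤ 1) {N : ℕ}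
    (hN : totalError (factorProd V V) (smoothed (δ / 8) p) (smoothed (δ / 8) q) N ≤ δ / 2)
    (hN' : ∀ k < N, δ / 2 <
      totalError (factorProd V V) (smoothed (δ / 8) p) (smoothed (δ / 8) q) k) :
    RunsIn (ℓ := ℓ) (sinkhorn V p q δ)
      (sinkhornState (factorProd V V) (smoothed (δ / 8) p) (smoothed (δ / 8) q) N)
      ((N + 1) * (100 * (n * r * charge ℓ B))) := by
  have hn : 1 ≤ n := by have := S.two_le; omega
  have hle : ∀ {p : Fin n → ℝ}, p ∈ stdSimplex ℝ (Fin n) → ∀ i, p i ≤ 1 := fun hp i => by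
    rw [← hp.2]; exact Finset.single_le_sum (fun j _ => hp.1 j) (Finset.mem_univ i)
  have loop := runsIn_sinkhorn_loop (ℓ := ℓ) hr S hV hAB hδ hδ1 hN hN'
  rw [← Nat.cast_one (R := ℝ)] at loop
  refine RunsIn.mono ((runsIn_lit (k := 8) (B := B) ?_).bind ((runsIn_div (B := B) ?_).bind
    ((runsIn_smooth (B := B) hn (by linarith) hnB (by positivity) ?_ hp.1 (hle hp)).bind
    ((runsIn_smooth (B := B) hn (by linarith) hnB (by positivity) ?_ hq.1 (hle hq)).bind
    ((runsIn_tabulate fun i => runsIn_lit (k := 1) (B := B) ?_).bind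
    ((runsIn_tabulate fun i => runsIn_lit (k := 1) (B := B) ?_).bind loop)))))) ?_
  · push_cast; exact hB8
  · push_cast; rw [abs_of_pos (by positivity)]; linarith
  · push_cast; linarith
  · push_cast; linarith
  · push_cast; linarith
  · push_cast; linarith
  · have hQ := one_le_charge ℓ B
    generalize charge ℓ B = Q at *
    have a1 : n ≤ n * r * Q := by nlinarith [Nat.mul_le_mul hr hQ]
    have a3 : n * Q ≤ n * r * Q := by nlinarith [Nat.mul_le_mul_left (n * Q) hr]
    have a5 : Q ≤ n * r * Q := by nlinarith [Nat.mul_le_mul_left Q (Nat.mul_le_mul hn hr)]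
    have a6 : 1 ≤ n * r * Q := hQ.trans a5
    generalize n * r * Q = X at *
    have a7 : N ≤ N * X := Nat.le_mul_of_pos_right N a6
    have a8 : 1 ≤ (N + 1) * X := by nlinarith
    nlinarith

theorem runsIn_round (hn : 1 ≤ n) (hr : 1 ≤ r) {L R : Fin n → Fin r → ℝ} {p q : Fin n → ℝ} {A : ℝ}
    (hp : p ∈ stdSimplex ℝ (Fin n)) (hq : q ∈ stdSimplex ℝ (Fin n))
    (hLR : FactorBound L R A) (hA : 1 ≤ A) (hAB : 4 * n ^ 2 * A ≤ B)
    (hF : ∀ i j, 0 ≤ factorProd L R i j)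
    (hrow : ∀ i, p i / ∑ j, factorProd L R i j ≤ B)
    (hcol : ∀ j, q j / ∑ i, scaledRows (factorProd L R) p i j ≤ B) :
    RunsIn (ℓ := ℓ) (round L R p q)
      { rank := r + 1
        left := fun i => Fin.snoc (α := fun _ => ℝ)
          (fun k => rowScale (factorProd L R) p i * L i k) (correction (factorProd L R) p q i)
        right := fun j => Fin.snoc (α := fun _ => ℝ)
          (fun k => colScale (factorProd L R) p q j * R j k) (colDefect (factorProd L R) p q j) }
      (100 * (n * r * charge ℓ B)) := by
  set F := factorProd L R with hFdef
  set L' : Fin n → Fin r → ℝ := fun i k => rowScale F p i * L i k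
  set R' : Fin n → Fin r → ℝ := fun j k => colScale F p q j * R j k
  have hn0 : (1 : ℝ) ≤ n := by exact_mod_cast hn
  have hnn : (n : ℝ) ≤ n ^ 2 := by nlinarith
  have hnA : n * A ≤ n ^ 2 * A := mul_le_mul_of_nonneg_right hnn (by linarith)
  have hnA1 : A ≤ n * A := by nlinarith
  have hn2 : (n : ℝ) ^ 2 ≤ n ^ 2 * A := le_mul_of_one_le_right (by positivity) hA
  have hB1 : 1 ≤ B := by linarith
  have hB : 0 ≤ B := by linarith
  have hle : ∀ {p : Fin n → ℝ}, p ∈ stdSimplex ℝ (Fin n) → ∀ i, p i ≤ 1 := fun hp i => by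
    rw [← hp.2]; exact Finset.single_le_sum (fun j _ => hp.1 j) (Finset.mem_univ i)
  have hx0 := rowScale_nonneg hF hp.1
  have hx1 := rowScale_le_one F p
  have hy0 := colScale_nonneg hF hp hq
  have hy1 : ∀ j, colScale F p q j ≤ 1 := fun j => colScale_le_one j
  have hL'R : FactorBound L' R A := by
    simpa only [one_mul] using hLR.scale hx0 hx1 (y := fun _ => 1) (fun _ => zero_le_one)
      fun _ => le_rfl
  have hL'R' : FactorBound L' R' A := hLR.scale hx0 hx1 hy0 hy1
  have hones : ∀ i : Fin n, |((1 : ℕ) : ℝ)| ≤ 1 := fun _ => by simp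
  have hA1 : n * (A * 1) ≤ B := by linarith
  have hrows : (fun i => ∑ j, factorProd L R i j * ((1 : ℕ) : ℝ)) = fun i => ∑ j, F i j := by
    funext i; simp [hFdef]
  have hcols : (fun j => ∑ i, factorProd R L' j i * ((1 : ℕ) : ℝ)) =
      fun j => ∑ i, scaledRows F p i j := by
    funext j
    refine Finset.sum_congr rfl fun i _ => ?_
    simp only [factorProd, scaledRows, L', F, Nat.cast_one, mul_one, Finset.mul_sum]
    exact Finset.sum_congr rfl fun k _ => by ring
  have hF'' : ∀ i j, factorProd L' R' i j = scaledDown F p q i j := fun i j => by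
    simp only [factorProd, scaledDown, L', R', F, Finset.mul_sum]
    exact Finset.sum_congr rfl fun k _ => by ring
  have hrows' : (fun i => ∑ j, factorProd L' R' i j * ((1 : ℕ) : ℝ)) =
      fun i => ∑ j, scaledDown F p q i j := by
    funext i; simp [hF'']
  have hcols' : (fun j => ∑ i, factorProd R' L' j i * ((1 : ℕ) : ℝ)) =
      fun j => ∑ i, scaledDown F p q i j := by
    funext j
    refine Finset.sum_congr rfl fun i _ => ?_
    rw [Nat.cast_one, mul_one, ← hF'']
    exact Finset.sum_congr rfl fun k _ => mul_comm _ _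
  have hdr : ∀ i, |rowDefect F p q i| ≤ 1 := fun i => by
    rw [abs_of_nonneg (rowDefect_nonneg hF hp i)]
    have := Finset.sum_nonneg fun j (_ : j ∈ Finset.univ) => scaledDown_nonneg hF hp hq i j
    unfold rowDefect
    linarith [hle hp i]
  have hdc : ∀ j, |colDefect F p q j| ≤ 1 := fun j => by
    rw [abs_of_nonneg (colDefect_nonneg hF hp hq j)]
    have := Finset.sum_nonneg fun i (_ : i ∈ Finset.univ) => scaledDown_nonneg hF hp hq i j
    unfold colDefect
    linarith [hle hq j]
  have hs : ∑ i, |rowDefect F p q i| ≤ B :=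
    (sum_le_card_mul hdr).trans (by linarith)
  have hs0 : 0 ≤ ∑ i, |rowDefect F p q i| := Finset.sum_nonneg fun _ _ => abs_nonneg _
  have hu : ∀ i, |correction F p q i| ≤ 1 := fun i => by
    rw [abs_of_nonneg (correction_nonneg hF hp i)]
    exact correction_le_one i
  have fin : ∀ u : Fin n → ℝ, RunsIn (ℓ := ℓ) (do
      let left ← tabulate n fun i => pure (Fin.snoc (α := fun _ => ℝ) (L' i) (u i))
      let right ← tabulate n fun j => pure (Fin.snoc (α := fun _ => ℝ) (R' j) (colDefect F p q j))
      return ({ rank := r + 1, left := left, right := right } : Factored n))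
      { rank := r + 1
        left := fun i => Fin.snoc (α := fun _ => ℝ) (L' i) (u i)
        right := fun j => Fin.snoc (α := fun _ => ℝ) (R' j) (colDefect F p q j) }
      (n * (0 + 1) + (n * (0 + 1) + 0)) := fun u =>
    (runsIn_tabulate fun _ => runsIn_pure _).bind
      ((runsIn_tabulate fun _ => runsIn_pure _).bind (runsIn_pure _))
  have mid : RunsIn (ℓ := ℓ) (
      if decide (∑ i, |rowDefect F p q i| ≤ ((0 : ℕ) : ℝ)) = true then do
        let u ← pure (rowDefect F p q)
        let left ← tabulate n fun i => pure (Fin.snoc (α := fun _ => ℝ) (L' i) (u i))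
        let right ← tabulate n fun j => pure (Fin.snoc (α := fun _ => ℝ) (R' j) (colDefect F p q j))
        return ({ rank := r + 1, left := left, right := right } : Factored n)
      else do
        let u ← tabulate n fun i => div (rowDefect F p q i) (∑ i, |rowDefect F p q i|)
        let left ← tabulate n fun i => pure (Fin.snoc (α := fun _ => ℝ) (L' i) (u i))
        let right ← tabulate n fun j => pure (Fin.snoc (α := fun _ => ℝ) (R' j) (colDefect F p q j))
        return ({ rank := r + 1, left := left, right := right } : Factored n))
      { rank := r + 1
        left := fun i => Fin.snoc (α := fun _ => ℝ) (L' i) (correction F p q i)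
        right := fun j => Fin.snoc (α := fun _ => ℝ) (R' j) (colDefect F p q j) }
      (n * (charge ℓ B + 1) + (n * (0 + 1) + (n * (0 + 1) + 0))) := by
    rw [Nat.cast_zero]
    by_cases h : ∑ i, |rowDefect F p q i| ≤ 0
    · simp only [h, decide_true, if_true]
      have e : correction F p q = rowDefect F p q := by
        funext i; rw [correction, if_pos h]
      rw [e]
      exact ((runsIn_pure _).bind (fin (rowDefect F p q))).mono (by omega)
    · simp only [h, decide_false, if_false, Bool.false_eq_true]
      have e : correction F p q = fun i => rowDefect F p q i / ∑ i, |rowDefect F p q i| := by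
        funext i; rw [correction, if_neg h]
      rw [e]
      refine (runsIn_tabulate fun i => runsIn_div ?_).bind (fin _)
      have := hu i
      rw [e] at this
      exact this.trans hB1
  refine RunsIn.mono ((runsIn_tabulate fun i => runsIn_lit (k := 1) (B := B) ?_).bind
    (((runsIn_factoredMulVec hB hn hr hLR hones hA1).congr hrows).bind
    ((runsIn_tabulate (a := rowScale F p) fun i => (runsIn_div (B := B) ?_).bind
      ((runsIn_lit (B := B) ?_).bind ((runsIn_min (B := B) ?_).congr ?_))).bind
    ((runsIn_diagMul (B := B) ?_).bind
    (((runsIn_factoredMulVec hB hn hr hL'R.swap hones hA1).congr hcols).bind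
    ((runsIn_tabulate (a := colScale F p q) fun i => (runsIn_div (B := B) ?_).bind
      ((runsIn_lit (B := B) ?_).bind ((runsIn_min (B := B) ?_).congr ?_))).bind
    ((runsIn_diagMul (B := B) ?_).bind
    (((runsIn_factoredMulVec hB hn hr hL'R' hones hA1).congr hrows').bind
    (((runsIn_factoredMulVec hB hn hr hL'R'.swap hones hA1).congr hcols').bind
    ((runsIn_tabulate (a := rowDefect F p q) fun i => runsIn_sub (B := B) (hdr i |>.trans hB1)).bind
    ((runsIn_tabulate (a := colDefect F p q) fun i => runsIn_sub (B := B) (hdc i |>.trans hB1)).bind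
    ((runsIn_sumLoop hB (fun i => runsIn_abs (hdr i |>.trans hB1))
      (by simpa only [abs_abs] using hs)).bind
    ((runsIn_lit (k := 0) (B := B) ?_).bind
    ((runsIn_le (B := B) ?_).bind mid)))))))))))))) ?_
  · push_cast; exact hB1
  · rw [abs_of_nonneg (div_nonneg (hp.1 i) (Finset.sum_nonneg fun j _ => hF i j))]; exact hrow i
  · push_cast; exact hB1
  · rw [Nat.cast_one]; exact (abs_of_nonneg (hx0 i)).le.trans ((hx1 i).trans hB1)
  · rw [Nat.cast_one]; rfl
  · exact fun i k => (hL'R.left i k).trans (by linarith)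
  · rw [abs_of_nonneg (div_nonneg (hq.1 i) (Finset.sum_nonneg fun j _ =>
      scaledRows_nonneg hF hp j i))]
    exact hcol i
  · push_cast; exact hB1
  · rw [Nat.cast_one]; exact (abs_of_nonneg (hy0 i)).le.trans ((hy1 i).trans hB1)
  · rw [Nat.cast_one]; rfl
  · exact fun i k => (hL'R'.right i k).trans (by linarith)
  · push_cast; exact hB
  · rw [Nat.cast_zero, sub_zero, abs_of_nonneg hs0]; exact hs
  · have hQ := one_le_charge ℓ B
    generalize charge ℓ B = Q at *
    have a1 : n ≤ n * r * Q := by nlinarith [Nat.mul_le_mul hr hQ]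
    have a2 : n * r ≤ n * r * Q := Nat.le_mul_of_pos_right _ hQ
    have a3 : n * Q ≤ n * r * Q := by nlinarith [Nat.mul_le_mul_left (n * Q) hr]
    have a5 : Q ≤ n * r * Q := by nlinarith [Nat.mul_le_mul_left Q (Nat.mul_le_mul hn hr)]
    linarith

theorem sum_comm_pairs {ι κ ι' κ' : Type*} [Fintype ι] [Fintype κ] [Fintype ι'] [Fintype κ']
    (G : ι → κ → ι' → κ' → ℝ) :
    ∑ i, ∑ j, ∑ k, ∑ l, G i j k l = ∑ k, ∑ l, ∑ i, ∑ j, G i j k l := by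
  have h : ∀ i, ∑ j, ∑ k, ∑ l, G i j k l = ∑ k, ∑ l, ∑ j, G i j k l := fun i => by
    rw [Finset.sum_comm]
    exact Finset.sum_congr rfl fun k _ => Finset.sum_comm
  simp_rw [h]
  rw [Finset.sum_comm]
  exact Finset.sum_congr rfl fun k _ => Finset.sum_comm

/-- The value that `quadCost` computes. -/
def quadCostValue (x : Fin n → EuclideanSpace ℝ (Fin d)) (p q : Fin n → ℝ) (P : Factored n) : ℝ :=
  ∑ i, (∑ l, x i l * x i l) * (p i + q i) -
    2 * ∑ k, ∑ l, (∑ i, x i l * P.left i k) * ∑ j, x j l * P.right j k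

theorem quadCostValue_eq {x : Fin n → EuclideanSpace ℝ (Fin d)} {p q : Fin n → ℝ} {P : Factored n}
    (hP : P.toMatrix ∈ transportPolytope p q) :
    quadCostValue x p q P = ∑ i, ∑ j, P.toMatrix i j * ‖x i - x j‖ ^ 2 := by
  obtain ⟨_, hr, hc⟩ := hP
  have e1 : ∑ i, (∑ l, x i l * x i l) * (p i + q i) =
      ∑ i, ∑ j, P.toMatrix i j * (‖x i‖ ^ 2 + ‖x j‖ ^ 2) := by
    simp_rw [sum_mul_self_eq, mul_add, Finset.sum_add_distrib]
    congr 1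
    · exact Finset.sum_congr rfl fun i _ => by rw [← hr i, ← Finset.sum_mul, mul_comm]
    · rw [Finset.sum_comm]
      exact Finset.sum_congr rfl fun j _ => by rw [← hc j, ← Finset.sum_mul, mul_comm]
  have e2 : ∑ k, ∑ l, (∑ i, x i l * P.left i k) * ∑ j, x j l * P.right j k =
      ∑ i, ∑ j, P.toMatrix i j * inner ℝ (x i) (x j) := by
    have h : ∀ i j, P.toMatrix i j * inner ℝ (x i) (x j) =
        ∑ k, ∑ l, x i l * P.left i k * (x j l * P.right j k) := fun i j => by
      rw [Factored.toMatrix, Matrix.of_apply, PiLp.inner_apply, Finset.sum_mul_sum]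
      refine Finset.sum_congr rfl fun k _ => Finset.sum_congr rfl fun l _ => ?_
      simp; ring
    simp_rw [h, Finset.sum_mul_sum]
    exact sum_comm_pairs _
  rw [quadCostValue, e1, e2, Finset.mul_sum, ← Finset.sum_sub_distrib]
  refine Finset.sum_congr rfl fun i _ => ?_
  rw [Finset.mul_sum, ← Finset.sum_sub_distrib]
  refine Finset.sum_congr rfl fun j _ => ?_
  rw [norm_sub_sq_real]; ring

theorem runsIn_quadCost (hn : 1 ≤ n) (hd : 1 ≤ d) {x : Fin n → EuclideanSpace ℝ (Fin d)}
    (hx : ∀ i, ‖x i‖ ≤ 1) {p q : Fin n → ℝ}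
    (hp : p ∈ stdSimplex ℝ (Fin n)) (hq : q ∈ stdSimplex ℝ (Fin n)) {P : Factored n}
    (hr : 1 ≤ P.rank) {A : ℝ}
    (hP : FactorBound P.left P.right A) (hA : 1 ≤ A) (hAB : 4 * n ^ 2 * A ≤ B) :
    RunsIn (ℓ := ℓ) (quadCost x p q P) (quadCostValue x p q P)
      (30 * (n * P.rank * charge ℓ B * d)) := by
  have hn0 : (1 : ℝ) ≤ n := by exact_mod_cast hn
  have hnn : (n : ℝ) ≤ n ^ 2 := by nlinarith
  have hnA : n * A ≤ n ^ 2 * A := mul_le_mul_of_nonneg_right hnn (by linarith)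
  have hnA1 : A ≤ n * A := by nlinarith
  have hB1 : 2 ≤ B := by linarith
  have hB : 0 ≤ B := by linarith
  have hxc : ∀ i l, |x i l| ≤ 1 := fun i l => (abs_coord_le (x i) l).trans (hx i)
  have hf : ∀ (G : Fin n → Fin P.rank → ℝ), (∀ i k, |G i k| ≤ A) → ∀ k l,
      ∑ i, |x i l * G i k| ≤ n * A := fun G hG k l => sum_le_card_mul fun i => by
    rw [abs_mul]
    exact (mul_le_mul (hxc i l) (hG i k) (abs_nonneg _) zero_le_one).trans (one_mul A).le
  have hsq0 : ∀ i, 0 ≤ ∑ l, x i l * x i l := fun i => by rw [sum_mul_self_eq]; positivity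
  have hsq1 : ∀ i, ∑ l, x i l * x i l ≤ 1 := fun i => by
    rw [sum_mul_self_eq]; nlinarith [norm_nonneg (x i), hx i]
  have hpq0 : ∀ i, 0 ≤ p i + q i := fun i => add_nonneg (hp.1 i) (hq.1 i)
  have hpq2 : ∑ i, (p i + q i) = 2 := by rw [Finset.sum_add_distrib, hp.2, hq.2]; norm_num
  have hpq1 : ∀ i, p i + q i ≤ 2 := fun i => by
    rw [← hpq2]; exact Finset.single_le_sum (fun j _ => hpq0 j) (Finset.mem_univ i)
  have hs : ∑ i, |(∑ l, x i l * x i l) * (p i + q i)| ≤ 2 := by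
    rw [← hpq2]
    refine Finset.sum_le_sum fun i _ => ?_
    rw [abs_of_nonneg (mul_nonneg (hsq0 i) (hpq0 i))]
    exact mul_le_of_le_one_left (hpq0 i) (hsq1 i)
  have hxx : ∀ i j, ∑ l, |x i l| * |x j l| ≤ 1 := fun i j => by
    have h : ∀ l, |x i l| * |x j l| ≤ (x i l * x i l + x j l * x j l) / 2 := fun l => by
      nlinarith [sq_nonneg (|x i l| - |x j l|), sq_abs (x i l), sq_abs (x j l)]
    refine (Finset.sum_le_sum fun l _ => h l).trans ?_
    rw [← Finset.sum_div, Finset.sum_add_distrib]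
    linarith [hsq1 i, hsq1 j]
  set f : Fin P.rank → Fin d → ℝ := fun k l => ∑ i, x i l * P.left i k
  set g : Fin P.rank → Fin d → ℝ := fun k l => ∑ j, x j l * P.right j k
  have ht : ∑ k, ∑ l, |f k l * g k l| ≤ n ^ 2 * A := by
    calc ∑ k, ∑ l, |f k l * g k l| ≤ ∑ k, ∑ l, ∑ i, ∑ j,
          (|P.left i k| * |P.right j k|) * (|x i l| * |x j l|) := by
          refine Finset.sum_le_sum fun k _ => Finset.sum_le_sum fun l _ => ?_
          rw [abs_mul]
          refine (mul_le_mul (Finset.abs_sum_le_sum_abs _ _) (Finset.abs_sum_le_sum_abs _ _)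
            (abs_nonneg _) (Finset.sum_nonneg fun _ _ => abs_nonneg _)).trans (le_of_eq ?_)
          rw [Finset.sum_mul_sum]
          refine Finset.sum_congr rfl fun i _ => Finset.sum_congr rfl fun j _ => ?_
          rw [abs_mul, abs_mul]; ring
      _ = ∑ i, ∑ j, ∑ k, ∑ l, (|P.left i k| * |P.right j k|) * (|x i l| * |x j l|) := by
          exact sum_comm_pairs _
      _ ≤ ∑ _i : Fin n, ∑ _j : Fin n, A := by
          refine Finset.sum_le_sum fun i _ => Finset.sum_le_sum fun j _ => ?_
          refine le_trans (Finset.sum_le_sum fun k _ => ?_) (hP.prod i j)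
          rw [← Finset.mul_sum]
          exact mul_le_of_le_one_right (by positivity) (hxx i j)
      _ = n ^ 2 * A := by simp; ring
  have hrow : ∀ k, ∑ l, |f k l * g k l| ≤ n ^ 2 * A := fun k =>
    (Finset.single_le_sum (f := fun k => ∑ l, |f k l * g k l|)
      (fun _ _ => Finset.sum_nonneg fun _ _ => abs_nonneg _) (Finset.mem_univ k)).trans ht
  have hone : ∀ k l, |f k l * g k l| ≤ n ^ 2 * A := fun k l =>
    (Finset.single_le_sum (f := fun l => |f k l * g k l|) (fun _ _ => abs_nonneg _)
      (Finset.mem_univ l)).trans (hrow k)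
  have hT : ∑ k, |∑ l, f k l * g k l| ≤ n ^ 2 * A :=
    (Finset.sum_le_sum fun k _ => Finset.abs_sum_le_sum_abs _ _).trans ht
  have hT' : |∑ k, ∑ l, f k l * g k l| ≤ n ^ 2 * A := (Finset.abs_sum_le_sum_abs _ _).trans hT
  have hS' : |∑ i, (∑ l, x i l * x i l) * (p i + q i)| ≤ 2 :=
    (Finset.abs_sum_le_sum_abs _ _).trans hs
  have hmulB : ∀ (G : Fin n → Fin P.rank → ℝ), (∀ i k, |G i k| ≤ A) → ∀ i k l,
      |x i l * G i k| ≤ B := fun G hG i k l =>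
    ((Finset.single_le_sum (f := fun i => |x i l * G i k|) (fun _ _ => abs_nonneg _)
      (Finset.mem_univ i)).trans (hf G hG k l)).trans (by linarith)
  refine RunsIn.mono (RunsIn.congr (RunsIn.bind (runsIn_tabulate fun i => runsIn_sqNorm (B := B) (by linarith) (hx i))
    ((runsIn_sumLoop hB (a := fun i => (∑ l, x i l * x i l) * (p i + q i)) (fun i =>
      (runsIn_add (B := B) ?_).bind (runsIn_mul (B := B) ?_)) ?_).bind
    ((runsIn_sumLoop hB (a := fun k => ∑ l, f k l * g k l) (fun k =>
      runsIn_sumLoop hB (a := fun l => f k l * g k l) (fun l =>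
        (runsIn_sumLoop hB (a := fun i => x i l * P.left i k)
          (fun i => runsIn_mul (hmulB _ hP.left i k l)) ?_).bind
        ((runsIn_sumLoop hB (a := fun i => x i l * P.right i k)
          (fun i => runsIn_mul (hmulB _ hP.right i k l)) ?_).bind
        (runsIn_mul (B := B) ?_))) ?_) ?_).bind
    ((runsIn_lit (k := 2) (B := B) ?_).bind ((runsIn_mul (B := B) ?_).bind
    (runsIn_sub (B := B) ?_)))))) ?_) ?_
  · rw [abs_of_nonneg (hpq0 i)]; linarith [hpq1 i]
  · exact (Finset.single_le_sum (f := fun i => |(∑ l, x i l * x i l) * (p i + q i)|)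
      (fun _ _ => abs_nonneg _) (Finset.mem_univ i)).trans (hs.trans hB1)
  · exact hs.trans hB1
  · exact (hf _ hP.left k l).trans (by linarith)
  · exact (hf _ hP.right k l).trans (by linarith)
  · exact (hone k l).trans (by linarith)
  · exact (hrow k).trans (by linarith)
  · exact hT.trans (by linarith)
  · push_cast; linarith
  · rw [abs_mul]; push_cast; rw [abs_two]; linarith
  · rw [abs_le] at *; push_cast; constructor <;> linarith [hS'.1, hS'.2, hT'.1, hT'.2]
  · push_cast; rfl
  · have hQ := one_le_charge ℓ B
    generalize charge ℓ B = Q at *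
    generalize P.rank = ρ at hr ⊢
    set X := n * ρ * Q * d with hX
    have a1 : n * d * Q ≤ X := by nlinarith [Nat.mul_le_mul_left (n * d * Q) hr]
    have a2 : n * Q ≤ X := le_trans (by nlinarith [Nat.mul_le_mul_left (n * Q) hd]) a1
    have a3 : n ≤ X := le_trans (Nat.le_mul_of_pos_right _ hQ) a2
    have a4 : Q ≤ X := le_trans (Nat.le_mul_of_pos_left _ hn) a2
    have a5 : n * d ≤ X := le_trans (Nat.le_mul_of_pos_right _ hQ) a1
    have a6 : ρ * d * Q ≤ X := by nlinarith [Nat.mul_le_mul_left (ρ * d * Q) hn]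
    have a7 : ρ * d ≤ X := le_trans (Nat.le_mul_of_pos_right _ hQ) a6
    have a8 : ρ * Q ≤ X := le_trans (by nlinarith [Nat.mul_le_mul_left (ρ * Q) hd]) a6
    have a9 : ρ ≤ X := le_trans (Nat.le_mul_of_pos_right _ hQ) a8
    have a10 : ρ * d * n ≤ X := by rw [hX]; nlinarith [Nat.mul_le_mul_left (n * ρ * d) hQ]
    have e : ρ * d * n * Q = X := by rw [hX]; ring
    ring_nf
    ring_nf at a1 a2 a6 a7 a8 a10 e a5
    nlinarith

end Programs


/-! ## Accuracy -/

theorem abs_sum_mul_sub_le {n : ℕ} {G C D : Fin n → Fin n → ℝ} {c θ m : ℝ}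
    (hG : ∀ i j, 0 ≤ G i j) (h : ∀ i j, |D i j - c * C i j| ≤ θ) (hm : ∑ i, ∑ j, G i j = m) :
    |∑ i, ∑ j, G i j * D i j - c * ∑ i, ∑ j, G i j * C i j| ≤ m * θ := by
  have e : ∑ i, ∑ j, G i j * D i j - c * ∑ i, ∑ j, G i j * C i j =
      ∑ i, ∑ j, G i j * (D i j - c * C i j) := by
    simp_rw [Finset.mul_sum, ← Finset.sum_sub_distrib]
    exact Finset.sum_congr rfl fun i _ => Finset.sum_congr rfl fun j _ => by ring
  rw [e, ← hm, Finset.sum_mul]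
  refine (Finset.abs_sum_le_sum_abs _ _).trans (Finset.sum_le_sum fun i _ => ?_)
  rw [Finset.sum_mul]
  refine (Finset.abs_sum_le_sum_abs _ _).trans (Finset.sum_le_sum fun j _ => ?_)
  rw [abs_mul, abs_of_nonneg (hG i j)]
  exact mul_le_mul_of_nonneg_left (h i j) (hG i j)

/-- Rounding a scaling of `K ≈ exp (-20 H C)` with approximately correct marginals gives a coupling
that is optimal for `C` up to `ε`. -/
theorem rounded_cost_le_add {n : ℕ} (hn : 2 ≤ n) {ε H : ℝ} (hε : 0 < ε) (hε1 : ε < 1)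
    (hH : Real.log n = ε * H) {C K F : Fin n → Fin n → ℝ} (hC0 : ∀ i j, 0 ≤ C i j)
    (hC4 : ∀ i j, C i j ≤ 4) (hK : ∀ i j, 0 < K i j)
    (hKC : ∀ i j, |-Real.log (K i j) - 20 * H * C i j| ≤ 1 / 100)
    {p q a b : Fin n → ℝ} (hp : p ∈ stdSimplex ℝ (Fin n)) (hq : q ∈ stdSimplex ℝ (Fin n))
    (ha : ∀ i, 0 < a i) (hb : ∀ i, 0 < b i) (hF : ∀ i j, F i j = a i * K i j * b j)
    (hab : (∀ i, a i = 1 ∧ b i = 1) ∨ ∑ i, ∑ j, F i j = 1)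
    (haR : ∀ i j, Real.log (a i) - Real.log (a j) ≤ 91 * H)
    (hbR : ∀ i j, Real.log (b i) - Real.log (b j) ≤ 91 * H)
    (herr : ∑ i, |∑ j, F i j - p i| + ∑ j, |∑ i, F i j - q j| ≤ ε / 10)
    {P : Matrix (Fin n) (Fin n) ℝ} (hP : P ∈ transportPolytope p q) :
    ∑ i, ∑ j, rounded F p q i j * C i j ≤ ∑ i, ∑ j, P i j * C i j + ε := by
  have hne : Nonempty (Fin n) := ⟨⟨0, by omega⟩⟩
  have hF0 : ∀ i j, 0 ≤ F i j := fun i j => by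
    rw [hF]; exact (mul_pos (mul_pos (ha i) (hK i j)) (hb j)).le
  set eR := ∑ i, |∑ j, F i j - p i|
  set eC := ∑ j, |∑ i, F i j - q j|
  have heR : 0 ≤ eR := Finset.sum_nonneg fun _ _ => abs_nonneg _
  have heC : 0 ≤ eC := Finset.sum_nonneg fun _ _ => abs_nonneg _
  set m := ∑ i, ∑ j, F i j with hm
  have hlog : 0.69 ≤ ε * H := by
    rw [← hH]
    have h2 : Real.log 2 ≤ Real.log n := Real.log_le_log two_pos (by exact_mod_cast hn)
    have := Real.log_two_gt_d9
    norm_num at this ⊢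
    linarith
  have hH0 : 0 < H := by
    by_contra! h
    nlinarith
  have hm1 : m ≤ 1.1 := by
    have h : m - 1 = ∑ i, (∑ j, F i j - p i) := by
      rw [Finset.sum_sub_distrib, hp.2]
    have : ∑ i, (∑ j, F i j - p i) ≤ eR := Finset.sum_le_sum fun i _ => le_abs_self _
    norm_num
    linarith
  have hm0 : 0 ≤ m := Finset.sum_nonneg fun i _ => Finset.sum_nonneg fun j _ => hF0 i j
  have hPm : ∑ i, ∑ j, P i j = 1 := by simp_rw [hP.2.1]; exact hp.2
  have h1 := rounded_cost_le hF0 hp hq hC0 hC4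
  have h2 := scaled_cost_le (by omega) hK ha hb hp.2 hP (s := m)
    (by simp_rw [hm, hF])
  simp_rw [← hF] at h2
  have h3 := abs_le.1 (abs_sum_mul_sub_le hF0 hKC hm.symm)
  have h4 := abs_le.1 (abs_sum_mul_sub_le hP.1 hKC hPm)
  have h5 : ∑ i, (∑ j, F i j - p i) * Real.log (a i) + ∑ j, (∑ i, F i j - q j) * Real.log (b j) ≤
      (eR + eC) * (91 * H / 2) := by
    rcases hab with h | h
    · have : ∀ i, Real.log (a i) = 0 ∧ Real.log (b i) = 0 := fun i => by
        rw [(h i).1, (h i).2]; simp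
      simp only [(this _).1, (this _).2, mul_zero, Finset.sum_const_zero, add_zero]
      positivity
    · rw [add_mul]
      refine add_le_add (sum_sub_mul_le_l1_mul ?_ haR) (sum_sub_mul_le_l1_mul ?_ hbR)
      · rw [hp.2]; exact h.symm
      · rw [hq.2, Finset.sum_comm]; exact h.symm
  have h6 : (eR + eC) * (91 * H / 2) ≤ ε / 10 * (91 * H / 2) :=
    mul_le_mul_of_nonneg_right herr (by positivity)
  have h7 : 2 * m * Real.log n ≤ 2.2 * (ε * H) := by
    rw [hH]
    have : 0 ≤ ε * H := by positivity
    norm_num at hm1 ⊢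
    nlinarith
  have h8 : 20 * H * (∑ i, ∑ j, F i j * C i j - ∑ i, ∑ j, P i j * C i j) ≤ 20 * H * (0.35 * ε) := by
    norm_num at hm1 h7 hlog ⊢
    linarith [h3.1, h4.2]
  have h9 := le_of_mul_le_mul_left h8 (by positivity)
  norm_num at h9
  linarith

/-! ## Numerical bounds -/

section Scale

variable {n : ℕ} {ε : ℝ}

/-- The unit `log n / ε` in which the logarithms of all quantities are measured. -/
def scaleUnit (n : ℕ) (ε : ℝ) : ℝ := Real.log n / ε

variable (hn : 2 ≤ n) (hε : 0 < ε) (hε1 : ε < 1)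
include hn hε hε1

theorem log_ge : 0.69 ≤ Real.log n := by
  have h2 : Real.log 2 ≤ Real.log n := Real.log_le_log two_pos (by exact_mod_cast hn)
  have := Real.log_two_gt_d9
  norm_num at this ⊢
  linarith

theorem log_le_scaleUnit : Real.log n ≤ scaleUnit n ε := by
  have := log_ge hn hε hε1
  norm_num at this
  exact le_div_self (by linarith) hε hε1.le

theorem scaleUnit_ge : 0.69 ≤ scaleUnit n ε :=
  (log_ge hn hε hε1).trans (log_le_scaleUnit hn hε hε1)

theorem card_le_exp : (n : ℝ) ≤ Real.exp (scaleUnit n ε) := by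
  have hn0 : (0 : ℝ) < n := by exact_mod_cast (by omega : 0 < n)
  rw [← Real.log_le_iff_le_exp hn0]
  exact log_le_scaleUnit hn hε hε1

theorem two_le_exp : 2 ≤ Real.exp (scaleUnit n ε) :=
  le_trans (by exact_mod_cast hn) (card_le_exp hn hε hε1)

theorem inv_eps_le_exp : 1 / ε ≤ Real.exp (scaleUnit n ε) ^ 2 := by
  have h1 := log_ge hn hε hε1
  have h2 := Real.add_one_le_exp (scaleUnit n ε)
  have h3 := two_le_exp hn hε hε1
  have h4 : 1 / ε * 0.69 ≤ scaleUnit n ε := by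
    rw [scaleUnit, one_div_mul_eq_div]
    exact div_le_div_of_nonneg_right h1 hε.le
  norm_num at h4
  have : 1 / ε ≤ 2 * Real.exp (scaleUnit n ε) := by
    rw [one_div]; linarith [inv_pos.2 hε]
  nlinarith

theorem inv_mu_le : 1 / (ε / 80 / n) ≤ Real.exp (scaleUnit n ε) ^ 10 := by
  have h1 := card_le_exp hn hε hε1
  have h2 := two_le_exp hn hε hε1
  have h3 := inv_eps_le_exp hn hε hε1
  have h4 : (80 : ℝ) ≤ Real.exp (scaleUnit n ε) ^ 7 :=
    le_trans (by norm_num) (pow_le_pow_left₀ two_pos.le h2 7)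
  have e : 1 / (ε / 80 / n) = 80 * n * (1 / ε) := by field_simp
  rw [e]
  calc 80 * n * (1 / ε) ≤ Real.exp (scaleUnit n ε) ^ 7 * Real.exp (scaleUnit n ε) *
        Real.exp (scaleUnit n ε) ^ 2 := by gcongr
    _ = _ := by ring

theorem charge_le {ℓ : ℕ} {c : ℝ} (hℓ : (ℓ : ℝ) ≤ c * scaleUnit n ε) :
    (charge ℓ (Real.exp (scaleUnit n ε) ^ 500) : ℝ) ≤ (|c| + 800) * scaleUnit n ε := by
  set H := scaleUnit n ε
  have hH : 0.69 ≤ H := scaleUnit_ge hn hε hε1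
  norm_num at hH
  have hB : 0 ≤ Real.exp H ^ 500 := by positivity
  have hsize : (Nat.size ⌊|Real.exp H ^ 500|⌋₊ : ℝ) ≤ 1 + 750 * H := by
    rw [abs_of_nonneg hB]
    rcases Nat.eq_zero_or_pos (Nat.size ⌊Real.exp H ^ 500⌋₊) with h | h
    · rw [h]; push_cast; linarith
    · obtain ⟨k, hk⟩ : ∃ k, Nat.size ⌊Real.exp H ^ 500⌋₊ = k + 1 := ⟨_, (Nat.sub_add_cancel h).symm⟩
      have h1 : 2 ^ k ≤ ⌊Real.exp H ^ 500⌋₊ := Nat.lt_size.1 (by omega)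
      have h2 : (2 : ℝ) ^ k ≤ Real.exp H ^ 500 :=
        le_trans (by exact_mod_cast h1) (Nat.floor_le hB)
      have h3 := Real.log_le_log (by positivity) h2
      rw [Real.log_pow, Real.log_pow, Real.log_exp] at h3
      have h4 := Real.log_two_gt_d9
      norm_num at h3 h4
      rw [hk]
      push_cast
      have : (k : ℝ) * 0.69 ≤ k * Real.log 2 :=
        mul_le_mul_of_nonneg_left (by norm_num; linarith) (Nat.cast_nonneg k)
      norm_num at this
      linarith
  have h5 : c * H ≤ |c| * H := mul_le_mul_of_nonneg_right (le_abs_self c) (by linarith)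
  unfold charge
  push_cast
  linarith

end Scale


section Scale

variable {n d : ℕ} {ε : ℝ}

/-- The bandwidth of the Gaussian kernel. -/
def bandwidth (n : ℕ) (ε : ℝ) : ℝ := 1 / Real.sqrt (2 * (20 * Real.log n / ε))

variable (hn : 2 ≤ n) (hε : 0 < ε) (hε1 : ε < 1)
include hn hε hε1

theorem scaleUnit_pos : 0 < scaleUnit n ε := by
  have := scaleUnit_ge hn hε hε1
  norm_num at this
  linarith

theorem bandwidth_sq : bandwidth n ε ^ 2 = 1 / (40 * scaleUnit n ε) := by
  have := scaleUnit_pos hn hε hε1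
  have e : 2 * (20 * Real.log n / ε) = 40 * scaleUnit n ε := by unfold scaleUnit; ring
  rw [bandwidth, e, div_pow, Real.sq_sqrt (by positivity), one_pow]

theorem bandwidth_pos : 0 < bandwidth n ε := by
  have := scaleUnit_pos hn hε hε1
  have e : 2 * (20 * Real.log n / ε) = 40 * scaleUnit n ε := by unfold scaleUnit; ring
  rw [bandwidth, e]
  positivity

theorem bandwidth_le_one : bandwidth n ε ≤ 1 := by
  have h := scaleUnit_ge hn hε hε1
  norm_num at h
  have h1 := bandwidth_sq hn hε hε1
  have : bandwidth n ε ^ 2 ≤ 1 := by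
    rw [h1, div_le_one (by positivity)]; linarith
  nlinarith [bandwidth_pos hn hε hε1]

theorem abs_gaussian_sub_taylorKernel_le_exp {y z : EuclideanSpace ℝ (Fin d)} (hy : ‖y‖ ≤ 1)
    (hz : ‖z‖ ≤ 1) : |Real.exp (-(20 * scaleUnit n ε * ‖y - z‖ ^ 2)) -
      taylorKernel (bandwidth n ε) ⌈300 * Real.log n / ε⌉₊ y z| ≤
      Real.exp (-scaleUnit n ε) ^ 300 := by
  have hH := scaleUnit_pos hn hε hε1
  have h := abs_gaussian_sub_taylorKernel_le (bandwidth_pos hn hε hε1) ⌈300 * Real.log n / ε⌉₊ hy hz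
  rw [bandwidth_sq hn hε hε1] at h
  have e : -‖y - z‖ ^ 2 / (2 * (1 / (40 * scaleUnit n ε))) =
      -(20 * scaleUnit n ε * ‖y - z‖ ^ 2) := by field_simp; ring
  rw [e, one_div_one_div] at h
  refine h.trans ?_
  have hM : 300 * scaleUnit n ε ≤ ⌈300 * Real.log n / ε⌉₊ := by
    refine le_trans (le_of_eq ?_) (Nat.le_ceil _)
    unfold scaleUnit; ring
  refine (pow_div_factorial_le_exp_neg (by positivity) (by linarith)).trans ?_
  rw [← Real.exp_nat_mul]
  refine Real.exp_le_exp.2 ?_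
  push_cast
  linarith

theorem exp_neg_pow_le_gaussian {y z : EuclideanSpace ℝ (Fin d)} (hy : ‖y‖ ≤ 1) (hz : ‖z‖ ≤ 1) :
    Real.exp (-scaleUnit n ε) ^ 80 ≤ Real.exp (-(20 * scaleUnit n ε * ‖y - z‖ ^ 2)) := by
  have hH := scaleUnit_pos hn hε hε1
  rw [← Real.exp_nat_mul]
  refine Real.exp_le_exp.2 ?_
  have h1 : ‖y - z‖ ≤ 2 := (norm_sub_le y z).trans (by linarith)
  have h2 : ‖y - z‖ ^ 2 ≤ 4 := by nlinarith [norm_nonneg (y - z)]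
  push_cast
  nlinarith

theorem exp_neg_le_half : Real.exp (-scaleUnit n ε) ≤ 1 / 2 := by
  rw [Real.exp_neg, ← one_div]
  exact one_div_le_one_div_of_le two_pos (two_le_exp hn hε hε1)

theorem exp_neg_pow_le_taylorKernel {y z : EuclideanSpace ℝ (Fin d)} (hy : ‖y‖ ≤ 1)
    (hz : ‖z‖ ≤ 1) : Real.exp (-scaleUnit n ε) ^ 81 ≤
      taylorKernel (bandwidth n ε) ⌈300 * Real.log n / ε⌉₊ y z := by
  have h1 := (abs_le.1 (abs_gaussian_sub_taylorKernel_le_exp hn hε hε1 hy hz)).2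
  have h2 := exp_neg_pow_le_gaussian hn hε hε1 hy hz
  have h3 := exp_neg_le_half hn hε hε1
  have h0 := Real.exp_pos (-scaleUnit n ε)
  generalize Real.exp (-scaleUnit n ε) = u at *
  have h4 : u ^ 300 ≤ u ^ 81 := pow_le_pow_of_le_one h0.le (by linarith) (by norm_num)
  have h5 : u ^ 81 ≤ u ^ 80 * (1 / 2) := by
    rw [pow_succ]; exact mul_le_mul_of_nonneg_left h3 (by positivity)
  linarith

theorem abs_log_taylorKernel_sub_le {y z : EuclideanSpace ℝ (Fin d)} (hy : ‖y‖ ≤ 1)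
    (hz : ‖z‖ ≤ 1) : |-Real.log (taylorKernel (bandwidth n ε) ⌈300 * Real.log n / ε⌉₊ y z) -
      20 * scaleUnit n ε * ‖y - z‖ ^ 2| ≤ 1 / 100 := by
  have h1 := abs_le.1 (abs_gaussian_sub_taylorKernel_le_exp hn hε hε1 hy hz)
  have h2 := exp_neg_pow_le_gaussian hn hε hε1 hy hz
  have h3 := exp_neg_le_half hn hε hε1
  have h4 := exp_neg_pow_le_taylorKernel hn hε hε1 hy hz
  have h0 := Real.exp_pos (-scaleUnit n ε)
  generalize taylorKernel (bandwidth n ε) ⌈300 * Real.log n / ε⌉₊ y z = k at *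
  have hg0 := Real.exp_pos (-(20 * scaleUnit n ε * ‖y - z‖ ^ 2))
  have hlg : Real.log (Real.exp (-(20 * scaleUnit n ε * ‖y - z‖ ^ 2))) =
    -(20 * scaleUnit n ε * ‖y - z‖ ^ 2) := Real.log_exp _
  generalize Real.exp (-(20 * scaleUnit n ε * ‖y - z‖ ^ 2)) = g at *
  generalize Real.exp (-scaleUnit n ε) = u at *
  have hk0 : 0 < k := (pow_pos h0 81).trans_le h4
  have h5 : u ^ 300 ≤ 1 / 100 * u ^ 81 := by
    have : u ^ 219 ≤ 1 / 100 := by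
      calc u ^ 219 ≤ u ^ 7 := pow_le_pow_of_le_one h0.le (by linarith) (by norm_num)
        _ ≤ (1 / 2) ^ 7 := pow_le_pow_left₀ h0.le h3 7
        _ ≤ _ := by norm_num
    calc u ^ 300 = u ^ 219 * u ^ 81 := by rw [← pow_add]
      _ ≤ _ := mul_le_mul_of_nonneg_right this (by positivity)
  have h6 : u ^ 81 ≤ u ^ 80 := pow_le_pow_of_le_one h0.le (by linarith) (by norm_num)
  have hlk := Real.log_le_sub_one_of_pos (div_pos hk0 hg0)
  have hlg' := Real.log_le_sub_one_of_pos (div_pos hg0 hk0)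
  rw [Real.log_div hk0.ne' hg0.ne'] at hlk
  rw [Real.log_div hg0.ne' hk0.ne'] at hlg'
  have h7 : k / g - 1 ≤ 1 / 100 := by
    rw [div_sub_one hg0.ne', div_le_iff₀ hg0]; linarith
  have h8 : g / k - 1 ≤ 1 / 100 := by
    rw [div_sub_one hk0.ne', div_le_iff₀ hk0]; linarith
  rw [abs_le]
  constructor <;> linarith

end Scale

section Smoothed

variable {n : ℕ} {τ : ℝ} {p : Fin n → ℝ} (hp : p ∈ stdSimplex ℝ (Fin n))
include hp

theorem le_smoothed (hτ1 : τ ≤ 1) (i : Fin n) : τ / n ≤ smoothed τ p i :=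
  le_add_of_nonneg_left (mul_nonneg (by linarith) (hp.1 i))

theorem sum_smoothed (hn : 1 ≤ n) : ∑ i, smoothed τ p i = 1 := by
  have hn0 : (n : ℝ) ≠ 0 := by exact_mod_cast (by omega : n ≠ 0)
  simp only [smoothed, Finset.sum_add_distrib, ← Finset.mul_sum, hp.2, Finset.sum_const,
    Finset.card_univ, Fintype.card_fin, nsmul_eq_mul]
  field_simp
  ring

theorem sum_abs_smoothed_sub_le (hn : 1 ≤ n) (hτ : 0 ≤ τ) : ∑ i, |smoothed τ p i - p i| ≤ 2 * τ := by
  have hn0 : (n : ℝ) ≠ 0 := by exact_mod_cast (by omega : n ≠ 0)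
  have h : ∀ i, |smoothed τ p i - p i| ≤ τ * p i + τ / n := fun i => by
    have e : smoothed τ p i - p i = τ / n - τ * p i := by unfold smoothed; ring
    have h1 : 0 ≤ τ * p i := mul_nonneg hτ (hp.1 i)
    have h2 : 0 ≤ τ / n := by positivity
    rw [e, abs_le]
    constructor <;> linarith
  refine (Finset.sum_le_sum fun i _ => h i).trans (le_of_eq ?_)
  simp only [Finset.sum_add_distrib, ← Finset.mul_sum, hp.2, Finset.sum_const,
    Finset.card_univ, Fintype.card_fin, nsmul_eq_mul]
  field_simp
  ring

end Smoothed

theorem FactorBound.snoc {n r : ℕ} {L R : Fin n → Fin r → ℝ} {A : ℝ} (h : FactorBound L R A)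
    (hA : 0 ≤ A) {u v : Fin n → ℝ} (hu : ∀ i, |u i| ≤ 1) (hv : ∀ i, |v i| ≤ 1) :
    FactorBound (fun i => Fin.snoc (α := fun _ => ℝ) (L i) (u i))
      (fun i => Fin.snoc (α := fun _ => ℝ) (R i) (v i)) (A + 1) := by
  refine ⟨fun i k => ?_, fun i k => ?_, fun i j => ?_⟩
  · refine Fin.lastCases ?_ (fun k => ?_) k
    · simpa using (hu i).trans (by linarith)
    · simpa using (h.left i k).trans (by linarith)
  · refine Fin.lastCases ?_ (fun k => ?_) k
    · simpa using (hv i).trans (by linarith)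
    · simpa using (h.right i k).trans (by linarith)
  · rw [Fin.sum_univ_castSucc]
    simp only [Fin.snoc_castSucc, Fin.snoc_last]
    exact add_le_add (h.prod i j) (mul_le_one₀ (hu i) (abs_nonneg _) (hv j))


section Ratios

variable {n : ℕ} {E : ℝ} {F : Fin n → Fin n → ℝ} {p q : Fin n → ℝ}
  (hn : 1 ≤ n) (hE : 2 ≤ E) (hnE : (n : ℝ) ≤ E)
  (hF0 : ∀ i j, 1 / E ^ 287 ≤ F i j) (hF1 : ∀ i j, F i j ≤ E ^ 184)
  (hp : p ∈ stdSimplex ℝ (Fin n)) (hq : q ∈ stdSimplex ℝ (Fin n))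
include hE hF0

theorem row_ratio_le (hp : p ∈ stdSimplex ℝ (Fin n)) (i : Fin n) :
    p i / ∑ j, F i j ≤ E ^ 500 := by
  have h1 : 1 / E ^ 287 ≤ ∑ j, F i j := (hF0 i i).trans (Finset.single_le_sum
    (fun j _ => le_trans (by positivity) (hF0 i j)) (Finset.mem_univ i))
  have h2 : p i ≤ 1 := by
    rw [← hp.2]; exact Finset.single_le_sum (fun j _ => hp.1 j) (Finset.mem_univ i)
  calc p i / ∑ j, F i j ≤ 1 / (1 / E ^ 287) := div_le_div₀ zero_le_one h2 (by positivity) h1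
    _ = E ^ 287 := one_div_one_div _
    _ ≤ E ^ 500 := pow_le_pow_right₀ (by linarith) (by norm_num)

include hn hnE hF1 hp hq

theorem col_ratio_le (j : Fin n) : q j / ∑ i, scaledRows F p i j ≤ E ^ 500 := by
  have hE0 : 0 < E := by linarith
  have hn0 : (0 : ℝ) < n := by exact_mod_cast hn
  have hF : ∀ i j, 0 ≤ F i j := fun i j => le_trans (by positivity) (hF0 i j)
  obtain ⟨i, hi⟩ : ∃ i, 1 / (n : ℝ) ≤ p i := by
    by_contra! h
    have hne : Nonempty (Fin n) := ⟨⟨0, hn⟩⟩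
    have := Finset.sum_lt_sum_of_nonempty Finset.univ_nonempty fun i (_ : i ∈ Finset.univ) => h i
    rw [hp.2] at this
    simp only [Finset.sum_const, Finset.card_univ, Fintype.card_fin, nsmul_eq_mul] at this
    rw [mul_one_div_cancel hn0.ne'] at this
    exact lt_irrefl _ this
  have h1 : 1 / E ≤ p i := le_trans (one_div_le_one_div_of_le hn0 hnE) hi
  have h2 : ∑ j, F i j ≤ E ^ 185 := (sum_le_card_mul fun j => hF1 i j).trans (by
    calc n * E ^ 184 ≤ E * E ^ 184 := by gcongr
      _ = _ := by ring)
  have h2' : 0 < ∑ j, F i j := by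
    refine lt_of_lt_of_le (by positivity : 0 < 1 / E ^ 287) ((hF0 i i).trans ?_)
    exact Finset.single_le_sum (fun j _ => hF i j) (Finset.mem_univ i)
  have h3 : 1 / E ^ 186 ≤ rowScale F p i := by
    refine le_inf ?_ ?_
    · calc 1 / E ^ 186 = 1 / E / E ^ 185 := by rw [div_div]; ring
        _ ≤ _ := div_le_div₀ (hp.1 i) h1 h2' h2
    · rw [div_le_one (by positivity)]
      exact one_le_pow₀ (by linarith)
  have h4 : 1 / E ^ 473 ≤ ∑ i, scaledRows F p i j := by
    calc 1 / E ^ 473 = 1 / E ^ 186 * (1 / E ^ 287) := by rw [div_mul_div_comm, ← pow_add]; norm_num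
      _ ≤ scaledRows F p i j := mul_le_mul h3 (hF0 i j) (by positivity)
          (le_trans (by positivity) h3)
      _ ≤ _ := Finset.single_le_sum (fun i _ => scaledRows_nonneg hF hp i j) (Finset.mem_univ i)
  have h5 : q j ≤ 1 := by
    rw [← hq.2]; exact Finset.single_le_sum (fun j _ => hq.1 j) (Finset.mem_univ j)
  calc q j / ∑ i, scaledRows F p i j ≤ 1 / (1 / E ^ 473) :=
        div_le_div₀ zero_le_one h5 (by positivity) h4
    _ = E ^ 473 := one_div_one_div _
    _ ≤ E ^ 500 := pow_le_pow_right₀ (by linarith) (by norm_num)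

end Ratios

section Setting

variable {ℓ n d : ℕ} {ε : ℝ}

/-- The array of features that the algorithm works with. -/
def featureMatrix (x : Fin n → EuclideanSpace ℝ (Fin d)) (ε : ℝ) (i : Fin n)
    (k : Fin (exponents d ⌈300 * Real.log n / ε⌉₊).length) : ℝ :=
  featureValue (bandwidth n ε) (x i) ((exponents d ⌈300 * Real.log n / ε⌉₊).get k)

theorem featureMatrix_bound (x : Fin n → EuclideanSpace ℝ (Fin d)) (ε : ℝ) :
    FactorBound (featureMatrix x ε) (featureMatrix x ε) 1 :=
  ⟨fun i _ => abs_featureValue_le_one (x i) _, fun i _ => abs_featureValue_le_one (x i) _,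
    fun i j => sum_abs_featureValue_mul_le_one _ _ (x i) (x j)⟩

theorem factorProd_featureMatrix (x : Fin n → EuclideanSpace ℝ (Fin d)) (ε : ℝ) (i j : Fin n) :
    factorProd (featureMatrix x ε) (featureMatrix x ε) i j =
      taylorKernel (bandwidth n ε) ⌈300 * Real.log n / ε⌉₊ (x i) (x j) := rfl

theorem factorProd_scale {r : ℕ} (V : Fin n → Fin r → ℝ) (a b : Fin n → ℝ) (i j : Fin n) :
    factorProd (fun i k => a i * V i k) (fun i k => b i * V i k) i j =
      a i * factorProd V V i j * b j := by
  simp only [factorProd, Finset.mul_sum, Finset.sum_mul]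
  exact Finset.sum_congr rfl fun k _ => by ring

variable (hn : 2 ≤ n) (hε : 0 < ε) (hε1 : ε < 1) {x : Fin n → EuclideanSpace ℝ (Fin d)}
  (hx : ∀ i, ‖x i‖ ≤ 1) {p q : Fin n → ℝ} (hp : p ∈ stdSimplex ℝ (Fin n))
  (hq : q ∈ stdSimplex ℝ (Fin n))
include hn hε hε1

theorem inv_kappa_mu_le (hμ : 0 < ε / 80 / n) :
    1 / (1 / Real.exp (scaleUnit n ε) ^ 81 * (ε / 80 / n / n)) ≤ Real.exp (scaleUnit n ε) ^ 92 := by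
  have h1 := inv_mu_le hn hε hε1
  have h2 := card_le_exp hn hε hε1
  have hn0 : (0 : ℝ) < n := by exact_mod_cast (by omega : 0 < n)
  generalize ε / 80 / (n : ℝ) = μ at *
  have hE := Real.exp_pos (scaleUnit n ε)
  generalize Real.exp (scaleUnit n ε) = E at *
  have e : 1 / (1 / E ^ 81 * (μ / n)) = E ^ 81 * (1 / μ) * n := by field_simp
  rw [e]
  calc E ^ 81 * (1 / μ) * n ≤ E ^ 81 * E ^ 10 * E := by gcongr
    _ = _ := by ring

theorem log_inv_kappa_mu_le (hμ : 0 < ε / 80 / n) :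
    Real.log (1 / (1 / Real.exp (scaleUnit n ε) ^ 81 * (ε / 80 / n))) ≤ 91 * scaleUnit n ε := by
  have h1 := inv_mu_le hn hε hε1
  have e2 : 91 * scaleUnit n ε = Real.log (Real.exp (scaleUnit n ε) ^ 91) := by
    rw [Real.log_pow, Real.log_exp]; norm_num
  rw [e2]
  generalize ε / 80 / (n : ℝ) = μ at *
  have hE := Real.exp_pos (scaleUnit n ε)
  generalize Real.exp (scaleUnit n ε) = E at *
  refine Real.log_le_log (by positivity) ?_
  have e : 1 / (1 / E ^ 81 * μ) = E ^ 81 * (1 / μ) := by field_simp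
  rw [e]
  calc E ^ 81 * (1 / μ) ≤ E ^ 81 * E ^ 10 := by gcongr
    _ = _ := by ring

omit hε1 in
theorem mu_pos : 0 < ε / 80 / n := by
  have : (0 : ℝ) < n := by exact_mod_cast (by omega : 0 < n)
  positivity

include hx hp hq

theorem scalingData_features : ScalingData (factorProd (featureMatrix x ε) (featureMatrix x ε))
    (smoothed (ε / 10 / 8) p) (smoothed (ε / 10 / 8) q) (1 / Real.exp (scaleUnit n ε) ^ 81)
    (ε / 80 / n) := by
  have e : ε / 80 / n = ε / 10 / 8 / n := by ring
  refine ⟨hn, fun i j => taylorKernel_comm _ _ _ _, by positivity, fun i j => ?_,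
    fun i j => taylorKernel_le_one _ _ _ _, mu_pos hn hε,
    fun i => ?_, fun i => ?_, sum_smoothed hp (by omega), sum_smoothed hq (by omega)⟩
  · have := exp_neg_pow_le_taylorKernel hn hε hε1 (hx i) (hx j)
    rwa [Real.exp_neg, inv_pow, ← one_div] at this
  · rw [e]; exact le_smoothed hp (by linarith) i
  · rw [e]; exact le_smoothed hq (by linarith) i

theorem le_scaling (k : ℕ) (i : Fin n) : 1 / Real.exp (scaleUnit n ε) ^ 103 ≤
    sinkhornSeq (factorProd (featureMatrix x ε) (featureMatrix x ε))
      (smoothed (ε / 10 / 8) p) (smoothed (ε / 10 / 8) q) k i := by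
  refine le_trans ?_ ((scalingData_features hn hε hε1 hx hp hq).le_seq k i)
  have hμ := mu_pos hn hε
  have h1 := inv_mu_le hn hε hε1
  have h2 := card_le_exp hn hε hε1
  have h3 := inv_kappa_mu_le hn hε hε1 hμ
  have hn0 : (0 : ℝ) < n := by exact_mod_cast (by omega : 0 < n)
  generalize ε / 80 / (n : ℝ) = μ at *
  have hE := Real.exp_pos (scaleUnit n ε)
  generalize Real.exp (scaleUnit n ε) = E at *
  have h4 : 0 < 1 / (1 / E ^ 81 * (μ / n)) := by positivity
  generalize 1 / (1 / E ^ 81 * (μ / n)) = A at *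
  rw [div_le_div_iff₀ (by positivity) (by positivity), one_mul]
  rw [div_le_iff₀ hμ] at h1
  calc n * A ≤ E * E ^ 92 := by gcongr
    _ = E ^ 93 * 1 := by ring
    _ ≤ E ^ 93 * (E ^ 10 * μ) := by gcongr
    _ = _ := by ring

theorem scaling_le (k : ℕ) (i : Fin n) :
    sinkhornSeq (factorProd (featureMatrix x ε) (featureMatrix x ε))
      (smoothed (ε / 10 / 8) p) (smoothed (ε / 10 / 8) q) k i ≤
    Real.exp (scaleUnit n ε) ^ 92 :=
  ((scalingData_features hn hε hε1 hx hp hq).seq_le k i).trans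
    (inv_kappa_mu_le hn hε hε1 (mu_pos hn hε))

theorem log_scaling_sub_le (k : ℕ) (i j : Fin n) :
    Real.log (sinkhornSeq (factorProd (featureMatrix x ε) (featureMatrix x ε))
      (smoothed (ε / 10 / 8) p) (smoothed (ε / 10 / 8) q) k i) -
    Real.log (sinkhornSeq (factorProd (featureMatrix x ε) (featureMatrix x ε))
      (smoothed (ε / 10 / 8) p) (smoothed (ε / 10 / 8) q) k j) ≤ 91 * scaleUnit n ε :=
  ((scalingData_features hn hε hε1 hx hp hq).log_seq_sub_le k i j).trans
    (log_inv_kappa_mu_le hn hε hε1 (mu_pos hn hε))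

theorem exists_stopping_time : ∃ N : ℕ, (N : ℝ) ≤ 3 + 14560 * (scaleUnit n ε / ε) ∧
    totalError (factorProd (featureMatrix x ε) (featureMatrix x ε))
      (smoothed (ε / 10 / 8) p) (smoothed (ε / 10 / 8) q) N ≤ ε / 10 / 2 ∧
    ∀ k < N, ε / 10 / 2 < totalError (factorProd (featureMatrix x ε) (featureMatrix x ε))
      (smoothed (ε / 10 / 8) p) (smoothed (ε / 10 / 8) q) k := by
  obtain ⟨N, h1, h2, h3⟩ := (scalingData_features hn hε hε1 hx hp hq).exists_totalError_le
    (by positivity : 0 < ε / 10 / 2)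
  refine ⟨N, h1.trans ?_, h2, h3⟩
  have h4 := log_inv_kappa_mu_le hn hε hε1 (mu_pos hn hε)
  have : 8 * Real.log (1 / (1 / Real.exp (scaleUnit n ε) ^ 81 * (ε / 80 / n))) / (ε / 10 / 2) ≤
      8 * (91 * scaleUnit n ε) / (ε / 10 / 2) := by gcongr
  have e : 8 * (91 * scaleUnit n ε) / (ε / 10 / 2) = 14560 * (scaleUnit n ε / ε) := by
    field_simp; ring
  linarith

/-- What is used about the scalings `a`, `b` with which Sinkhorn's algorithm stops. -/
structure StoppedScaling (x : Fin n → EuclideanSpace ℝ (Fin d)) (ε : ℝ) (p q a b : Fin n → ℝ) :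
    Prop where
  le_left : ∀ i, 1 / Real.exp (scaleUnit n ε) ^ 103 ≤ a i
  le_right : ∀ i, 1 / Real.exp (scaleUnit n ε) ^ 103 ≤ b i
  left_le : ∀ i, a i ≤ Real.exp (scaleUnit n ε) ^ 92
  right_le : ∀ i, b i ≤ Real.exp (scaleUnit n ε) ^ 92
  left_osc : ∀ i j, Real.log (a i) - Real.log (a j) ≤ 91 * scaleUnit n ε
  right_osc : ∀ i j, Real.log (b i) - Real.log (b j) ≤ 91 * scaleUnit n ε
  mass : (∀ i, a i = 1 ∧ b i = 1) ∨
    ∑ i, ∑ j, a i * factorProd (featureMatrix x ε) (featureMatrix x ε) i j * b j = 1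
  error : marginalError (factorProd (featureMatrix x ε) (featureMatrix x ε)) p q a b ≤ ε / 10

theorem stoppedScaling {N : ℕ}
    (hN : totalError (factorProd (featureMatrix x ε) (featureMatrix x ε))
      (smoothed (ε / 10 / 8) p) (smoothed (ε / 10 / 8) q) N ≤ ε / 10 / 2) :
    StoppedScaling x ε p q
      (sinkhornState (factorProd (featureMatrix x ε) (featureMatrix x ε))
        (smoothed (ε / 10 / 8) p) (smoothed (ε / 10 / 8) q) N).1
      (sinkhornState (factorProd (featureMatrix x ε) (featureMatrix x ε))
        (smoothed (ε / 10 / 8) p) (smoothed (ε / 10 / 8) q) N).2 := by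
  have S := scalingData_features hn hε hε1 hx hp hq
  have h1 := le_scaling hn hε hε1 hx hp hq
  have h2 := scaling_le hn hε hε1 hx hp hq
  have h3 := log_scaling_sub_le hn hε hε1 hx hp hq
  rw [← marginalError_sinkhornState] at hN
  have hmass : (∀ i, (sinkhornState (factorProd (featureMatrix x ε) (featureMatrix x ε))
        (smoothed (ε / 10 / 8) p) (smoothed (ε / 10 / 8) q) N).1 i = 1 ∧
      (sinkhornState (factorProd (featureMatrix x ε) (featureMatrix x ε))
        (smoothed (ε / 10 / 8) p) (smoothed (ε / 10 / 8) q) N).2 i = 1) ∨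
      ∑ i, ∑ j, (sinkhornState (factorProd (featureMatrix x ε) (featureMatrix x ε))
        (smoothed (ε / 10 / 8) p) (smoothed (ε / 10 / 8) q) N).1 i *
      factorProd (featureMatrix x ε) (featureMatrix x ε) i j *
      (sinkhornState (factorProd (featureMatrix x ε) (featureMatrix x ε))
        (smoothed (ε / 10 / 8) p) (smoothed (ε / 10 / 8) q) N).2 j = 1 := by
    cases N with
    | zero => left; intro i; exact ⟨rfl, rfl⟩
    | succ N =>
      right
      have h := S.sum_seq_succ N
      simp_rw [mul_assoc, ← Finset.mul_sum]
      unfold sinkhornState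
      split_ifs
      · exact h
      · rw [ScalingData.sum_mul_comm_of_symm S.symm]; exact h
  generalize hst : sinkhornState (factorProd (featureMatrix x ε) (featureMatrix x ε))
    (smoothed (ε / 10 / 8) p) (smoothed (ε / 10 / 8) q) N = st at *
  have herr : marginalError (factorProd (featureMatrix x ε) (featureMatrix x ε)) p q st.1 st.2 ≤
      marginalError (factorProd (featureMatrix x ε) (featureMatrix x ε))
        (smoothed (ε / 10 / 8) p) (smoothed (ε / 10 / 8) q) st.1 st.2 +
      (∑ i, |smoothed (ε / 10 / 8) p i - p i| + ∑ i, |smoothed (ε / 10 / 8) q i - q i|) := by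
    have h : ∀ (m m' v : Fin n → ℝ), ∑ i, |v i - m i| ≤ ∑ i, |v i - m' i| + ∑ i, |m' i - m i| :=
      fun m m' v => by
        rw [← Finset.sum_add_distrib]
        exact Finset.sum_le_sum fun i _ => abs_sub_le _ _ _
    have h4 := h p (smoothed (ε / 10 / 8) p)
      (scaledMarginal (factorProd (featureMatrix x ε) (featureMatrix x ε)) st.1 st.2)
    have h5 := h q (smoothed (ε / 10 / 8) q)
      (scaledMarginal (factorProd (featureMatrix x ε) (featureMatrix x ε)) st.2 st.1)
    unfold marginalError
    linarith
  have h4 := sum_abs_smoothed_sub_le hp (by omega) (by positivity : 0 ≤ ε / 10 / 8)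
  have h5 := sum_abs_smoothed_sub_le hq (by omega) (by positivity : 0 ≤ ε / 10 / 8)
  refine ⟨?_, ?_, ?_, ?_, ?_, ?_, hmass, by linarith⟩ <;> rw [← hst] <;> unfold sinkhornState <;>
    split_ifs
  exacts [h1 _, h1 _, h1 _, h1 _, h2 _, h2 _, h2 _, h2 _, h3 _, h3 _, h3 _, h3 _]

end Setting


/-! ## The algorithm as a whole -/

section Output

variable {n r : ℕ}

/-- The result of `round`. -/
def roundedFactors (L R : Fin n → Fin r → ℝ) (p q : Fin n → ℝ) : Factored n where
  rank := r + 1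
  left := fun i => Fin.snoc (α := fun _ => ℝ)
    (fun k => rowScale (factorProd L R) p i * L i k) (correction (factorProd L R) p q i)
  right := fun j => Fin.snoc (α := fun _ => ℝ)
    (fun k => colScale (factorProd L R) p q j * R j k) (colDefect (factorProd L R) p q j)

theorem toMatrix_roundedFactors (L R : Fin n → Fin r → ℝ) (p q : Fin n → ℝ) :
    (roundedFactors L R p q).toMatrix = Matrix.of (rounded (factorProd L R) p q) := by
  ext i j
  refine (Fin.sum_univ_castSucc (n := r) fun k => (roundedFactors L R p q).left i k *
    (roundedFactors L R p q).right j k).trans ?_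
  simp only [roundedFactors, Fin.snoc_castSucc, Fin.snoc_last, Matrix.of_apply, rounded, scaledDown]
  conv_rhs => rw [factorProd, Finset.mul_sum]
  congr 1
  exact Finset.sum_congr rfl fun k _ => by ring

theorem factorBound_roundedFactors {L R : Fin n → Fin r → ℝ} {p q : Fin n → ℝ} {A : ℝ}
    (h : FactorBound L R A) (hA : 0 ≤ A) (hF : ∀ i j, 0 ≤ factorProd L R i j)
    (hp : p ∈ stdSimplex ℝ (Fin n)) (hq : q ∈ stdSimplex ℝ (Fin n)) :
    FactorBound (roundedFactors L R p q).left (roundedFactors L R p q).right (A + 1) := by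
  refine (h.scale (rowScale_nonneg hF hp.1) (rowScale_le_one _ _) (colScale_nonneg hF hp hq)
    colScale_le_one).snoc hA (fun i => ?_) (fun j => ?_)
  · rw [abs_of_nonneg (correction_nonneg hF hp i)]
    exact correction_le_one i
  · rw [abs_of_nonneg (colDefect_nonneg hF hp hq j)]
    refine (sub_le_self _ (Finset.sum_nonneg fun i _ => scaledDown_nonneg hF hp hq i j)).trans ?_
    rw [← hq.2]
    exact Finset.single_le_sum (fun j _ => hq.1 j) (Finset.mem_univ j)

end Output

section Setting

variable {ℓ n d : ℕ} {ε : ℝ} (hn : 2 ≤ n) (hε : 0 < ε) (hε1 : ε < 1)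
  {x : Fin n → EuclideanSpace ℝ (Fin d)} (hx : ∀ i, ‖x i‖ ≤ 1) {p q a b : Fin n → ℝ}
  (hp : p ∈ stdSimplex ℝ (Fin n)) (hq : q ∈ stdSimplex ℝ (Fin n))

theorem StoppedScaling.left_pos (S : StoppedScaling x ε p q a b) (i : Fin n) : 0 < a i :=
  lt_of_lt_of_le (by positivity) (S.le_left i)

theorem StoppedScaling.right_pos (S : StoppedScaling x ε p q a b) (i : Fin n) : 0 < b i :=
  lt_of_lt_of_le (by positivity) (S.le_right i)

theorem StoppedScaling.factorBound (S : StoppedScaling x ε p q a b)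
    (hE : 1 ≤ Real.exp (scaleUnit n ε)) :
    FactorBound (fun i k => a i * featureMatrix x ε i k) (fun j k => b j * featureMatrix x ε j k)
      (Real.exp (scaleUnit n ε) ^ 184) := by
  have h1 := S.left_pos
  have h2 := S.right_pos
  have h3 := S.left_le
  have h4 := S.right_le
  have hV := featureMatrix_bound x ε
  have e : (Real.exp (scaleUnit n ε)) ^ 92 ≤ (Real.exp (scaleUnit n ε)) ^ 184 :=
    pow_le_pow_right₀ hE (by norm_num)
  generalize featureMatrix x ε = V at *
  refine ⟨fun i k => ?_, fun i k => ?_, fun i j => ?_⟩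
  · rw [abs_mul, abs_of_pos (h1 i)]
    exact (mul_le_of_le_one_right (h1 i).le (hV.left i k)).trans ((h3 i).trans e)
  · rw [abs_mul, abs_of_pos (h2 i)]
    exact (mul_le_of_le_one_right (h2 i).le (hV.left i k)).trans ((h4 i).trans e)
  · calc ∑ k, |a i * V i k| * |b j * V j k| = a i * b j * ∑ k, |V i k| * |V j k| := by
          rw [Finset.mul_sum]
          refine Finset.sum_congr rfl fun k _ => ?_
          rw [abs_mul, abs_mul, abs_of_pos (h1 i), abs_of_pos (h2 j)]; ring
      _ ≤ a i * b j := mul_le_of_le_one_right (mul_pos (h1 i) (h2 j)).le (hV.prod i j)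
      _ ≤ _ := mul_le_mul (h3 i) (h4 j) (h2 j).le (by positivity)
      _ = _ := by rw [← pow_add]

include hn hε hε1 hx

theorem StoppedScaling.le_entry (S : StoppedScaling x ε p q a b) (i j : Fin n) :
    1 / Real.exp (scaleUnit n ε) ^ 287 ≤ factorProd (fun i k => a i * featureMatrix x ε i k)
      (fun j k => b j * featureMatrix x ε j k) i j := by
  have h := exp_neg_pow_le_taylorKernel hn hε hε1 (hx i) (hx j)
  rw [Real.exp_neg, inv_pow, ← one_div] at h
  rw [factorProd_scale, factorProd_featureMatrix]
  calc 1 / Real.exp (scaleUnit n ε) ^ 287 = 1 / Real.exp (scaleUnit n ε) ^ 103 *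
        (1 / Real.exp (scaleUnit n ε) ^ 81) * (1 / Real.exp (scaleUnit n ε) ^ 103) := by
        rw [div_mul_div_comm, div_mul_div_comm, ← pow_add, ← pow_add]; norm_num
    _ ≤ _ := mul_le_mul (mul_le_mul (S.le_left i) h (by positivity) (S.left_pos i).le)
        (S.le_right j) (by positivity)
        (mul_nonneg (S.left_pos i).le (le_trans (by positivity) h))

theorem StoppedScaling.cost_le (S : StoppedScaling x ε p q a b)
    (hp : p ∈ stdSimplex ℝ (Fin n)) (hq : q ∈ stdSimplex ℝ (Fin n))
    {P : Matrix (Fin n) (Fin n) ℝ} (hP : P ∈ transportPolytope p q) :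
    ∑ i, ∑ j, rounded (factorProd (fun i k => a i * featureMatrix x ε i k)
      (fun j k => b j * featureMatrix x ε j k)) p q i j * ‖x i - x j‖ ^ 2 ≤
      ∑ i, ∑ j, P i j * ‖x i - x j‖ ^ 2 + ε := by
  have hK : ∀ i j, 0 < factorProd (featureMatrix x ε) (featureMatrix x ε) i j := fun i j =>
    (pow_pos (Real.exp_pos _) 81).trans_le
      (exp_neg_pow_le_taylorKernel hn hε hε1 (hx i) (hx j))
  have hsymm : ∀ i j, factorProd (featureMatrix x ε) (featureMatrix x ε) i j =
      factorProd (featureMatrix x ε) (featureMatrix x ε) j i := fun i j =>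
    taylorKernel_comm _ _ _ _
  refine rounded_cost_le_add hn hε hε1 (H := scaleUnit n ε)
    (by rw [scaleUnit, mul_div_cancel₀ _ hε.ne']) (C := fun i j => ‖x i - x j‖ ^ 2)
    (fun i j => by positivity) (fun i j => ?_) hK (fun i j => ?_) hp hq S.left_pos S.right_pos
    (factorProd_scale _ a b) ?_ S.left_osc S.right_osc ?_ hP
  · have := (norm_sub_le (x i) (x j)).trans (add_le_add (hx i) (hx j))
    nlinarith [norm_nonneg (x i - x j)]
  · exact abs_log_taylorKernel_sub_le hn hε hε1 (hx i) (hx j)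
  · simp only [factorProd_scale]
    exact S.mass
  · refine le_of_eq_of_le ?_ S.error
    simp only [factorProd_scale, marginalError, scaledMarginal, Finset.mul_sum]
    congr 1
    · exact Finset.sum_congr rfl fun i _ => by
        congr 2; exact Finset.sum_congr rfl fun j _ => by ring
    · exact Finset.sum_congr rfl fun j _ => by
        congr 2; exact Finset.sum_congr rfl fun i _ => by rw [hsymm i j]; ring

section Parameters

omit hx

theorem mul_scaleUnit_le {k : ℝ} (hk : k ≤ 2 ^ 10) :
    k * scaleUnit n ε ≤ Real.exp (scaleUnit n ε) ^ 11 := by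
  have h1 := two_le_exp hn hε hε1
  have h2 := scaleUnit_pos hn hε hε1
  have h3 := Real.add_one_le_exp (scaleUnit n ε)
  calc k * scaleUnit n ε ≤ Real.exp (scaleUnit n ε) ^ 10 * Real.exp (scaleUnit n ε) :=
        mul_le_mul (hk.trans (pow_le_pow_left₀ two_pos.le h1 10)) (by linarith) h2.le
          (by positivity)
    _ = _ := by ring

/-- The scalar parameters of the algorithm are computed in constant time. -/
theorem runsIn_parameters {α : Type} {f : ℕ → ℝ → RAM ℓ α} {v : α} {T : ℕ}
    (h : RunsIn (f ⌈300 * Real.log n / ε⌉₊ (bandwidth n ε)) v T) :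
    RunsIn (do
      let logn ← log (← lit n)
      let η ← div (← mul (← lit 20) logn) ε
      let M ← ceil (← div (← mul (← lit 300) logn) ε)
      let s ← div (← lit 1) (← sqrt (← mul (← lit 2) η))
      f M s) v (14 * charge ℓ (Real.exp (scaleUnit n ε) ^ 500) + T) := by
  have hE2 := two_le_exp hn hε hε1
  have hnE := card_le_exp hn hε hε1
  have hl := log_ge hn hε hε1
  have hlH := log_le_scaleUnit hn hε hε1
  have hb0 := bandwidth_pos hn hε hε1
  have hb1 := bandwidth_le_one hn hε hε1
  have hH := fun {k : ℝ} => mul_scaleUnit_le (k := k) hn hε hε1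
  norm_num at hl
  have hB : Real.exp (scaleUnit n ε) ^ 11 ≤ Real.exp (scaleUnit n ε) ^ 500 :=
    pow_le_pow_right₀ (by linarith) (by norm_num)
  have h2B : (2 : ℝ) ^ 11 ≤ Real.exp (scaleUnit n ε) ^ 11 := pow_le_pow_left₀ two_pos.le hE2 11
  have hEB : Real.exp (scaleUnit n ε) ≤ Real.exp (scaleUnit n ε) ^ 500 :=
    le_self_pow₀ (by linarith) (by norm_num)
  have e : ∀ k : ℝ, k * Real.log n / ε = k * scaleUnit n ε := fun k => mul_div_assoc _ _ _
  have hdiv : ∀ k : ℝ, 0 ≤ k → k ≤ 2 ^ 10 →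
      |k * Real.log n / ε| ≤ Real.exp (scaleUnit n ε) ^ 500 := fun k hk hk' => by
    rw [e, abs_of_nonneg (mul_nonneg hk (by linarith))]
    exact (hH hk').trans hB
  have hmul : ∀ k : ℝ, 0 ≤ k → k ≤ 2 ^ 10 →
      |k * Real.log n| ≤ Real.exp (scaleUnit n ε) ^ 500 := fun k hk hk' => by
    rw [abs_of_nonneg (mul_nonneg hk (by linarith))]
    exact (mul_le_mul_of_nonneg_left hlH hk).trans ((hH hk').trans hB)
  norm_num at h2B
  have l1 : RunsIn (ℓ := ℓ) (lit n) n (charge ℓ (Real.exp (scaleUnit n ε) ^ 500)) :=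
    runsIn_lit (hnE.trans hEB)
  have l20 : RunsIn (ℓ := ℓ) (lit 20) 20 (charge ℓ (Real.exp (scaleUnit n ε) ^ 500)) := by
    simpa using runsIn_lit (ℓ := ℓ) (k := 20) (B := Real.exp (scaleUnit n ε) ^ 500)
      (by norm_num; linarith)
  have l300 : RunsIn (ℓ := ℓ) (lit 300) 300 (charge ℓ (Real.exp (scaleUnit n ε) ^ 500)) := by
    simpa using runsIn_lit (ℓ := ℓ) (k := 300) (B := Real.exp (scaleUnit n ε) ^ 500)
      (by norm_num; linarith)
  have l2 : RunsIn (ℓ := ℓ) (lit 2) 2 (charge ℓ (Real.exp (scaleUnit n ε) ^ 500)) := by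
    simpa using runsIn_lit (ℓ := ℓ) (k := 2) (B := Real.exp (scaleUnit n ε) ^ 500)
      (by norm_num; linarith)
  have l11 : RunsIn (ℓ := ℓ) (lit 1) 1 (charge ℓ (Real.exp (scaleUnit n ε) ^ 500)) := by
    simpa using runsIn_lit (ℓ := ℓ) (k := 1) (B := Real.exp (scaleUnit n ε) ^ 500)
      (by norm_num; linarith)
  have h40 : 2 * (20 * Real.log n / ε) = 40 * Real.log n / ε := by ring
  have hd := hdiv 40 (by norm_num) (by norm_num)
  refine RunsIn.mono (l1.bind ((runsIn_log ?_).bind (l20.bind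
    ((runsIn_mul (hmul 20 (by norm_num) (by norm_num))).bind
    ((runsIn_div (hdiv 20 (by norm_num) (by norm_num))).bind (l300.bind
    ((runsIn_mul (hmul 300 (by norm_num) (by norm_num))).bind
    ((runsIn_div (hdiv 300 (by norm_num) (by norm_num))).bind
    ((runsIn_ceil (hdiv 300 (by norm_num) (by norm_num))).bind
    (l11.bind (l2.bind ((runsIn_mul (h40 ▸ hd)).bind ((runsIn_sqrt ?_).bind ((runsIn_div ?_).bind
    h)))))))))))))) (by ring_nf; rfl)
  · simpa using hmul 1 (by norm_num) (by norm_num)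
  · rw [h40]
    refine (Real.sqrt_le_sqrt ((le_abs_self _).trans hd)).trans ?_
    rw [Real.sqrt_le_left (by positivity)]
    nlinarith
  · change |bandwidth n ε| ≤ _
    rw [abs_of_pos hb0]
    linarith

end Parameters

theorem StoppedScaling.runsIn_output (hd : 1 ≤ d) (S : StoppedScaling x ε p q a b)
    (hp : p ∈ stdSimplex ℝ (Fin n)) (hq : q ∈ stdSimplex ℝ (Fin n))
    (hr : 1 ≤ (exponents d ⌈300 * Real.log n / ε⌉₊).length) :
    RunsIn (ℓ := ℓ) (do
      let L ← diagMul a (featureMatrix x ε)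
      let R ← diagMul b (featureMatrix x ε)
      let P ← round L R p q
      let W ← quadCost x p q P
      return (P, W))
      (roundedFactors (fun i k => a i * featureMatrix x ε i k)
        (fun j k => b j * featureMatrix x ε j k) p q,
      quadCostValue x p q (roundedFactors (fun i k => a i * featureMatrix x ε i k)
        (fun j k => b j * featureMatrix x ε j k) p q))
      (170 * (n * (exponents d ⌈300 * Real.log n / ε⌉₊).length *
        charge ℓ (Real.exp (scaleUnit n ε) ^ 500)) * d) := by
  have hE2 := two_le_exp hn hε hε1
  have hnE := card_le_exp hn hε hε1
  have hFB := S.factorBound (by linarith)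
  have hle := S.le_entry hn hε hε1 hx
  generalize featureMatrix x ε = V at *
  generalize Real.exp (scaleUnit n ε) = E at *
  have h1E : 1 ≤ E := by linarith
  set L := fun i k => a i * V i k
  set R := fun i k => b i * V i k
  have hF0 : ∀ i j, 0 ≤ factorProd L R i j := fun i j => le_trans (by positivity) (hle i j)
  have hA : E ^ 184 + 1 ≤ E ^ 185 := by
    have := one_le_pow₀ h1E (n := 184)
    rw [pow_succ]; nlinarith
  have h4 : ∀ k ≤ 185, 4 * n ^ 2 * E ^ k ≤ E ^ 500 := fun k hk => by
    calc 4 * n ^ 2 * E ^ k ≤ E ^ 2 * E ^ 2 * E ^ k := by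
          gcongr; nlinarith
      _ = E ^ (4 + k) := by ring
      _ ≤ _ := pow_le_pow_right₀ h1E (by omega)
  have hB : E ^ 184 ≤ E ^ 500 := pow_le_pow_right₀ h1E (by norm_num)
  refine RunsIn.mono ((runsIn_diagMul fun i k => (hFB.left i k).trans hB).bind
    ((runsIn_diagMul fun i k => (hFB.right i k).trans hB).bind
    ((runsIn_round (by omega) hr hp hq hFB (one_le_pow₀ h1E) (h4 184 (by norm_num)) hF0
      (row_ratio_le hE2 hle hp) (col_ratio_le (by omega) hE2 hnE hle
        (fun i j => (le_abs_self _).trans (hFB.abs_factorProd_le i j)) hp hq)).bind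
    ((runsIn_quadCost (P := roundedFactors L R p q) (by omega) hd hx hp hq (Nat.le_add_left 1 _)
      ((factorBound_roundedFactors hFB (by positivity) hF0 hp hq).mono hA) (one_le_pow₀ h1E)
      (h4 185 le_rfl)).bind (runsIn_pure _))))) ?_
  change _ + (_ + (_ + (30 * (n * (_ + 1) * _ * d) + 0))) ≤ _
  have hQ := one_le_charge ℓ (E ^ 500)
  generalize charge ℓ (E ^ 500) = Q at *
  generalize (exponents d ⌈300 * Real.log n / ε⌉₊).length = r at *
  have a1 : n ≤ n * r * Q := by nlinarith [Nat.mul_le_mul hr hQ]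
  have a5 : n * r ≤ n * r * Q := Nat.le_mul_of_pos_right _ hQ
  have a3 : n * Q ≤ n * r * Q := by nlinarith [Nat.mul_le_mul_left (n * Q) hr]
  have a6 : n * Q * d ≤ n * r * Q * d := Nat.mul_le_mul_right d a3
  have a7 : n * r * Q ≤ n * r * Q * d := Nat.le_mul_of_pos_right _ hd
  linarith

theorem exists_runsIn_algorithm (hd : 1 ≤ d) (hp : p ∈ stdSimplex ℝ (Fin n))
    (hq : q ∈ stdSimplex ℝ (Fin n)) : ∃ (a b : Fin n → ℝ) (N : ℕ), StoppedScaling x ε p q a b ∧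
      (N : ℝ) ≤ 3 + 14560 * (scaleUnit n ε / ε) ∧
      RunsIn (ℓ := ℓ) (algorithm x p q ε)
        (roundedFactors (fun i k => a i * featureMatrix x ε i k)
          (fun j k => b j * featureMatrix x ε j k) p q,
        quadCostValue x p q (roundedFactors (fun i k => a i * featureMatrix x ε i k)
          (fun j k => b j * featureMatrix x ε j k) p q))
        (320 * (n * (exponents d ⌈300 * Real.log n / ε⌉₊).length *
          charge ℓ (Real.exp (scaleUnit n ε) ^ 500)) * (d + ⌈300 * Real.log n / ε⌉₊ + N)) := by
  obtain ⟨N, hN1, hN2, hN3⟩ := exists_stopping_time hn hε hε1 hx hp hq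
  have S := stoppedScaling hn hε hε1 hx hp hq hN2
  have D := scalingData_features hn hε hε1 hx hp hq
  refine ⟨_, _, N, S, hN1, ?_⟩
  have hM1 : 1 ≤ ⌈300 * Real.log n / ε⌉₊ := by
    have := log_ge hn hε hε1
    norm_num at this
    exact Nat.one_le_iff_ne_zero.2 (Nat.ceil_pos.2 (by positivity)).ne'
  have hr : 1 ≤ (exponents d ⌈300 * Real.log n / ε⌉₊).length := by
    rw [length_exponents d _ hM1]
    exact Nat.choose_pos (Nat.le_add_left _ _)
  have hE2 := two_le_exp hn hε hε1
  have hnE := card_le_exp hn hε hε1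
  have hMB : ((⌈300 * Real.log n / ε⌉₊ : ℕ) : ℝ) ≤ Real.exp (scaleUnit n ε) ^ 500 := by
    have := log_ge hn hε hε1
    norm_num at this
    have h1 := Nat.ceil_lt_add_one (a := 300 * Real.log n / ε) (by positivity)
    have h2 := mul_scaleUnit_le hn hε hε1 (k := 300) (by norm_num)
    have h3 : 300 * Real.log n / ε = 300 * scaleUnit n ε := mul_div_assoc _ _ _
    calc _ ≤ Real.exp (scaleUnit n ε) ^ 11 + 1 := by linarith
      _ ≤ Real.exp (scaleUnit n ε) ^ 12 := by
        rw [pow_succ _ 11]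
        nlinarith [one_le_pow₀ (by linarith : 1 ≤ Real.exp (scaleUnit n ε)) (n := 11)]
      _ ≤ _ := pow_le_pow_right₀ (by linarith) (by norm_num)
  have hsB : 1 / (bandwidth n ε * bandwidth n ε) ≤ Real.exp (scaleUnit n ε) ^ 500 := by
    rw [← sq, bandwidth_sq hn hε hε1, one_div_one_div]
    exact (mul_scaleUnit_le hn hε hε1 (by norm_num)).trans
      (pow_le_pow_right₀ (by linarith) (by norm_num))
  have hAB : 5 * n ^ 2 * (1 / (1 / Real.exp (scaleUnit n ε) ^ 81 * (ε / 80 / n / n))) ^ 2 ≤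
      Real.exp (scaleUnit n ε) ^ 500 := by
    have h1 := inv_kappa_mu_le hn hε hε1 (mu_pos hn hε)
    have h0 : 0 ≤ 1 / (1 / Real.exp (scaleUnit n ε) ^ 81 * (ε / 80 / n / n)) := by positivity
    generalize 1 / (1 / Real.exp (scaleUnit n ε) ^ 81 * (ε / 80 / n / n)) = A at *
    generalize Real.exp (scaleUnit n ε) = E at *
    have h5 : 5 ≤ E ^ 3 := le_trans (by norm_num) (pow_le_pow_left₀ two_pos.le hE2 3)
    calc 5 * n ^ 2 * A ^ 2 ≤ E ^ 3 * E ^ 2 * (E ^ 92) ^ 2 := by gcongr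
      _ = E ^ 189 := by ring
      _ ≤ _ := pow_le_pow_right₀ (by linarith) (by norm_num)
  have h3B : (2 : ℝ) ^ 11 ≤ Real.exp (scaleUnit n ε) ^ 500 :=
    (pow_le_pow_left₀ two_pos.le hE2 11).trans (pow_le_pow_right₀ (by linarith) (by norm_num))
  norm_num at h3B
  have hEB : Real.exp (scaleUnit n ε) ≤ Real.exp (scaleUnit n ε) ^ 500 :=
    le_self_pow₀ (by linarith) (by norm_num)
  have l10 : RunsIn (ℓ := ℓ) (lit 10) 10 (charge ℓ (Real.exp (scaleUnit n ε) ^ 500)) := by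
    simpa using runsIn_lit (ℓ := ℓ) (k := 10) (B := Real.exp (scaleUnit n ε) ^ 500)
      (by norm_num; linarith)
  have hδ : |ε / 10| ≤ Real.exp (scaleUnit n ε) ^ 500 := by
    rw [abs_of_pos (by positivity)]; linarith
  have out := S.runsIn_output (ℓ := ℓ) hn hε hε1 hx hd hp hq hr
  refine RunsIn.mono (runsIn_parameters hn hε hε1
    ((runsIn_taylorGKM (by omega) hM1 (by linarith) (bandwidth_pos hn hε hε1)
      (bandwidth_le_one hn hε hε1) hsB hMB hx).bind
    (l10.bind ((runsIn_div hδ).bind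
    ((runsIn_sinkhorn hr hp hq D (featureMatrix_bound x ε) (hnE.trans hEB) (by linarith) hAB
      (by positivity) (by linarith) hN2 hN3).bind out))))) ?_
  clear out S D hN1 hN2 hN3
  have hQ := one_le_charge ℓ (Real.exp (scaleUnit n ε) ^ 500)
  generalize charge ℓ (Real.exp (scaleUnit n ε) ^ 500) = Q at *
  generalize (exponents d ⌈300 * Real.log n / ε⌉₊).length = r at *
  generalize ⌈300 * Real.log n / ε⌉₊ = M
  have a5 : Q ≤ n * r * Q := by
    nlinarith [Nat.mul_le_mul_left Q (Nat.mul_le_mul (by omega : 1 ≤ n) hr)]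
  generalize n * r * Q = X at *
  have a7 : X ≤ X * d := Nat.le_mul_of_pos_right _ hd
  ring_nf
  linarith [Nat.zero_le (X * M), Nat.zero_le (X * N)]

end Setting

/-- The bound on the running time in terms of `n`, `d` and `ε`. -/
theorem time_le {n d r Q M N : ℕ} (hn : 2 ≤ n) {ε : ℝ} (hε : 0 < ε) (hε1 : ε < 1) (hd : 1 ≤ d)
    {D : ℝ} (hM : M = ⌈300 * Real.log n / ε⌉₊) (hr : r = (M - 1 + d).choose d)
    (hQ : (Q : ℝ) ≤ D * scaleUnit n ε) (hN : (N : ℝ) ≤ 3 + 14560 * (scaleUnit n ε / ε)) :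
    ((320 * (n * r * Q) * (d + M + N) : ℕ) : ℝ) ≤ 320 * 14860 * D *
      (n * (d * Real.log n / ε ^ 2) *
        (Real.exp 1 + 900 * Real.log n / (ε * d)) ^ (d + 1)) := by
  have hH := scaleUnit_pos hn hε hε1
  have hd1 : (1 : ℝ) ≤ d := by exact_mod_cast hd
  have eH : ∀ k : ℝ, k * Real.log n / ε = k * scaleUnit n ε := fun k => mul_div_assoc _ _ _
  have e1 : 900 * Real.log n / (ε * d) = 900 * scaleUnit n ε / d := by rw [← div_div, eH]
  have e2 : d * Real.log n / ε ^ 2 = d * scaleUnit n ε / ε := by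
    rw [sq, ← div_div, eH]
  rw [e1, e2]
  rw [eH] at hM
  have hM1 : (M : ℝ) ≤ 300 * scaleUnit n ε + 1 := by
    rw [hM]; exact (Nat.ceil_lt_add_one (by positivity)).le
  have hM2 : ((M - 1 : ℕ) : ℝ) ≤ 300 * scaleUnit n ε := by
    rcases Nat.eq_zero_or_pos M with h | h
    · rw [h]; simp; positivity
    · rw [Nat.cast_sub h]; push_cast; linarith
  generalize scaleUnit n ε = H at *
  have he3 : Real.exp 1 ≤ 3 := by linarith [Real.exp_one_lt_d9]
  have he1 : 1 ≤ Real.exp 1 := Real.one_le_exp zero_le_one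
  have hr1 : (r : ℝ) ≤ (Real.exp 1 + 900 * H / d) ^ d := by
    rw [hr]
    refine (choose_le_exp_pow hd).trans (pow_le_pow_left₀ (by positivity) ?_ d)
    have : Real.exp 1 * ((M - 1 : ℕ) : ℝ) ≤ 900 * H := by
      calc Real.exp 1 * ((M - 1 : ℕ) : ℝ) ≤ 3 * (300 * H) := by gcongr
        _ = _ := by ring
    gcongr
  have hY : d + H ≤ d * (Real.exp 1 + 900 * H / d) := by
    rw [mul_add, mul_div_cancel₀ _ (by positivity)]
    nlinarith
  have hs : (d : ℝ) + M + N ≤ 14860 * (d * (Real.exp 1 + 900 * H / d) / ε) := by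
    have h1 : (d + H) / ε ≤ d * (Real.exp 1 + 900 * H / d) / ε := by gcongr
    have h2 : (d : ℝ) ≤ d / ε := le_div_self (by positivity) hε hε1.le
    have h3 : H ≤ H / ε := le_div_self hH.le hε hε1.le
    rw [add_div] at h1
    linarith
  have hY0 : 0 ≤ Real.exp 1 + 900 * H / d := by positivity
  generalize Real.exp 1 + 900 * H / d = Y at *
  have hDH : 0 ≤ D * H := (Nat.cast_nonneg Q).trans hQ
  push_cast
  calc 320 * ((n : ℝ) * r * Q) * (d + M + N) ≤
        320 * (n * Y ^ d * (D * H)) * (14860 * (d * Y / ε)) := by gcongr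
    _ = _ := by ring

end FastOT

end
theorem theorem1 :
    -- for every constant `c`, numbers being kept to `ℓ ≤ c log n / ε` binary places,
    -- there is a constant `C` that depends on `c` only
    ∀ c : ℝ, ∃ C : ℝ, 0 < C ∧
      ∀ (n d ℓ : ℕ), 2 ≤ n → 1 ≤ d →
      ∀ (x : Fin n → EuclideanSpace ℝ (Fin d)), (∀ i, ‖x i‖ ≤ 1) →
      ∀ (p q : Fin n → ℝ), p ∈ stdSimplex ℝ (Fin n) → q ∈ stdSimplex ℝ (Fin n) →
      ∀ ε : ℝ, 0 < ε → ε < 1 → (ℓ : ℝ) ≤ c * (Real.log n / ε) →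
      ∃ (P : FastOT.Factored n) (W : ℝ) (T : ℕ),
        (FastOT.algorithm (ℓ := ℓ) x p q ε).HaltsWith (P, W) T ∧
        P.toMatrix ∈ FastOT.transportPolytope p q ∧
        P.rank ≤ 1 + (⌈300 * Real.log n / ε⌉₊ - 1 + d).choose d ∧
        W = ∑ i, ∑ j, P.toMatrix i j * ‖x i - x j‖ ^ 2 ∧
        W ≤ (FastOT.wasserstein 2 (FastOT.discreteMeasure x p)
              (FastOT.discreteMeasure x q)).toReal ^ 2 + ε ∧
        (T : ℝ) ≤ C * (n * (d * Real.log n / ε ^ 2) *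
          (Real.exp 1 + 900 * Real.log n / (ε * d)) ^ (d + 1)) := by
  intro c
  refine ⟨320 * 14860 * (|c| + 800), by positivity, ?_⟩
  intro n d ℓ hn hd x hx p q hp hq ε hε hε1 hℓ
  obtain ⟨a, b, N, S, hN, hrun⟩ :=
    FastOT.exists_runsIn_algorithm (ℓ := ℓ) hn hε hε1 hx hd hp hq
  obtain ⟨T, hT, hmem⟩ := hrun 0
  have hF : ∀ i j, 0 ≤ FastOT.factorProd (fun i k => a i * FastOT.featureMatrix x ε i k)
      (fun j k => b j * FastOT.featureMatrix x ε j k) i j := fun i j =>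
    le_trans (by positivity) (S.le_entry hn hε hε1 hx i j)
  have hP := FastOT.rounded_mem hF hp hq
  have hlen : (FastOT.exponents d ⌈300 * Real.log n / ε⌉₊).length =
      (⌈300 * Real.log n / ε⌉₊ - 1 + d).choose d := by
    have := FastOT.log_ge hn hε hε1
    norm_num at this
    exact FastOT.length_exponents d _ (Nat.ceil_pos.2 (by positivity))
  rw [← FastOT.toMatrix_roundedFactors] at hP
  have hW := FastOT.quadCostValue_eq (x := x) hP
  refine ⟨_, _, T, hmem, hP, ?_, hW, ?_, ?_⟩
  · change _ + 1 ≤ _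
    rw [hlen, add_comm]
  · rw [hW, ← sub_le_iff_le_add]
    refine FastOT.le_wasserstein_sq hp.1 hq.1 ⟨_, hP⟩ fun P' hP' => ?_
    rw [sub_le_iff_le_add, FastOT.toMatrix_roundedFactors]
    exact S.cost_le hn hε hε1 hx hp hq hP'
  · refine le_trans ?_ (FastOT.time_le hn hε hε1 hd rfl hlen
      (FastOT.charge_le hn hε hε1 hℓ) hN)
    rw [zero_add] at hT
    exact_mod_cast hT
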